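/- Let $A$ be a unital $C^*$-algebra, $G$ a discrete group and $(\rho,\sigma)$ a twisted action of $G$ on $A$: maps $\rho:G\to\operatorname{Aut}(A)$ and $\sigma:G\times G\to U(A)$ with $\rho_x(\sigma_{y,z})=\sigma_{x,y}\sigma_{xy,z}\sigma_{x,yz}^*$, $\rho_x\rho_y=\operatorname{Ad}(\sigma_{x,y})\rho_{xy}$, $\sigma_{x,e}=\sigma_{e,x}=1$ and $\rho_e=\operatorname{id}$. Let $(\mathcal A,H,D,\pi)$ be an odd spectral triple on $A$ with $\pi$ faithful: $\mathcal A\subseteq A$ is a dense unital $*$-subalgebra, $\pi:A\to\mathbb B(H)$ a faithful unital representation, $D$ a self-adjoint operator on $H$ with $(1+D^2)^{-1/2}$ compact, and every $\pi(a)$ with $a\in\mathcal A$ preserves $\operatorname{Dom}D$ and has bounded commutator with $D$. Suppose that the twisted action is smooth ($\rho_x(\mathcal A)\subseteq\mathcal A$ and $\sigma_{x,y}\in\mathcal A$ for all $x,y$) and that the triple is twisted equivariant: there are unitaries $U_g$ $(g\in G)$ on $H$ with $U_xU_y=\pi(\sigma_{x,y})U_{xy}$ and $\pi(\rho_x(a))=U_x\pi(a)U_x^*$,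 which preserve $\operatorname{Dom}D$ and for which each $[D,U_g]$ is bounded. Let $V$ be a finite-dimensional Hilbert space and let $\ell:G\to\mathbb B(V)$ be a function with self-adjoint values that is translation bounded ($\sup_x\|\ell(x)-\ell(y^{-1}x)\|<\infty$ for every $y$) and proper ($\ell(g)=0$ iff $g=e$; the union of the spectra of all $\ell(x)$ is a closed discrete subset of $\mathbb R$; each of its points lies in the spectrum of $\ell(x)$ for only finitely many $x$). Let $A\rtimes G$ be the full twisted crossed product and $A\rtimes_rG$ the reduced one, the latter being generated by the operators $a\delta_x$ on $\ell^2(G,H)$, $(a\delta_x)(\xi\otimes\delta_y)=\pi(\rho_{y^{-1}x^{-1}}(a)\sigma_{y^{-1}x^{-1},x})\xi\otimes\delta_{xy}$. Let $C_c(G,\mathcal A)\subseteq A\rtimes_rG$ be the set of finite sums $\sum_g a_g\delta_g$ with $a_g\in\mathcal A$, and let $C^*_r(G)$ be generated by the left translations $\delta_g=\lambda_g$ on $\ell^2(G)$. Let $B\subseteq\mathbb B(H)$ be the $C^*$-algebra generated by the operators $\pi(a)U_g$, and $\mathcal B\subseteq B$ the set of finite sums $\sum_g\pi(a_g)U_g$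 with $a_g\in\mathcal A$. Let $M_\ell$ be the closure of $\delta_x\otimes v\mapsto\delta_x\otimes\ell(x)v$ on $\mathbb C G\otimes V$. All $C^*$-tensor products are minimal. Then the following hold. 1. The integrated form of $(\pi,U)$ is a unital $*$-homomorphism $\pi\times U:A\rtimes G\to\mathbb B(H)$, $a\delta_g\mapsto\pi(a)U_g$, with image $B$. 2. There is an injective unital $*$-homomorphism $\phi_A^r:A\rtimes_rG\to(A\rtimes G)\otimes C_r^*(G)$ with $\phi_A^r(a\delta_g)=a\delta_g\otimes\delta_g$. The map $(\pi\times U)\otimes\operatorname{id}:(A\rtimes G)\otimes C_r^*(G)\to B\otimes C_r^*(G)$ exists, and we put $\psi_A=((\pi\times U)\otimes\operatorname{id})\circ\phi_A^r:A\rtimes_rG\to B\otimes C^*_r(G)$. 3. The equivariant construction gives an even spectral triple $(C_c(G,\mathcal A),\widetilde H,\widetilde D,\hat\pi\times\hat L)$ on $A\rtimes_rG$. Here $\widetilde H=(H\otimes\ell^2(G)\otimes V)^{\oplus2}$ with the standard grading. The representation is two copies of $a\delta_h\mapsto\pi(a)U_h\otimes\lambda_h\otimes1_V$, which is well defined on $A\rtimes_rG$.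 The operator $\widetilde D$ is the closure of $\begin{pmatrix}0&D\otimes1-i\,1\otimes M_\ell\\ D\otimes1+i\,1\otimes M_\ell&0\end{pmatrix}$ on two copies of the algebraic tensor product $\operatorname{Dom}D\otimes\mathbb C G\otimes V$. 4. $(\mathcal B,H,D)$, with the inclusion $B\subseteq\mathbb B(H)$, is an odd spectral triple on $B$. Likewise $(C_c(G),\ell^2(G)\otimes V,M_\ell)$, with the representation $\delta_g\mapsto\lambda_g\otimes1_V$, is an odd spectral triple on $C_r^*(G)$. Their exterior product exists and is an even spectral triple on $B\otimes C_r^*(G)$. It has smooth algebra $\mathcal B\otimes_{\rm alg}C_c(G)$, acts on $\widetilde H$ with the standard grading by two copies of the tensor product representation, and its Dirac operator is the closure of the same matrix on two copies of $\operatorname{Dom}D\otimes_{\rm alg}\operatorname{Dom}M_\ell$. 5. The triple in 3 is the restriction via $\psi_A$ of the exterior product in 4: $\psi_A$ is injective, maps $C_c(G,\mathcal A)$ into $\mathcal B\otimes_{\rm alg}C_c(G)$, and the representation of the triple in 3 is that of the exterior product composed with $\psi_A$, while the Hilbert spaces, gradings and Dirac operators coincide. -/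

import Mathlib

open scoped TensorProduct

universe u v w w'

noncomputable section

/-! ### Hilbert space tensor products, direct sums and weighted shifts -/

/-- The Hilbert space tensor product: the completion of the algebraic tensor product. -/
def HilbertTensor (E : Type u) (F : Type v) [NormedAddCommGroup E] [InnerProductSpace ℂ E]
    [NormedAddCommGroup F] [InnerProductSpace ℂ F] : Type (max u v) :=
  UniformSpace.Completion (E ⊗[ℂ] F)

namespace HilbertTensor

variable (E : Type u) (F : Type v) [NormedAddCommGroup E] [InnerProductSpace ℂ E]
  [NormedAddCommGroup F] [InnerProductSpace ℂ F]

instance instNormedAddCommGroup : NormedAddCommGroup (HilbertTensor E F) :=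
  inferInstanceAs (NormedAddCommGroup (UniformSpace.Completion (E ⊗[ℂ] F)))

instance instInnerProductSpace : InnerProductSpace ℂ (HilbertTensor E F) :=
  inferInstanceAs (InnerProductSpace ℂ (UniformSpace.Completion (E ⊗[ℂ] F)))

instance instCompleteSpace : CompleteSpace (HilbertTensor E F) :=
  inferInstanceAs (CompleteSpace (UniformSpace.Completion (E ⊗[ℂ] F)))

/-- The isometric inclusion of the algebraic tensor product. -/
def incl : E ⊗[ℂ] F →ₗᵢ[ℂ] HilbertTensor E F :=
  (UniformSpace.Completion.toComplₗᵢ : E ⊗[ℂ] F →ₗᵢ[ℂ] UniformSpace.Completion (E ⊗[ℂ] F))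

theorem denseRange_incl : DenseRange (incl E F) :=
  UniformSpace.Completion.denseRange_coe (α := E ⊗[ℂ] F)

end HilbertTensor

/-- The Hilbert space direct sum `K ⊕ K`. -/
abbrev Double (K : Type u) [NormedAddCommGroup K] [InnerProductSpace ℂ K] : Type u :=
  WithLp 2 (K × K)

/-- The Hilbert space `ℓ²(G)`. -/
abbrev L2 (G : Type u) : Type u := lp (fun _ : G => ℂ) 2

section Operators

variable {E : Type u} {F : Type v} [NormedAddCommGroup E] [InnerProductSpace ℂ E]
  [NormedAddCommGroup F] [InnerProductSpace ℂ F]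

/-- The bounded operator `S ⊗ T` on the Hilbert space tensor product. -/
def tensorOp (S : E →L[ℂ] E) (T : F →L[ℂ] F) : HilbertTensor E F →L[ℂ] HilbertTensor E F :=
  ((HilbertTensor.incl E F).toContinuousLinearMap.comp (TensorProduct.mapL S T)).extend
    (HilbertTensor.incl E F).toContinuousLinearMap

theorem tensorOp_incl (S : E →L[ℂ] E) (T : F →L[ℂ] F) (t : E ⊗[ℂ] F) :
    tensorOp S T (HilbertTensor.incl E F t) = HilbertTensor.incl E F (TensorProduct.mapL S T t) :=
  ContinuousLinearMap.extend_eq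
    ((HilbertTensor.incl E F).toContinuousLinearMap.comp (TensorProduct.mapL S T))
    (e := (HilbertTensor.incl E F).toContinuousLinearMap)
    (HilbertTensor.denseRange_incl E F) (HilbertTensor.incl E F).isometry.isUniformInducing t

theorem tensorOp_ext {X Y : HilbertTensor E F →L[ℂ] HilbertTensor E F}
    (h : ∀ t : E ⊗[ℂ] F, X (HilbertTensor.incl E F t) = Y (HilbertTensor.incl E F t)) : X = Y :=
  DFunLike.coe_injective <|
    (HilbertTensor.denseRange_incl E F).equalizer X.continuous Y.continuous (funext h)

theorem tensorOp_mul (S S' : E →L[ℂ] E) (T T' : F →L[ℂ] F) :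
    tensorOp (S * S') (T * T') = tensorOp S T * tensorOp S' T' :=
  tensorOp_ext fun t => by
    simp only [mul_apply_eq_comp, tensorOp_incl, TensorProduct.mapL_mul]

theorem tensorOp_one : tensorOp (1 : E →L[ℂ] E) (1 : F →L[ℂ] F) = 1 :=
  tensorOp_ext fun t => by
    rw [tensorOp_incl]
    exact congrArg _ (DFunLike.congr_fun (TensorProduct.mapL_id_id (𝕜 := ℂ)) t)

theorem tensorOp_add_left (S S' : E →L[ℂ] E) (T : F →L[ℂ] F) :
    tensorOp (S + S') T = tensorOp S T + tensorOp S' T :=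
  tensorOp_ext fun t => by
    simp only [add_apply, tensorOp_incl, TensorProduct.mapL_add_left, map_add]

theorem tensorOp_smul_left (c : ℂ) (S : E →L[ℂ] E) (T : F →L[ℂ] F) :
    tensorOp (c • S) T = c • tensorOp S T :=
  tensorOp_ext fun t => by
    simp only [smul_apply, tensorOp_incl, TensorProduct.mapL_smul_left, map_smul]

theorem tensorOp_star [CompleteSpace E] [CompleteSpace F] (S : E →L[ℂ] E) (T : F →L[ℂ] F) :
    tensorOp (star S) (star T) = star (tensorOp S T) := by
  rw [ContinuousLinearMap.star_eq_adjoint (tensorOp S T), ContinuousLinearMap.eq_adjoint_iff]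
  intro x y
  refine (HilbertTensor.denseRange_incl E F).induction_on₂ (isClosed_eq (by fun_prop) (by fun_prop))
    (fun s t => ?_) x y
  rw [tensorOp_incl, tensorOp_incl, LinearIsometry.inner_map_map, LinearIsometry.inner_map_map]
  induction s using TensorProduct.induction_on with
  | zero => simp
  | add a b ha hb => simp only [map_add, inner_add_left, ha, hb]
  | tmul a b =>
    induction t using TensorProduct.induction_on with
    | zero => simp
    | add c d hc hd => simp only [map_add, inner_add_right, hc, hd]
    | tmul c d =>
      simp [ContinuousLinearMap.star_eq_adjoint, ContinuousLinearMap.adjoint_inner_left]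

/-- The amplification `S ↦ S ⊗ 1`, as a unital `*`-homomorphism. -/
def amplify (E : Type u) (F : Type v) [NormedAddCommGroup E] [InnerProductSpace ℂ E]
    [NormedAddCommGroup F] [InnerProductSpace ℂ F] [CompleteSpace E] [CompleteSpace F] :
    (E →L[ℂ] E) →⋆ₐ[ℂ] (HilbertTensor E F →L[ℂ] HilbertTensor E F) where
  toFun S := tensorOp S 1
  map_one' := tensorOp_one
  map_mul' S S' := by rw [← tensorOp_mul, one_mul]
  map_zero' := by simpa using tensorOp_smul_left (0 : ℂ) (0 : E →L[ℂ] E) (1 : F →L[ℂ] F)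
  map_add' S S' := tensorOp_add_left S S' 1
  commutes' c := by
    rw [Algebra.algebraMap_eq_smul_one, Algebra.algebraMap_eq_smul_one, tensorOp_smul_left,
      tensorOp_one]
  map_star' S := by rw [← tensorOp_star, star_one]

/-- The operator `T ⊕ T` on `E ⊕ E`. -/
def doubleOp (T : E →L[ℂ] E) : Double E →L[ℂ] Double E :=
  (WithLp.prodContinuousLinearEquiv 2 ℂ E E).symm.toContinuousLinearMap ∘L
    (T.prodMap T) ∘L (WithLp.prodContinuousLinearEquiv 2 ℂ E E).toContinuousLinearMap

/-- The standard grading `(ξ, η) ↦ (ξ, -η)` of `E ⊕ E`. -/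
def stdGrading (E : Type u) [NormedAddCommGroup E] [InnerProductSpace ℂ E] :
    Double E →L[ℂ] Double E :=
  (WithLp.prodContinuousLinearEquiv 2 ℂ E E).symm.toContinuousLinearMap ∘L
    ((1 : E →L[ℂ] E).prodMap (-1 : E →L[ℂ] E)) ∘L
      (WithLp.prodContinuousLinearEquiv 2 ℂ E E).toContinuousLinearMap

end Operators

section Shift

variable {ι : Type u} {E : ι → Type v} [∀ i, NormedAddCommGroup (E i)]
  [∀ i, InnerProductSpace ℂ (E i)]

theorem shift_memℓp (e : ι ≃ ι) (T : ∀ i, E (e i) →L[ℂ] E i) (C : ℝ)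
    (hC : ∀ i, ‖T i‖ ≤ C) (f : lp E 2) : Memℓp (fun i => T i (f (e i))) 2 := by
  have hf : Summable fun i => ‖f (e i)‖ ^ (2 : ℕ) := by
    have h := (lp.memℓp f).summable (by simp)
    have h' : Summable fun i => ‖f i‖ ^ (2 : ℕ) := by simpa using h
    exact (e.summable_iff (f := fun i => ‖f i‖ ^ (2 : ℕ))).mpr h'
  refine memℓp_gen ?_
  refine Summable.of_nonneg_of_le (fun i => by positivity) (fun i => ?_) (hf.mul_left (C ^ 2))
  have h1 : ‖T i (f (e i))‖ ≤ C * ‖f (e i)‖ :=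
    ((T i).le_opNorm _).trans (mul_le_mul_of_nonneg_right (hC i) (norm_nonneg _))
  have h2 : ‖T i (f (e i))‖ ^ 2 ≤ (C * ‖f (e i)‖) ^ 2 := by gcongr
  simpa [mul_pow] using h2

/-- The underlying linear map of the weighted shift. -/
def weightedShiftₗ (e : ι ≃ ι) (T : ∀ i, E (e i) →L[ℂ] E i) (C : ℝ)
    (hC : ∀ i, ‖T i‖ ≤ C) : lp E 2 →ₗ[ℂ] lp E 2 where
  toFun f := ⟨fun i => T i (f (e i)), shift_memℓp e T C hC f⟩
  map_add' f g := by
    ext i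
    exact (T i).map_add (f (e i)) (g (e i))
  map_smul' c f := by
    ext i
    exact (T i).map_smul c (f (e i))

theorem norm_weightedShiftₗ_le (e : ι ≃ ι) (T : ∀ i, E (e i) →L[ℂ] E i) (C : ℝ)
    (hC : ∀ i, ‖T i‖ ≤ C) (f : lp E 2) : ‖weightedShiftₗ e T C hC f‖ ≤ |C| * ‖f‖ := by
  have h2 : (0 : ℝ) < (2 : ENNReal).toReal := by simp
  refine lp.norm_le_of_forall_sum_le h2 (by positivity) fun s => ?_
  have h1 : ∀ i ∈ s, ‖weightedShiftₗ e T C hC f i‖ ^ (2 : ENNReal).toReal ≤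
      |C| ^ (2 : ENNReal).toReal * ‖f (e i)‖ ^ (2 : ENNReal).toReal := by
    intro i _
    rw [← Real.mul_rpow (abs_nonneg _) (norm_nonneg _)]
    refine Real.rpow_le_rpow (norm_nonneg _) ?_ h2.le
    exact ((T i).le_opNorm _).trans
      (mul_le_mul_of_nonneg_right ((hC i).trans (le_abs_self C)) (norm_nonneg _))
  refine (Finset.sum_le_sum h1).trans ?_
  rw [← Finset.mul_sum, Real.mul_rpow (abs_nonneg _) (norm_nonneg _)]
  refine mul_le_mul_of_nonneg_left ?_ (by positivity)
  have h3 := lp.sum_rpow_le_norm_rpow h2 f (s.map e.toEmbedding)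
  rwa [Finset.sum_map] at h3

/-- The weighted shift `(X f)(i) = Tᵢ (f (e i))` on `⨁₂ Eᵢ`, for a permutation `e` and uniformly
bounded operators `Tᵢ`. -/
def weightedShift (e : ι ≃ ι) (T : ∀ i, E (e i) →L[ℂ] E i) (C : ℝ)
    (hC : ∀ i, ‖T i‖ ≤ C) : lp E 2 →L[ℂ] lp E 2 :=
  (weightedShiftₗ e T C hC).mkContinuous |C| (norm_weightedShiftₗ_le e T C hC)

theorem weightedShift_apply (e : ι ≃ ι) (T : ∀ i, E (e i) →L[ℂ] E i) (C : ℝ)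
    (hC : ∀ i, ‖T i‖ ≤ C) (f : lp E 2) (i : ι) : weightedShift e T C hC f i = T i (f (e i)) :=
  rfl

end Shift

/-! ### Concrete C*-algebras -/

section CStar

variable {K : Type u} [NormedAddCommGroup K] [InnerProductSpace ℂ K] [CompleteSpace K]
  {L : Type v} [NormedAddCommGroup L] [InnerProductSpace ℂ L] [CompleteSpace L]

/-- The closed unital `*`-algebra of operators generated by a set `s`. -/
def cstarGen (s : Set (K →L[ℂ] K)) : StarSubalgebra ℂ (K →L[ℂ] K) :=
  (StarAlgebra.adjoin ℂ s).topologicalClosure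

theorem mem_cstarGen {s : Set (K →L[ℂ] K)} {T : K →L[ℂ] K} (hT : T ∈ s) : T ∈ cstarGen s :=
  StarSubalgebra.le_topologicalClosure _ (StarAlgebra.subset_adjoin ℂ s hT)

theorem isClosed_cstarGen (s : Set (K →L[ℂ] K)) : IsClosed (cstarGen s : Set (K →L[ℂ] K)) :=
  StarSubalgebra.isClosed_topologicalClosure _

instance instCompleteCstarGen (s : Set (K →L[ℂ] K)) : CompleteSpace (cstarGen s) :=
  (isClosed_cstarGen s).completeSpace_coe

/-- The unital C*-algebra of operators generated by a set `s`, as a type. -/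
def OpAlg (s : Set (K →L[ℂ] K)) : Type u := cstarGen s

instance OpAlg.instCStarAlgebra (s : Set (K →L[ℂ] K)) : CStarAlgebra (OpAlg s) :=
  { (inferInstance : NormedRing (cstarGen s)), (inferInstance : StarRing (cstarGen s)),
    (inferInstance : CompleteSpace (cstarGen s)), (inferInstance : CStarRing (cstarGen s)),
    (inferInstance : NormedAlgebra ℂ (cstarGen s)),
    (inferInstance : StarModule ℂ (cstarGen s)) with }

/-- The inclusion of the C*-algebra generated by `s` in the algebra of all bounded operators. -/
def OpAlg.val (s : Set (K →L[ℂ] K)) : OpAlg s →⋆ₐ[ℂ] (K →L[ℂ] K) := (cstarGen s).subtype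

/-- An element of `s`, as an element of the C*-algebra generated by `s`. -/
def OpAlg.gen {s : Set (K →L[ℂ] K)} (T : K →L[ℂ] K) (hT : T ∈ s) : OpAlg s := ⟨T, mem_cstarGen hT⟩

/-- The operators `b ⊗ c`. -/
def tensorGen (s : Set (K →L[ℂ] K)) (t : Set (L →L[ℂ] L)) :
    Set (HilbertTensor K L →L[ℂ] HilbertTensor K L) :=
  {T | ∃ (b : OpAlg s) (c : OpAlg t), T = tensorOp (OpAlg.val s b) (OpAlg.val t c)}

/-- The minimal (spatial) tensor product of two C*-algebras of operators on `K` and `L`: the closed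
span of the operators `b ⊗ c` on the Hilbert space tensor product of `K` and `L`. -/
abbrev MinTensor (s : Set (K →L[ℂ] K)) (t : Set (L →L[ℂ] L)) : Type (max u v) :=
  OpAlg (tensorGen s t)

/-- The elementary tensor `b ⊗ c` in the minimal tensor product. -/
def MinTensor.tmul {s : Set (K →L[ℂ] K)} {t : Set (L →L[ℂ] L)} (b : OpAlg s) (c : OpAlg t) :
    MinTensor s t :=
  OpAlg.gen (tensorOp (OpAlg.val s b) (OpAlg.val t c)) ⟨b, c, rfl⟩

end CStar

/-! ### Spectral triples -/

section Triples

/-- `[D, T]` is defined on the domain of `D` and extends to a bounded operator. -/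
def HasBoundedCommutator {H : Type v} [NormedAddCommGroup H] [InnerProductSpace ℂ H]
    (D : H →ₗ.[ℂ] H) (T : H →L[ℂ] H) : Prop :=
  ∃ h : ∀ ξ : D.domain, T ξ ∈ D.domain,
    ∃ C : H →L[ℂ] H, ∀ ξ : D.domain, D ⟨T ξ, h ξ⟩ - T (D ξ) = C ξ

/-- `S = (1 + D²)^(-1/2)`: the positive bounded operator whose square inverts `1 + D²`. -/
def IsInvSqrtOneAddSq {H : Type v} [NormedAddCommGroup H] [InnerProductSpace ℂ H] [CompleteSpace H]
    (D : H →ₗ.[ℂ] H) (S : H →L[ℂ] H) : Prop :=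
  S.IsPositive ∧ ∀ ξ : H, ∃ (h₁ : S (S ξ) ∈ D.domain) (h₂ : D ⟨S (S ξ), h₁⟩ ∈ D.domain),
    S (S ξ) + D ⟨D ⟨S (S ξ), h₁⟩, h₂⟩ = ξ

/-- The data `(𝒜, H, D, π)` of a candidate spectral triple on `A`. -/
structure TripleData (A : Type u) [CStarAlgebra A] (H : Type v) [NormedAddCommGroup H]
    [InnerProductSpace ℂ H] [CompleteSpace H] where
  /-- the smooth subalgebra -/
  alg : Submodule ℂ A
  /-- the representation -/
  rep : A →⋆ₐ[ℂ] (H →L[ℂ] H)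
  /-- the Dirac operator -/
  dirac : H →ₗ.[ℂ] H

/-- The data of a candidate even spectral triple on `A`. -/
structure EvenTripleData (A : Type u) [CStarAlgebra A] (H : Type v) [NormedAddCommGroup H]
    [InnerProductSpace ℂ H] [CompleteSpace H] extends TripleData A H where
  /-- the grading operator -/
  grading : H →L[ℂ] H

variable {A : Type u} [CStarAlgebra A] {H : Type v} [NormedAddCommGroup H]
    [InnerProductSpace ℂ H] [CompleteSpace H]

/-- Odd spectral triples on the unital C*-algebra `A`. -/
structure IsSpectralTriple (T : TripleData A H) : Prop where
  one_mem : (1 : A) ∈ T.alg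
  mul_mem : ∀ a ∈ T.alg, ∀ b ∈ T.alg, a * b ∈ T.alg
  star_mem : ∀ a ∈ T.alg, star a ∈ T.alg
  dense : Dense (T.alg : Set A)
  selfAdjoint : IsSelfAdjoint T.dirac
  compact : ∃ S : H →L[ℂ] H, IsInvSqrtOneAddSq T.dirac S ∧ IsCompactOperator S
  commutator : ∀ a ∈ T.alg, HasBoundedCommutator T.dirac (T.rep a)

/-- Even spectral triples on the unital C*-algebra `A`. -/
structure IsEvenSpectralTriple (T : EvenTripleData A H) : Prop
    extends IsSpectralTriple T.toTripleData where
  grading_selfAdjoint : IsSelfAdjoint T.grading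
  grading_sq : T.grading * T.grading = 1
  grading_comm : ∀ a : A, T.rep a * T.grading = T.grading * T.rep a
  grading_dirac : ∃ h : ∀ ξ : T.dirac.domain, T.grading ξ ∈ T.dirac.domain,
    ∀ ξ : T.dirac.domain, T.dirac ⟨T.grading ξ, h ξ⟩ = -T.grading (T.dirac ξ)

/-- `Q` is the pullback of the (even) triple `P` under the smooth unital morphism `ψ`. -/
structure IsPullback {A' : Type w} [CStarAlgebra A'] (ψ : A' →⋆ₐ[ℂ] A) (P : EvenTripleData A H)
    (Q : EvenTripleData A' H) : Prop where
  smooth : ∀ a ∈ Q.alg, ψ a ∈ P.alg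
  rep : Q.rep = P.rep.comp ψ
  dirac : Q.dirac = P.dirac
  grading : Q.grading = P.grading

/-- `Q` is the restriction of `P` via `ψ`: the pullback under a unital inclusion. -/
def IsRestriction {A' : Type w} [CStarAlgebra A'] (ψ : A' →⋆ₐ[ℂ] A) (P : EvenTripleData A H)
    (Q : EvenTripleData A' H) : Prop :=
  Function.Injective ψ ∧ IsPullback ψ P Q

end Triples

/-! ### The exterior product of odd triples -/

/-- The operator `e t ↦ d t` with domain the range of an injective linear map `e`. -/
def pmapOfParam {X : Type u} {E : Type v} [AddCommGroup X] [Module ℂ X] [AddCommGroup E]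
    [Module ℂ E] (e : X →ₗ[ℂ] E) (he : Function.Injective e) (d : X →ₗ[ℂ] E) : E →ₗ.[ℂ] E where
  domain := LinearMap.range e
  toFun := d ∘ₗ (LinearEquiv.ofInjective e he).symm.toLinearMap

section Exterior

variable {H₁ : Type u} [NormedAddCommGroup H₁] [InnerProductSpace ℂ H₁]
  {H₂ : Type v} [NormedAddCommGroup H₂] [InnerProductSpace ℂ H₂]

/-- The inclusion of the algebraic tensor product of two subspaces in the Hilbert space tensor
product. -/
def coreIncl (E : Submodule ℂ H₁) (F : Submodule ℂ H₂) : E ⊗[ℂ] F →ₗ[ℂ] HilbertTensor H₁ H₂ :=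
  (HilbertTensor.incl H₁ H₂).toLinearMap ∘ₗ TensorProduct.map E.subtype F.subtype

theorem coreIncl_injective (E : Submodule ℂ H₁) (F : Submodule ℂ H₂) :
    Function.Injective (coreIncl E F) :=
  (HilbertTensor.incl H₁ H₂).injective.comp
    (TensorProduct.map_injective_of_flat_flat _ _ E.injective_subtype F.injective_subtype)

/-- `D₁ ⊗ 1 + c (1 ⊗ D₂)` on the algebraic tensor product of the domains. -/
def tensorSum (D₁ : H₁ →ₗ.[ℂ] H₁) (D₂ : H₂ →ₗ.[ℂ] H₂) (c : ℂ) :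
    D₁.domain ⊗[ℂ] D₂.domain →ₗ[ℂ] HilbertTensor H₁ H₂ :=
  (HilbertTensor.incl H₁ H₂).toLinearMap ∘ₗ
    (TensorProduct.map D₁.toFun D₂.domain.subtype +
      c • TensorProduct.map D₁.domain.subtype D₂.toFun)

/-- The inclusion of two copies of the algebraic tensor product of two subspaces. -/
def doubleIncl (E : Submodule ℂ H₁) (F : Submodule ℂ H₂) :
    (E ⊗[ℂ] F) × (E ⊗[ℂ] F) →ₗ[ℂ] Double (HilbertTensor H₁ H₂) :=
  (WithLp.linearEquiv 2 ℂ (HilbertTensor H₁ H₂ × HilbertTensor H₁ H₂)).symm.toLinearMap ∘ₗ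
    (coreIncl E F).prodMap (coreIncl E F)

theorem doubleIncl_injective (E : Submodule ℂ H₁) (F : Submodule ℂ H₂) :
    Function.Injective (doubleIncl E F) :=
  (WithLp.linearEquiv 2 ℂ (HilbertTensor H₁ H₂ × HilbertTensor H₁ H₂)).symm.injective.comp
    ((coreIncl_injective E F).prodMap (coreIncl_injective E F))

/-- The matrix `((0, D₁ ⊗ 1 - i 1 ⊗ D₂), (D₁ ⊗ 1 + i 1 ⊗ D₂, 0))` on two copies of the algebraic
tensor product of the domains. -/
def prodDiracCore (D₁ : H₁ →ₗ.[ℂ] H₁) (D₂ : H₂ →ₗ.[ℂ] H₂) :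
    Double (HilbertTensor H₁ H₂) →ₗ.[ℂ] Double (HilbertTensor H₁ H₂) :=
  pmapOfParam (doubleIncl D₁.domain D₂.domain) (doubleIncl_injective _ _)
    ((WithLp.linearEquiv 2 ℂ (HilbertTensor H₁ H₂ × HilbertTensor H₁ H₂)).symm.toLinearMap ∘ₗ
      LinearMap.prod (tensorSum D₁ D₂ (-Complex.I) ∘ₗ LinearMap.snd ℂ _ _)
        (tensorSum D₁ D₂ Complex.I ∘ₗ LinearMap.fst ℂ _ _))

/-- The closure of the above operator. -/
def prodDirac (D₁ : H₁ →ₗ.[ℂ] H₁) (D₂ : H₂ →ₗ.[ℂ] H₂) :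
    Double (HilbertTensor H₁ H₂) →ₗ.[ℂ] Double (HilbertTensor H₁ H₂) :=
  (prodDiracCore D₁ D₂).closure

variable [CompleteSpace H₁] [CompleteSpace H₂]
  {K₁ : Type w} [NormedAddCommGroup K₁] [InnerProductSpace ℂ K₁] [CompleteSpace K₁]
  {K₂ : Type w'} [NormedAddCommGroup K₂] [InnerProductSpace ℂ K₂] [CompleteSpace K₂]

/-- `P` is the exterior product of the odd triples `T₁`, `T₂` on C*-algebras of operators. The
values of the representation on elementary tensors determine it. -/
structure IsExteriorProduct {s₁ : Set (K₁ →L[ℂ] K₁)} {s₂ : Set (K₂ →L[ℂ] K₂)}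
    (T₁ : TripleData (OpAlg s₁) H₁) (T₂ : TripleData (OpAlg s₂) H₂)
    (P : EvenTripleData (MinTensor s₁ s₂) (Double (HilbertTensor H₁ H₂))) : Prop where
  alg : P.alg = Submodule.span ℂ {t | ∃ b ∈ T₁.alg, ∃ c ∈ T₂.alg, t = MinTensor.tmul b c}
  rep : ∀ b c, P.rep (MinTensor.tmul b c) = doubleOp (tensorOp (T₁.rep b) (T₂.rep c))
  dirac : P.dirac = prodDirac T₁.dirac T₂.dirac
  grading : P.grading = stdGrading _

end Exterior

/-! ### Twisted dynamical systems and crossed products -/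

/-- A twisted action `(ρ, σ)` of the discrete group `G` on the unital C*-algebra `A`. -/
structure TwistedSystem (A : Type u) [CStarAlgebra A] (G : Type v) [Group G] where
  ρ : G → (A ≃⋆ₐ[ℂ] A)
  σ : G → G → unitary A
  cocycle : ∀ x y z, ρ x (σ y z : A) = (σ x y : A) * (σ (x * y) z : A) * star (σ x (y * z) : A)
  action : ∀ x y a, ρ x (ρ y a) = (σ x y : A) * ρ (x * y) a * star (σ x y : A)
  σ_one_right : ∀ x, σ x 1 = 1
  σ_one_left : ∀ x, σ 1 x = 1
  ρ_one : ∀ a, ρ 1 a = a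

/-- The twisted action restricts to the subalgebra `𝒜`. -/
def TwistedSystem.IsSmooth {A : Type u} [CStarAlgebra A] {G : Type v} [Group G]
    (S : TwistedSystem A G) (𝒜 : Submodule ℂ A) : Prop :=
  (∀ x, ∀ a ∈ 𝒜, S.ρ x a ∈ 𝒜) ∧ ∀ x y, (S.σ x y : A) ∈ 𝒜

/-- Twisted covariant representations on the Hilbert space `K`. -/
structure CovariantRep {A : Type u} [CStarAlgebra A] {G : Type v} [Group G] (S : TwistedSystem A G)
    (K : Type w) [NormedAddCommGroup K] [InnerProductSpace ℂ K] [CompleteSpace K] where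
  π : A →⋆ₐ[ℂ] (K →L[ℂ] K)
  U : G → unitary (K →L[ℂ] K)
  mul : ∀ x y, (U x : K →L[ℂ] K) * U y = π (S.σ x y) * U (x * y)
  cov : ∀ x a, π (S.ρ x a) = (U x : K →L[ℂ] K) * π a * star (U x : K →L[ℂ] K)

/-- The operator `π(a) Uₓ`, image of `a δₓ` under the integrated form. -/
def CovariantRep.op {A : Type u} [CStarAlgebra A] {G : Type v} [Group G] {S : TwistedSystem A G}
    {K : Type w} [NormedAddCommGroup K] [InnerProductSpace ℂ K] [CompleteSpace K]
    (R : CovariantRep S K) (a : A) (x : G) : K →L[ℂ] K :=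
  R.π a * R.U x

theorem CovariantRep.norm_op_le {A : Type u} [CStarAlgebra A] {G : Type v} [Group G]
    {S : TwistedSystem A G} {K : Type w} [NormedAddCommGroup K] [InnerProductSpace ℂ K]
    [CompleteSpace K] (R : CovariantRep S K) (a : A) (x : G) : ‖R.op a x‖ ≤ ‖a‖ := by
  rw [CovariantRep.op, CStarRing.norm_mul_coe_unitary]
  exact NonUnitalStarAlgHom.norm_apply_le R.π a

section Crossed

variable {A G : Type u} [CStarAlgebra A] [Group G]

/-- All twisted covariant representations on Hilbert spaces. -/
structure SomeCovariantRep (S : TwistedSystem A G) : Type (u + 1) where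
  K : Type u
  [group : NormedAddCommGroup K]
  [inner : InnerProductSpace ℂ K]
  [complete : CompleteSpace K]
  rep : CovariantRep S K

attribute [instance] SomeCovariantRep.group SomeCovariantRep.inner SomeCovariantRep.complete

/-- The Hilbert space of the universal covariant representation. -/
abbrev UnivSpace (S : TwistedSystem A G) : Type (u + 1) :=
  lp (fun R : SomeCovariantRep S => R.K) 2

/-- The image of `a δₓ` in the universal covariant representation, the direct sum of all the
covariant representations. -/
def univOp (S : TwistedSystem A G) (a : A) (x : G) : UnivSpace S →L[ℂ] UnivSpace S :=
  weightedShift (E := fun R : SomeCovariantRep S => R.K) (Equiv.refl _)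
    (fun R => R.rep.op a x) ‖a‖ (fun R => R.rep.norm_op_le a x)

/-- Generators of the full twisted crossed product. -/
def univGen (S : TwistedSystem A G) : Set (UnivSpace S →L[ℂ] UnivSpace S) :=
  {T | ∃ a x, T = univOp S a x}

/-- The full twisted crossed product `A ⋊ G`: the C*-algebra generated by the universal covariant
representation, so that its norm is the supremum over all covariant representations. -/
abbrev FullCrossed (S : TwistedSystem A G) : Type (u + 1) :=
  OpAlg (univGen S)

/-- The element `a δₓ` of the full twisted crossed product. -/
def fullδ (S : TwistedSystem A G) (a : A) (x : G) : FullCrossed S :=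
  OpAlg.gen (univOp S a x) ⟨a, x, rfl⟩

variable {H : Type u} [NormedAddCommGroup H] [InnerProductSpace ℂ H] [CompleteSpace H]

/-- The left regular representation on `ℓ²(G, H)` induced by `π`:
`(a δₓ)(ξ ⊗ δ_y) = π(ρ_{y⁻¹x⁻¹}(a) σ_{y⁻¹x⁻¹,x}) ξ ⊗ δ_{xy}`, that is
`((a δₓ) f)(z) = π(ρ_{z⁻¹}(a) σ_{z⁻¹,x}) f(x⁻¹z)`. -/
def regOp (S : TwistedSystem A G) (π : A →⋆ₐ[ℂ] (H →L[ℂ] H)) (a : A) (x : G) :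
    lp (fun _ : G => H) 2 →L[ℂ] lp (fun _ : G => H) 2 :=
  weightedShift (E := fun _ : G => H) (Equiv.mulLeft x⁻¹)
    (fun z => π (S.ρ z⁻¹ a * S.σ z⁻¹ x)) ‖a‖ (fun z => by
      refine (NonUnitalStarAlgHom.norm_apply_le π _).trans ?_
      rw [CStarRing.norm_mul_coe_unitary]
      exact NonUnitalStarAlgHom.norm_apply_le (S.ρ z⁻¹).toStarAlgHom a)

/-- Generators of the reduced twisted crossed product. -/
def regGen (S : TwistedSystem A G) (π : A →⋆ₐ[ℂ] (H →L[ℂ] H)) :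
    Set (lp (fun _ : G => H) 2 →L[ℂ] lp (fun _ : G => H) 2) :=
  {T | ∃ a x, T = regOp S π a x}

/-- The reduced twisted crossed product `A ⋊_r G`, defined by a faithful representation `π`. -/
abbrev ReducedCrossed (S : TwistedSystem A G) (π : A →⋆ₐ[ℂ] (H →L[ℂ] H)) : Type u :=
  OpAlg (regGen S π)

/-- The element `a δₓ` of the reduced twisted crossed product. -/
def redδ (S : TwistedSystem A G) (π : A →⋆ₐ[ℂ] (H →L[ℂ] H)) (a : A) (x : G) :
    ReducedCrossed S π :=
  OpAlg.gen (regOp S π a x) ⟨a, x, rfl⟩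

/-- Generators of the C*-algebra of a covariant representation. -/
def repGen {S : TwistedSystem A G} (R : CovariantRep S H) : Set (H →L[ℂ] H) :=
  {T | ∃ a x, T = R.op a x}

/-- The C*-algebra `B ⊆ 𝔹(H)` generated by the operators `π(a) Uₓ`. -/
abbrev RepAlg {S : TwistedSystem A G} (R : CovariantRep S H) : Type u :=
  OpAlg (repGen R)

/-- The element `π(a) Uₓ` of `B`. -/
def repδ {S : TwistedSystem A G} (R : CovariantRep S H) (a : A) (x : G) : RepAlg R :=
  OpAlg.gen (R.op a x) ⟨a, x, rfl⟩

end Crossed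

/-! ### The reduced group C*-algebra and length functions -/

section Fibre

variable {G : Type u} {V : Type v} [NormedAddCommGroup V] [InnerProductSpace ℂ V]

open Classical in
/-- `δₓ ∈ ℓ²(G)`. -/
def L2.δ (x : G) : L2 G := lp.single 2 x (1 : ℂ)

/-- The embedding `ℂG ⊗ V → ℓ²(G) ⊗ V`, `∑ δₓ ⊗ vₓ ↦ ∑ δₓ ⊗ vₓ`, composed with a fibrewise
operator `m` on `V`. -/
def fibreMap (m : G → V →ₗ[ℂ] V) : (G →₀ V) →ₗ[ℂ] HilbertTensor (L2 G) V :=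
  Finsupp.lsum ℂ fun x =>
    (HilbertTensor.incl (L2 G) V).toLinearMap ∘ₗ
      (TensorProduct.mk ℂ (L2 G) V (L2.δ x)) ∘ₗ m x

theorem fibreMap_injective :
    Function.Injective (fibreMap (G := G) fun _ => (LinearMap.id : V →ₗ[ℂ] V)) := by
  classical
  rw [← LinearMap.ker_eq_bot, LinearMap.ker_eq_bot']
  intro f hf
  ext y
  have key : ∀ (g : G →₀ V) (w : V),
      inner ℂ (HilbertTensor.incl (L2 G) V (L2.δ y ⊗ₜ[ℂ] w))
        (fibreMap (fun _ => (LinearMap.id : V →ₗ[ℂ] V)) g) = inner ℂ w (g y) := by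
    intro g w
    induction g using Finsupp.induction_linear with
    | zero => simp
    | add a b ha hb => rw [map_add, inner_add_right, ha, hb, Finsupp.add_apply, inner_add_right]
    | single x v =>
      simp only [fibreMap, Finsupp.lsum_single, LinearMap.comp_apply, TensorProduct.mk_apply,
        LinearMap.id_apply, LinearIsometry.coe_toLinearMap,
        LinearIsometry.inner_map_map, TensorProduct.inner_tmul, L2.δ, lp.inner_single_left,
        lp.single_apply, Finsupp.single_apply]
      by_cases h : x = y
      · subst h; simp
      · simp [h, Ne.symm h]
  have h0 := key f (f y)
  rw [hf, inner_zero_right] at h0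
  exact inner_self_eq_zero.mp h0.symm

end Fibre

section Length

variable {G : Type u} [Group G]

/-- The left regular representation `λ_g δₓ = δ_{gx}` on `ℓ²(G)`. -/
def leftReg (g : G) : L2 G →L[ℂ] L2 G :=
  weightedShift (E := fun _ : G => ℂ) (Equiv.mulLeft g⁻¹) (fun _ => ContinuousLinearMap.id ℂ ℂ) 1
    (fun _ => ContinuousLinearMap.norm_id_le)

/-- Generators of the reduced group C*-algebra. -/
def grpGen (G : Type u) [Group G] : Set (L2 G →L[ℂ] L2 G) :=
  {T | ∃ g, T = leftReg g}

/-- The reduced group C*-algebra `C*_r(G)`. -/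
abbrev ReducedGroupAlg (G : Type u) [Group G] : Type u :=
  OpAlg (grpGen G)

/-- The element `δ_g` of `C*_r(G)`. -/
def grpδ (g : G) : ReducedGroupAlg G :=
  OpAlg.gen (leftReg g) ⟨g, rfl⟩

variable {V : Type v} [NormedAddCommGroup V] [InnerProductSpace ℂ V]

/-- The union of the spectra of the self-adjoint operators `ℓ(x)`. -/
def lengthSpectrum (ℓ : G → V →L[ℂ] V) : Set ℝ :=
  {t | ∃ x, (t : ℂ) ∈ spectrum ℂ (ℓ x)}

/-- Proper translation bounded functions with values in the self-adjoint operators on `V`. -/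
structure IsProperLength [CompleteSpace V] (ℓ : G → V →L[ℂ] V) : Prop where
  selfAdjoint : ∀ x, IsSelfAdjoint (ℓ x)
  translation : ∀ y, ∃ C : ℝ, ∀ x, ‖ℓ x - ℓ (y⁻¹ * x)‖ ≤ C
  eq_zero_iff : ∀ x, ℓ x = 0 ↔ x = 1
  closed : IsClosed (lengthSpectrum ℓ)
  discrete : IsDiscrete (lengthSpectrum ℓ)
  finite : ∀ t ∈ lengthSpectrum ℓ, {x | (t : ℂ) ∈ spectrum ℂ (ℓ x)}.Finite

/-- Multiplication by `ℓ`, `δₓ ⊗ v ↦ δₓ ⊗ ℓ(x) v`, on the algebraic tensor product `ℂG ⊗ V`. -/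
def lengthCore (ℓ : G → V →L[ℂ] V) : HilbertTensor (L2 G) V →ₗ.[ℂ] HilbertTensor (L2 G) V :=
  pmapOfParam (fibreMap fun _ => (LinearMap.id : V →ₗ[ℂ] V)) fibreMap_injective
    (fibreMap fun x => (ℓ x).toLinearMap)

/-- The Dirac operator `M_ℓ`: the closure of multiplication by `ℓ`. -/
def lengthDirac (ℓ : G → V →L[ℂ] V) : HilbertTensor (L2 G) V →ₗ.[ℂ] HilbertTensor (L2 G) V :=
  (lengthCore ℓ).closure

/-- The triple `(C_c(G), ℓ²(G) ⊗ V, M_ℓ, λ)` on `C*_r(G)`, where `λ(δ_g) = λ_g ⊗ 1`. -/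
def groupTriple [CompleteSpace V] (ℓ : G → V →L[ℂ] V) :
    TripleData (ReducedGroupAlg G) (HilbertTensor (L2 G) V) where
  alg := Submodule.span ℂ (Set.range grpδ)
  rep := (amplify (L2 G) V).comp (OpAlg.val (grpGen G))
  dirac := lengthDirac ℓ

end Length

/-! ### The equivariant construction -/

section Equivariant

variable {A G : Type u} [CStarAlgebra A] [Group G]
  {H : Type u} [NormedAddCommGroup H] [InnerProductSpace ℂ H] [CompleteSpace H]

/-- The triple `(ℬ, H, D)` on `B`, with `ℬ` the finite sums of `π(a) U_g`, `a ∈ 𝒜`. -/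
def repTriple {S : TwistedSystem A G} (R : CovariantRep S H) (𝒜 : Submodule ℂ A)
    (D : H →ₗ.[ℂ] H) : TripleData (RepAlg R) H where
  alg := Submodule.span ℂ {b | ∃ a ∈ 𝒜, ∃ g, b = repδ R a g}
  rep := OpAlg.val (repGen R)
  dirac := D

variable {V : Type v} [NormedAddCommGroup V] [InnerProductSpace ℂ V] [CompleteSpace V]

/-- `Q` is the triple `(C_c(G, 𝒜), H̃, D̃, π̂ × L̂)` on `A ⋊_r G` given by the equivariant construction.
The representation is two copies of `a δ_h ↦ π(a) U_h ⊗ λ_h ⊗ 1`, whose values on the elements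
`a δ_h` determine it. -/
structure IsEquivariantTriple {S : TwistedSystem A G} (R : CovariantRep S H) (𝒜 : Submodule ℂ A)
    (D : H →ₗ.[ℂ] H) (ℓ : G → V →L[ℂ] V)
    (Q : EvenTripleData (ReducedCrossed S R.π) (Double (HilbertTensor H (HilbertTensor (L2 G) V)))) :
    Prop where
  alg : Q.alg = Submodule.span ℂ {t | ∃ a ∈ 𝒜, ∃ g, t = redδ S R.π a g}
  rep : ∀ a h, Q.rep (redδ S R.π a h) =
    doubleOp (tensorOp (R.op a h) (tensorOp (leftReg h) (1 : V →L[ℂ] V)))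
  dirac : Q.dirac = prodDirac D (lengthCore ℓ)
  grading : Q.grading = stdGrading _

end Equivariant

end

/-! The theorem has an operator-algebraic half and an analytic half, which meet only in the last
step.

On the C*-side everything rests on Fell absorption. The unitary `k ⊗ δ_z ↦ U_{z⁻¹} k ⊗ δ_z`
conjugates `π(a) Uₓ ⊗ λₓ` into the regular representation induced by `π`
(`CovariantRep.fellEquiv_conj`). The norm of a finite sum in a regular representation is a supremum
over finite corners, which are matrices over `A`; hence a faithful `π` dominates every other
representation (`HasMatrix.norm_le`). Applied to the universal covariant representation, this bounds
`∑ a_g δ_g ⊗ δ_g` by the reduced norm, so the coaction exists. Conjugating `ψ` with the Fell unitary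
of `(π, U)` itself gives back the inclusion of `A ⋊_r G`, so `ψ` is injective, and with it the
coaction. The integrated form is a compression of the universal representation to one summand.
Compressions can be tensored with the identity, and a `*`-homomorphism with dense range is onto.

On the analytic side everything is diagonal. An operator with compact resolvent has an eigenbasis
(`exists_eigenbasis`), and `M_ℓ` has one made of vectors `δₓ ⊗ v`. Over `bᵢ ⊗ cⱼ` the exterior
product matrix is `((0, z̄), (z, 0))` with `z = μᵢ + i νⱼ`, with eigenvalues `±|z|`. A symmetric
operator whose domain contains a Hilbert basis of eigenvectors has the maximal diagonal operator as
its closure (`closure_eq_diagOp`). This yields self-adjointness and compact resolvent. It also shows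
that the cores `Dom D ⊗ ℂG ⊗ V` and `Dom D ⊗ Dom M_ℓ` have the same closure, since the eigenvectors
lie in the smaller one. The equivariant triple is then a pullback of the exterior product and
inherits its analytic properties. -/

noncomputable section

/-! ### Elementary tensors and isometries of Hilbert space tensor products -/

namespace HilbertTensor

section Basic

variable {E : Type u} {F : Type v} [NormedAddCommGroup E] [InnerProductSpace ℂ E]
  [NormedAddCommGroup F] [InnerProductSpace ℂ F]

/-- The elementary tensors, as a continuous bilinear map. -/
def tmulL : E →L[ℂ] F →L[ℂ] HilbertTensor E F :=
  (ContinuousLinearMap.compL ℂ F (E ⊗[ℂ] F) (HilbertTensor E F)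
    (incl E F).toContinuousLinearMap).comp (TensorProduct.mkL ℂ E F)

theorem tmulL_apply (x : E) (y : F) : tmulL x y = incl E F (x ⊗ₜ y) := rfl

theorem inner_tmulL (x x' : E) (y y' : F) :
    inner ℂ (tmulL x y) (tmulL x' y') = inner ℂ x x' * inner ℂ y y' := by
  rw [tmulL_apply, tmulL_apply, LinearIsometry.inner_map_map, TensorProduct.inner_tmul]

theorem norm_tmulL (x : E) (y : F) : ‖tmulL x y‖ = ‖x‖ * ‖y‖ := by
  rw [tmulL_apply, LinearIsometry.norm_map, TensorProduct.norm_tmul]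

theorem tensorOp_tmulL (S : E →L[ℂ] E) (T : F →L[ℂ] F) (x : E) (y : F) :
    tensorOp S T (tmulL x y) = tmulL (S x) (T y) := by
  rw [tmulL_apply, tensorOp_incl, TensorProduct.mapL_tmul, tmulL_apply]

/-- A closed subspace which contains `x ⊗ y` for `x` and `y` in two total sets is everything. -/
theorem eq_top_of_tmulL_mem {s : Set E} {t : Set F} (hs : Dense (Submodule.span ℂ s : Set E))
    (ht : Dense (Submodule.span ℂ t : Set F)) {P : Submodule ℂ (HilbertTensor E F)}
    (hP : IsClosed (P : Set (HilbertTensor E F))) (h : ∀ x ∈ s, ∀ y ∈ t, tmulL x y ∈ P) :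
    P = ⊤ := by
  -- Density is used in one variable at a time: membership in `P` is a closed linear condition on
  -- each factor separately.
  have h1 : ∀ y ∈ t, ∀ x : E, tmulL x y ∈ P := by
    intro y hy
    have hc : IsClosed {x : E | tmulL x y ∈ P} := hP.preimage (by fun_prop)
    have hsub : Submodule.span ℂ s ≤ P.comap ((tmulL (E := E) (F := F)).flip y).toLinearMap :=
      Submodule.span_le.mpr fun x hx => h x hx y hy
    intro x
    exact hc.closure_subset_iff.mpr (fun x hx => hsub hx) (hs x)
  have h2 : ∀ (x : E) (y : F), tmulL x y ∈ P := by
    intro x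
    have hc : IsClosed {y : F | tmulL x y ∈ P} := hP.preimage (by fun_prop)
    have hsub : Submodule.span ℂ t ≤ P.comap (tmulL x).toLinearMap :=
      Submodule.span_le.mpr fun y hy => h1 y hy x
    intro y
    exact hc.closure_subset_iff.mpr (fun x hx => hsub hx) (ht y)
  rw [eq_top_iff]
  rintro z -
  refine hP.closure_subset_iff.mpr ?_ (denseRange_incl E F z)
  rintro _ ⟨r, rfl⟩
  induction r using TensorProduct.induction_on with
  | zero => simp
  | add a b ha hb => rw [map_add]; exact P.add_mem ha hb
  | tmul a b => exact h2 a b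

theorem dense_span_tmulL {s : Set E} {t : Set F} (hs : Dense (Submodule.span ℂ s : Set E))
    (ht : Dense (Submodule.span ℂ t : Set F)) :
    Dense (Submodule.span ℂ (Set.image2 (fun x y => tmulL x y) s t) : Set (HilbertTensor E F)) := by
  rw [Submodule.dense_iff_topologicalClosure_eq_top]
  exact eq_top_of_tmulL_mem hs ht (Submodule.isClosed_topologicalClosure _) fun x hx y hy =>
    Submodule.le_topologicalClosure _ (Submodule.subset_span ⟨x, hx, y, hy, rfl⟩)

theorem clm_ext {K : Type*} [NormedAddCommGroup K] [NormedSpace ℂ K]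
    {X Y : HilbertTensor E F →L[ℂ] K} {s : Set E} {t : Set F}
    (hs : Dense (Submodule.span ℂ s : Set E)) (ht : Dense (Submodule.span ℂ t : Set F))
    (h : ∀ x ∈ s, ∀ y ∈ t, X (tmulL x y) = Y (tmulL x y)) : X = Y := by
  have hP : LinearMap.eqLocus X.toLinearMap Y.toLinearMap = ⊤ :=
    eq_top_of_tmulL_mem hs ht (isClosed_eq X.continuous Y.continuous) h
  ext z
  exact (hP ▸ Submodule.mem_top : z ∈ LinearMap.eqLocus X.toLinearMap Y.toLinearMap)

theorem dense_span_univ (E : Type*) [NormedAddCommGroup E] [InnerProductSpace ℂ E] :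
    Dense (Submodule.span ℂ (Set.univ : Set E) : Set E) := by
  rw [Submodule.span_univ]
  exact dense_univ

theorem clm_ext' {K : Type*} [NormedAddCommGroup K] [NormedSpace ℂ K]
    {X Y : HilbertTensor E F →L[ℂ] K} (h : ∀ x y, X (tmulL x y) = Y (tmulL x y)) : X = Y :=
  clm_ext (dense_span_univ E) (dense_span_univ F) fun x _ y _ => h x y

end Basic

section Map

variable {E : Type*} {F : Type*} {E' : Type*} {F' : Type*} [NormedAddCommGroup E]
  [InnerProductSpace ℂ E] [NormedAddCommGroup F] [InnerProductSpace ℂ F] [NormedAddCommGroup E']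
  [InnerProductSpace ℂ E'] [NormedAddCommGroup F'] [InnerProductSpace ℂ F']

/-- The tensor product of two isometries. -/
def mapIsometry (f : E →ₗᵢ[ℂ] E') (g : F →ₗᵢ[ℂ] F') :
    HilbertTensor E F →ₗᵢ[ℂ] HilbertTensor E' F' where
  toLinearMap := (((incl E' F').comp
    (TensorProduct.mapIsometry f g)).toContinuousLinearMap.extend
      (incl E F).toContinuousLinearMap).toLinearMap
  norm_map' x := by
    refine (denseRange_incl E F).induction_on x
      (isClosed_eq (continuous_norm.comp (ContinuousLinearMap.continuous _)) continuous_norm) ?_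
    intro t
    have := ContinuousLinearMap.extend_eq
      ((incl E' F').comp (TensorProduct.mapIsometry f g)).toContinuousLinearMap
      (e := (incl E F).toContinuousLinearMap)
      (denseRange_incl E F) (incl E F).isometry.isUniformInducing t
    refine (congrArg norm this).trans ?_
    exact (LinearIsometry.norm_map _ _).trans (LinearIsometry.norm_map _ _).symm

theorem mapIsometry_tmulL (f : E →ₗᵢ[ℂ] E') (g : F →ₗᵢ[ℂ] F') (x : E) (y : F) :
    mapIsometry f g (tmulL x y) = tmulL (f x) (g y) :=
  ContinuousLinearMap.extend_eq
    ((incl E' F').comp (TensorProduct.mapIsometry f g)).toContinuousLinearMap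
    (e := (incl E F).toContinuousLinearMap)
    (denseRange_incl E F) (incl E F).isometry.isUniformInducing (x ⊗ₜ y)

/-- The isometry `x ↦ x ⊗ y` for a unit vector `y`. -/
def tmulRight (E : Type*) [NormedAddCommGroup E] [InnerProductSpace ℂ E] (y : F) (hy : ‖y‖ = 1) :
    E →ₗᵢ[ℂ] HilbertTensor E F where
  toLinearMap := (tmulL.flip y).toLinearMap
  norm_map' x := by
    change ‖tmulL x y‖ = ‖x‖
    rw [norm_tmulL, hy, mul_one]

/-- The isometry `y ↦ x ⊗ y` for a unit vector `x`. -/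
def tmulLeft (F : Type*) [NormedAddCommGroup F] [InnerProductSpace ℂ F] (x : E) (hx : ‖x‖ = 1) :
    F →ₗᵢ[ℂ] HilbertTensor E F where
  toLinearMap := (tmulL x).toLinearMap
  norm_map' y := by
    change ‖tmulL x y‖ = ‖y‖
    rw [norm_tmulL, hx, one_mul]

end Map

end HilbertTensor

section TensorOp

variable {E : Type u} {F : Type v} [NormedAddCommGroup E] [InnerProductSpace ℂ E]
  [NormedAddCommGroup F] [InnerProductSpace ℂ F]

theorem tensorOp_add_right (S : E →L[ℂ] E) (T T' : F →L[ℂ] F) :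
    tensorOp S (T + T') = tensorOp S T + tensorOp S T' :=
  HilbertTensor.clm_ext' fun x y => by
    simp [HilbertTensor.tensorOp_tmulL]

theorem tensorOp_smul_right (c : ℂ) (S : E →L[ℂ] E) (T : F →L[ℂ] F) :
    tensorOp S (c • T) = c • tensorOp S T :=
  HilbertTensor.clm_ext' fun x y => by
    simp [HilbertTensor.tensorOp_tmulL]

theorem norm_tensorOp_le (S : E →L[ℂ] E) (T : F →L[ℂ] F) : ‖tensorOp S T‖ ≤ ‖S‖ * ‖T‖ := by
  refine ContinuousLinearMap.opNorm_le_bound _ (by positivity) fun z => ?_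
  refine (HilbertTensor.denseRange_incl E F).induction_on z
    (isClosed_le (by fun_prop) (by fun_prop)) fun t => ?_
  rw [tensorOp_incl, LinearIsometry.norm_map, LinearIsometry.norm_map]
  exact ((TensorProduct.mapL S T).le_opNorm t).trans
    (mul_le_mul_of_nonneg_right (TensorProduct.norm_mapL_le S T) (norm_nonneg _))

/-- `(S, T) ↦ S ⊗ T` as a bilinear map. -/
def tensorOpₗ (E : Type u) (F : Type v) [NormedAddCommGroup E] [InnerProductSpace ℂ E]
    [NormedAddCommGroup F] [InnerProductSpace ℂ F] :
    (E →L[ℂ] E) →ₗ[ℂ] (F →L[ℂ] F) →ₗ[ℂ] (HilbertTensor E F →L[ℂ] HilbertTensor E F) :=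
  LinearMap.mk₂ ℂ tensorOp tensorOp_add_left tensorOp_smul_left tensorOp_add_right
    tensorOp_smul_right

/-- `(S, T) ↦ S ⊗ T` as a continuous bilinear map. -/
def tensorOpL (E : Type u) (F : Type v) [NormedAddCommGroup E] [InnerProductSpace ℂ E]
    [NormedAddCommGroup F] [InnerProductSpace ℂ F] :
    (E →L[ℂ] E) →L[ℂ] (F →L[ℂ] F) →L[ℂ] (HilbertTensor E F →L[ℂ] HilbertTensor E F) :=
  LinearMap.mkContinuous₂ (tensorOpₗ E F) 1 fun S T => by
    rw [one_mul]
    exact norm_tensorOp_le S T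

end TensorOp

/-! ### Direct sums of copies of a representation -/

section Copies

variable {K : Type*} {L : Type*} [NormedAddCommGroup K] [InnerProductSpace ℂ K] [CompleteSpace K]
  [NormedAddCommGroup L] [InnerProductSpace ℂ L] [CompleteSpace L]

open ContinuousLinearMap in
/-- If `L` is the orthogonal direct sum of the ranges of finitely many isometries `Jᵢ : K → L`, then
`X ↦ ∑ᵢ Jᵢ X Jᵢ*` is a unital `*`-homomorphism. -/
def copiesHom {ι : Type*} [Fintype ι] [DecidableEq ι] (J : ι → K →L[ℂ] L)
    (hJ : ∀ i j, (adjoint (J i)) ∘L J j = if i = j then 1 else 0)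
    (hsum : ∑ i, J i ∘L adjoint (J i) = 1) : (K →L[ℂ] K) →⋆ₐ[ℂ] (L →L[ℂ] L) where
  toFun X := ∑ i, J i ∘L X ∘L adjoint (J i)
  map_one' := by
    rw [← hsum]
    rfl
  map_mul' X Y := by
    ext ξ
    -- Orthogonality of the ranges removes the cross terms in the product of the two sums.
    have hJ' : ∀ i j (k : K), adjoint (J i) (J j k) = if i = j then k else 0 := by
      intro i j k
      have := DFunLike.congr_fun (hJ i j) k
      by_cases h : i = j <;> simpa [h] using this
    simp [hJ', map_sum, apply_ite]
  map_zero' := by simp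
  map_add' X Y := by
    rw [← Finset.sum_add_distrib]
    exact Finset.sum_congr rfl fun i _ => by ext; simp
  commutes' c := by
    rw [Algebra.algebraMap_eq_smul_one, Algebra.algebraMap_eq_smul_one, ← hsum, Finset.smul_sum]
    exact Finset.sum_congr rfl fun i _ => by ext; simp
  map_star' X := by
    rw [star_sum]
    refine Finset.sum_congr rfl fun i _ => ?_
    simp only [star_eq_adjoint, adjoint_comp, adjoint_adjoint]
    rfl

open ContinuousLinearMap in
-- Intertwining lets `Y` be pulled out of the sum, and what remains is `∑ Jᵢ Jᵢ* = 1`.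
theorem copiesHom_apply_eq {ι : Type*} [Fintype ι] [DecidableEq ι] (J : ι → K →L[ℂ] L)
    (hJ : ∀ i j, (adjoint (J i)) ∘L J j = if i = j then 1 else 0)
    (hsum : ∑ i, J i ∘L adjoint (J i) = 1) {X : K →L[ℂ] K} {Y : L →L[ℂ] L}
    (h : ∀ i, J i ∘L X = Y ∘L J i) : copiesHom J hJ hsum X = Y := by
  have h1 : copiesHom J hJ hsum X = Y ∘L ∑ i, J i ∘L adjoint (J i) := by
    change ∑ i, J i ∘L X ∘L adjoint (J i) = _
    rw [ContinuousLinearMap.comp_finsetSum]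
    refine Finset.sum_congr rfl fun i _ => ?_
    rw [← ContinuousLinearMap.comp_assoc, h, ContinuousLinearMap.comp_assoc]
  rw [h1, hsum]
  rfl

end Copies

/-! ### Diagonal operators -/

section Diagonal

variable {ι : Type*} {E : Type*} [NormedAddCommGroup E] [InnerProductSpace ℂ E]
  (b : HilbertBasis ι ℂ E) (μ : ι → ℝ)

/-- The graph of the maximal diagonal operator with eigenvalues `μᵢ`. -/
def diagGraph : Submodule ℂ (E × E) where
  carrier := {p | ∀ i, b.repr p.2 i = (μ i : ℂ) * b.repr p.1 i}
  add_mem' {p q} hp hq i := by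
    have := congrArg₂ (· + ·) (hp i) (hq i)
    simpa [mul_add] using this
  zero_mem' i := by simp
  smul_mem' c p hp i := by
    have := congrArg (c * ·) (hp i)
    simpa [mul_left_comm] using this

/-- The maximal diagonal operator with eigenvalues `μᵢ` with respect to the Hilbert basis `b`. -/
def diagOp : E →ₗ.[ℂ] E := (diagGraph b μ).toLinearPMap

/-- The relation is single-valued: a pair with first entry `0` has a second entry with all
coordinates `0`. -/
theorem graph_diagOp : (diagOp b μ).graph = diagGraph b μ := by
  refine Submodule.toLinearPMap_graph_eq _ fun p hp h0 => ?_
  apply b.repr.injective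
  ext i
  have := hp i
  simpa [h0] using this

theorem mem_graph_diagOp_iff {x y : E} :
    (x, y) ∈ (diagOp b μ).graph ↔ ∀ i, b.repr y i = (μ i : ℂ) * b.repr x i := by
  rw [graph_diagOp]
  rfl

theorem isClosed_diagOp : (diagOp b μ).IsClosed := by
  have h : ((diagOp b μ).graph : Set (E × E)) =
      ⋂ i, {p | inner ℂ (b i) p.2 = (μ i : ℂ) * inner ℂ (b i) p.1} := by
    ext p
    rw [graph_diagOp, Set.mem_iInter]
    simp only [← b.repr_apply_apply]
    rfl
  rw [LinearPMap.IsClosed, h]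
  exact isClosed_iInter fun i => isClosed_eq (by fun_prop) (by fun_prop)

theorem basis_mem_graph_diagOp (i : ι) : (b i, (μ i : ℂ) • b i) ∈ (diagOp b μ).graph := by
  classical
  rw [mem_graph_diagOp_iff]
  intro j
  simp only [map_smul, b.repr_self, lp.coeFn_smul, Pi.smul_apply, smul_eq_mul, lp.single_apply]
  by_cases h : j = i
  · subst h; simp
  · simp [h]

theorem dense_domain_diagOp : Dense ((diagOp b μ).domain : Set E) := by
  have h := b.dense_span
  rw [← Submodule.dense_iff_topologicalClosure_eq_top] at h
  refine h.mono ?_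
  rw [SetLike.coe_subset_coe, Submodule.span_le]
  rintro _ ⟨i, rfl⟩
  exact LinearPMap.mem_domain_of_mem_graph (basis_mem_graph_diagOp b μ i)

/-- Testing an element of the adjoint graph against `(bᵢ, μᵢ bᵢ)` gives its `i`-th coordinate
equation, so the adjoint is no larger. The converse is Parseval's identity together with the reality
of the `μᵢ`. -/
theorem isSelfAdjoint_diagOp [CompleteSpace E] : IsSelfAdjoint (diagOp b μ) := by
  rw [LinearPMap.isSelfAdjoint_def]
  apply LinearPMap.eq_of_eq_graph
  rw [LinearPMap.adjoint_graph_eq_graph_adjoint (dense_domain_diagOp b μ)]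
  ext ⟨x, y⟩
  rw [Submodule.mem_adjoint_iff, mem_graph_diagOp_iff]
  constructor
  · intro h i
    have := h _ _ (basis_mem_graph_diagOp b μ i)
    rw [sub_eq_zero, inner_smul_left, Complex.conj_ofReal] at this
    rw [b.repr_apply_apply, b.repr_apply_apply, this]
  · intro h a c hac
    rw [mem_graph_diagOp_iff] at hac
    rw [sub_eq_zero, ← b.repr.inner_map_map, ← b.repr.inner_map_map a, lp.inner_eq_tsum,
      lp.inner_eq_tsum]
    refine tsum_congr fun i => ?_
    simp only [RCLike.inner_apply, hac i, h i, map_mul, Complex.conj_ofReal]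
    ring

variable {b μ}

/-- A symmetric operator with a Hilbert basis of eigenvectors is essentially self-adjoint, and its
closure is the diagonal operator. -/
theorem closure_eq_diagOp {T : E →ₗ.[ℂ] E} (hT : T.IsFormalAdjoint T)
    (hb : ∀ i, (b i, (μ i : ℂ) • b i) ∈ T.graph) :
    T.IsClosable ∧ T.closure = diagOp b μ := by
  -- Symmetry against the eigenvector `bᵢ` computes the `i`-th coordinate of `T x`. So `T` has a
  -- closed extension, which also makes it closable.
  have hle : T.graph ≤ (diagOp b μ).graph := by
    rintro ⟨x, y⟩ hxy
    obtain ⟨x', rfl, rfl⟩ := (LinearPMap.mem_graph_iff T).mp hxy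
    rw [mem_graph_diagOp_iff]
    intro i
    obtain ⟨z, hz, hz'⟩ := (LinearPMap.mem_graph_iff T).mp (hb i)
    simp only at hz hz'
    rw [b.repr_apply_apply, b.repr_apply_apply, ← hz, ← hT z x', hz', hz, inner_smul_left,
      Complex.conj_ofReal]
  have hcl : T.IsClosable :=
    (isClosed_diagOp b μ).isClosable.leIsClosable (LinearPMap.le_of_le_graph hle)
  refine ⟨hcl, LinearPMap.eq_of_eq_graph ?_⟩
  rw [← hcl.graph_closure_eq_closure_graph]
  apply le_antisymm
  · exact Submodule.topologicalClosure_minimal _ hle (isClosed_diagOp b μ)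
  -- The partial sums of the expansions of `x` and `y` form pairs in the graph of `T`, and these
  -- converge to `(x, y)`.
  · rintro ⟨x, y⟩ hxy
    rw [mem_graph_diagOp_iff] at hxy
    have h1 := b.hasSum_repr x
    have h2 := b.hasSum_repr y
    have h3 := h1.prodMk h2
    refine mem_closure_of_tendsto h3 (Filter.Eventually.of_forall fun s => ?_)
    refine Submodule.sum_mem _ fun i _ => ?_
    have := T.graph.smul_mem (b.repr x i) (hb i)
    rwa [Prod.smul_mk, smul_smul, mul_comm, ← hxy] at this

variable (b)

/-- The bounded diagonal operator with eigenvalues `sᵢ`. -/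
def diagCLM (s : ι → ℝ) (C : ℝ) (hs : ∀ i, |s i| ≤ C) : E →L[ℂ] E :=
  b.repr.symm.toContinuousLinearEquiv.toContinuousLinearMap ∘L
    weightedShift (E := fun _ : ι => ℂ) (Equiv.refl ι)
      (fun i => (s i : ℂ) • ContinuousLinearMap.id ℂ ℂ) C
      (fun i => by simpa [norm_smul] using hs i) ∘L
    b.repr.toContinuousLinearEquiv.toContinuousLinearMap

theorem repr_diagCLM (s : ι → ℝ) (C : ℝ) (hs : ∀ i, |s i| ≤ C) (x : E) (i : ι) :
    b.repr (diagCLM b s C hs x) i = (s i : ℂ) * b.repr x i := by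
  change b.repr (b.repr.symm _) i = _
  rw [LinearIsometryEquiv.apply_symm_apply]
  rfl

theorem norm_diagCLM_le (s : ι → ℝ) (C : ℝ) (hs : ∀ i, |s i| ≤ C) :
    ‖diagCLM b s C hs‖ ≤ |C| := by
  refine ContinuousLinearMap.opNorm_le_bound _ (abs_nonneg _) fun x => ?_
  change ‖b.repr.symm _‖ ≤ _
  rw [LinearIsometryEquiv.norm_map, ← b.repr.norm_map x]
  exact norm_weightedShiftₗ_le (E := fun _ : ι => ℂ) (Equiv.refl ι)
      (fun i => (s i : ℂ) • ContinuousLinearMap.id ℂ ℂ) C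
      (fun i => by simpa [norm_smul] using hs i) _

theorem isPositive_diagCLM (s : ι → ℝ) (C : ℝ) (hs : ∀ i, |s i| ≤ C) (h0 : ∀ i, 0 ≤ s i) :
    (diagCLM b s C hs).IsPositive := by
  rw [ContinuousLinearMap.isPositive_iff_complex]
  intro x
  have h : inner ℂ (diagCLM b s C hs x) x = ((∑' i, s i * ‖b.repr x i‖ ^ 2 : ℝ) : ℂ) := by
    rw [← b.repr.inner_map_map, lp.inner_eq_tsum, Complex.ofReal_tsum]
    refine tsum_congr fun i => ?_
    simp only [RCLike.inner_apply, repr_diagCLM, map_mul, Complex.conj_ofReal]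
    rw [mul_left_comm, Complex.mul_conj]
    simp [Complex.normSq_eq_norm_sq]
  rw [h]
  refine ⟨by simp, ?_⟩
  simp only [RCLike.re_to_complex, Complex.ofReal_re]
  exact tsum_nonneg fun i => mul_nonneg (h0 i) (sq_nonneg _)

theorem isCompactOperator_diagCLM_of_finite (s : ι → ℝ) (C : ℝ) (hs : ∀ i, |s i| ≤ C)
    (hfin : {i | s i ≠ 0}.Finite) : IsCompactOperator (diagCLM b s C hs) := by
  classical
  have h : diagCLM b s C hs = ∑ i ∈ hfin.toFinset,
      (s i : ℂ) • (ContinuousLinearMap.toSpanSingleton ℂ (b i)) ∘L (innerSL ℂ (b i)) := by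
    ext x
    apply b.repr.injective
    ext j
    rw [repr_diagCLM]
    simp only [sum_apply, smul_apply, ContinuousLinearMap.comp_apply,
      innerSL_apply_apply, ContinuousLinearMap.toSpanSingleton_apply, map_sum, map_smul,
      b.repr_self, ← b.repr_apply_apply, lp.coeFn_sum, Finset.sum_apply, lp.coeFn_smul,
      Pi.smul_apply, lp.single_apply, smul_eq_mul]
    by_cases hj : s j = 0
    · rw [hj, Complex.ofReal_zero, zero_mul, Finset.sum_eq_zero]
      intro i hi
      have : j ≠ i := by rintro rfl; simp [hj] at hi
      simp [this]
    · rw [Finset.sum_eq_single j]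
      · simp
      · intro i _ hi
        simp [hi.symm]
      · intro hj'; simp [hj] at hj'
  rw [h]
  refine (compactOperator (RingHom.id ℂ) E E).sum_mem fun i _ => ?_
  refine Submodule.smul_mem _ _ ?_
  exact (isCompactOperator_id (E := ℂ)).comp_clm (innerSL ℂ (b i)) |>.clm_comp
    (ContinuousLinearMap.toSpanSingleton ℂ (b i))

/-- Replacing the eigenvalues below `ε / 2` by `0` leaves a finite rank operator at distance at most
`ε / 2`, and the compact operators are norm closed. -/
theorem isCompactOperator_diagCLM [CompleteSpace E] (s : ι → ℝ) (C : ℝ) (hs : ∀ i, |s i| ≤ C)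
    (hfin : ∀ ε > 0, {i | ε ≤ |s i|}.Finite) : IsCompactOperator (diagCLM b s C hs) := by
  classical
  have hcl := isClosed_setOfPred_isCompactOperator (σ₁₂ := RingHom.id ℂ) (M₁ := E) (M₂ := E)
  refine hcl.closure_subset_iff.mpr subset_rfl (Metric.mem_closure_iff.mpr fun ε hε => ?_)
  set t : ι → ℝ := fun i => if ε / 2 ≤ |s i| then s i else 0 with ht
  have htC : ∀ i, |t i| ≤ C := by
    intro i
    by_cases h : ε / 2 ≤ |s i|
    · simpa [ht, h] using hs i
    · simpa [ht, h] using (abs_nonneg _).trans (hs i)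
  have hst : ∀ i, |s i - t i| ≤ ε / 2 := by
    intro i
    by_cases h : ε / 2 ≤ |s i|
    · simpa [ht, h] using (half_pos hε).le
    · simpa [ht, h] using (not_le.mp h).le
  refine ⟨diagCLM b t C htC, isCompactOperator_diagCLM_of_finite b t C htC ?_, ?_⟩
  · refine (hfin (ε / 2) (half_pos hε)).subset fun i hi => ?_
    by_contra h
    exact hi (if_neg h)
  · have hsub : diagCLM b s C hs - diagCLM b t C htC = diagCLM b (fun i => s i - t i) _ hst := by
      ext x
      apply b.repr.injective
      ext j
      rw [repr_diagCLM]
      simp [repr_diagCLM, sub_mul]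
    rw [dist_eq_norm, hsub]
    refine (norm_diagCLM_le b _ _ hst).trans_lt ?_
    rw [abs_of_pos (half_pos hε)]
    exact half_lt_self hε

/-- A diagonal operator whose eigenvalues tend to infinity has compact resolvent. -/
theorem exists_isInvSqrtOneAddSq_diagOp [CompleteSpace E] (μ : ι → ℝ)
    (hμ : ∀ N : ℝ, {i | |μ i| ≤ N}.Finite) :
    ∃ S : E →L[ℂ] E, IsInvSqrtOneAddSq (diagOp b μ) S ∧ IsCompactOperator S := by
  set s : ι → ℝ := fun i => (√(1 + μ i ^ 2))⁻¹ with hs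
  have hpos : ∀ i, 0 < 1 + μ i ^ 2 := fun i => by positivity
  have h1 : ∀ i, 1 ≤ √(1 + μ i ^ 2) := fun i => Real.one_le_sqrt.mpr (by nlinarith [sq_nonneg (μ i)])
  have hs0 : ∀ i, 0 ≤ s i := fun i => by positivity
  have hs1 : ∀ i, |s i| ≤ 1 := fun i => by
    rw [abs_of_nonneg (hs0 i)]
    exact inv_le_one_of_one_le₀ (h1 i)
  have hsq : ∀ i, s i * s i = (1 + μ i ^ 2)⁻¹ := fun i => by
    rw [hs, ← mul_inv, Real.mul_self_sqrt (hpos i).le]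
  -- These are the eigenvalues `μ / (1 + μ²)` of `D S²`, which is therefore a bounded diagonal
  -- operator.
  have hμs : ∀ i, |μ i * (s i * s i)| ≤ 1 := fun i => by
    rw [hsq, abs_mul, abs_inv, abs_of_pos (hpos i), ← div_eq_mul_inv, div_le_one (hpos i)]
    nlinarith [sq_abs (μ i), sq_nonneg (|μ i| - 1)]
  refine ⟨diagCLM b s 1 hs1, ⟨isPositive_diagCLM b s 1 hs1 hs0, fun ξ => ?_⟩, ?_⟩
  · have hg1 : (diagCLM b s 1 hs1 (diagCLM b s 1 hs1 ξ), diagCLM b _ 1 hμs ξ) ∈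
        (diagOp b μ).graph := by
      rw [mem_graph_diagOp_iff]
      intro i
      simp only [repr_diagCLM, Complex.ofReal_mul]
      ring
    have hg2 : (diagCLM b _ 1 hμs ξ, ξ - diagCLM b s 1 hs1 (diagCLM b s 1 hs1 ξ)) ∈
        (diagOp b μ).graph := by
      rw [mem_graph_diagOp_iff]
      intro i
      have hk : (1 : ℂ) - (s i : ℂ) * s i = μ i * (μ i * (s i * s i)) := by
        norm_cast
        rw [hsq]
        field_simp [(hpos i).ne']
        ring
      simp only [map_sub, lp.coeFn_sub, Pi.sub_apply, repr_diagCLM, Complex.ofReal_mul]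
      linear_combination (b.repr ξ i) * hk
    obtain ⟨x, hx, hx'⟩ := (LinearPMap.mem_graph_iff _).mp hg1
    obtain ⟨y, hy, hy'⟩ := (LinearPMap.mem_graph_iff _).mp hg2
    simp only at hx hx' hy hy'
    have hxd : diagCLM b s 1 hs1 (diagCLM b s 1 hs1 ξ) ∈ (diagOp b μ).domain := hx ▸ x.2
    have hxe : (⟨_, hxd⟩ : (diagOp b μ).domain) = x := Subtype.ext hx.symm
    have hval : diagOp b μ ⟨_, hxd⟩ = diagCLM b _ 1 hμs ξ := by rw [hxe, hx']
    have hyd : diagOp b μ ⟨_, hxd⟩ ∈ (diagOp b μ).domain := by rw [hval, ← hy]; exact y.2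
    refine ⟨hxd, hyd, ?_⟩
    have hye : (⟨_, hyd⟩ : (diagOp b μ).domain) = y := Subtype.ext (hval.trans hy.symm)
    rw [hye, hy']
    abel
  -- From `ε ≤ (1 + μ²)^(-1/2)` it follows that `|μ| ≤ ε⁻¹`.
  · refine isCompactOperator_diagCLM b s 1 hs1 fun ε hε => (hμ ε⁻¹).subset fun i hi => ?_
    simp only [Set.mem_ofPred_eq] at hi ⊢
    rw [abs_of_nonneg (hs0 i)] at hi
    have h2 : √(1 + μ i ^ 2) ≤ ε⁻¹ := by
      rw [le_inv_comm₀ (by positivity) hε]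
      exact hi
    refine le_trans ?_ h2
    exact Real.abs_le_sqrt (by linarith)

end Diagonal

/-! ### Bounded commutators -/

section Commutator

variable {E : Type*} [NormedAddCommGroup E] [InnerProductSpace ℂ E]

/-- The graph form carries no domain proofs, so it is compatible with sums, products and limits. -/
theorem hasBoundedCommutator_iff {D : E →ₗ.[ℂ] E} {T : E →L[ℂ] E} :
    HasBoundedCommutator D T ↔
      ∃ C : E →L[ℂ] E, ∀ x y, (x, y) ∈ D.graph → (T x, T y + C x) ∈ D.graph := by
  constructor
  · rintro ⟨h, C, hC⟩
    refine ⟨C, fun x y hxy => ?_⟩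
    obtain ⟨ξ, rfl, rfl⟩ := (LinearPMap.mem_graph_iff D).mp hxy
    exact (LinearPMap.mem_graph_iff D).mpr ⟨⟨T ξ, h ξ⟩, rfl, by rw [← hC ξ]; simp⟩
  · rintro ⟨C, hC⟩
    refine ⟨fun ξ => LinearPMap.mem_domain_of_mem_graph (hC _ _ (D.mem_graph ξ)), C, fun ξ => ?_⟩
    have h1 := hC _ _ (D.mem_graph ξ)
    have h2 := D.mem_graph ⟨T ξ, LinearPMap.mem_domain_of_mem_graph h1⟩
    rw [D.mem_graph_snd_inj h2 h1 rfl]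
    abel

variable {D : E →ₗ.[ℂ] E}

/-- The operators with a bounded commutator form a subspace. -/
def boundedCommutators (D : E →ₗ.[ℂ] E) : Submodule ℂ (E →L[ℂ] E) where
  carrier := {T | HasBoundedCommutator D T}
  zero_mem' := hasBoundedCommutator_iff.mpr ⟨0, fun x y _ => by simp⟩
  add_mem' {S T} hS hT := by
    obtain ⟨C, hC⟩ := hasBoundedCommutator_iff.mp hS
    obtain ⟨C', hC'⟩ := hasBoundedCommutator_iff.mp hT
    refine hasBoundedCommutator_iff.mpr ⟨C + C', fun x y h => ?_⟩
    have := D.graph.add_mem (hC x y h) (hC' x y h)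
    rw [Prod.mk_add_mk, add_add_add_comm] at this
    exact this
  smul_mem' c T hT := by
    obtain ⟨C, hC⟩ := hasBoundedCommutator_iff.mp hT
    refine hasBoundedCommutator_iff.mpr ⟨c • C, fun x y h => ?_⟩
    have := D.graph.smul_mem c (hC x y h)
    rw [Prod.smul_mk, smul_add] at this
    exact this

theorem HasBoundedCommutator.mul {S T : E →L[ℂ] E} (hS : HasBoundedCommutator D S)
    (hT : HasBoundedCommutator D T) : HasBoundedCommutator D (S * T) := by
  obtain ⟨C, hC⟩ := hasBoundedCommutator_iff.mp hS
  obtain ⟨C', hC'⟩ := hasBoundedCommutator_iff.mp hT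
  -- The Leibniz rule `[D, S T] = S [D, T] + [D, S] T`.
  refine hasBoundedCommutator_iff.mpr ⟨S * C' + C * T, fun x y h => ?_⟩
  have := hC _ _ (hC' x y h)
  simp only [map_add] at this
  simpa [add_assoc] using this

/-- Relations of the form `D T = S₁ D + S₂` on the domain pass to the closure. -/
theorem LinearPMap.IsClosable.closure_mapsTo (hD : D.IsClosable) (T S₁ S₂ : E →L[ℂ] E)
    (h : ∀ x y, (x, y) ∈ D.graph → (T x, S₁ y + S₂ x) ∈ D.graph) (x y : E)
    (hxy : (x, y) ∈ D.closure.graph) : (T x, S₁ y + S₂ x) ∈ D.closure.graph := by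
  rw [← hD.graph_closure_eq_closure_graph] at hxy ⊢
  have hc : Continuous fun p : E × E => (T p.1, S₁ p.2 + S₂ p.1) := by fun_prop
  exact map_mem_closure (f := fun p : E × E => (T p.1, S₁ p.2 + S₂ p.1)) hc hxy
    fun p hp => h p.1 p.2 hp

theorem HasBoundedCommutator.closure (hD : D.IsClosable) {T : E →L[ℂ] E}
    (hT : HasBoundedCommutator D T) : HasBoundedCommutator D.closure T := by
  obtain ⟨C, hC⟩ := hasBoundedCommutator_iff.mp hT
  exact hasBoundedCommutator_iff.mpr ⟨C, hD.closure_mapsTo T T C hC⟩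

end Commutator

theorem mem_graph_pmapOfParam {X : Type*} {E : Type*} [AddCommGroup X] [Module ℂ X] [AddCommGroup E]
    [Module ℂ E] (e : X →ₗ[ℂ] E) (he : Function.Injective e) (d : X →ₗ[ℂ] E) {x y : E} :
    (x, y) ∈ (pmapOfParam e he d).graph ↔ ∃ t, e t = x ∧ d t = y := by
  rw [LinearPMap.mem_graph_iff]
  have key : ∀ t (h : e t ∈ (pmapOfParam e he d).domain), pmapOfParam e he d ⟨e t, h⟩ = d t := by
    intro t h
    exact congrArg d ((LinearEquiv.ofInjective e he).symm_apply_apply t)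
  constructor
  · rintro ⟨⟨_, t, rfl⟩, rfl, rfl⟩
    exact ⟨t, rfl, (key t _).symm⟩
  · rintro ⟨t, rfl, rfl⟩
    exact ⟨⟨e t, t, rfl⟩, rfl, key t _⟩

/-! ### The Dirac operator of an exterior product -/

section OffDiag

variable {E : Type*} [NormedAddCommGroup E] [InnerProductSpace ℂ E]

theorem doubleOp_apply (T : E →L[ℂ] E) (x y : E) :
    doubleOp T (WithLp.toLp 2 (x, y)) = WithLp.toLp 2 (T x, T y) := rfl

theorem stdGrading_apply (x y : E) :
    stdGrading E (WithLp.toLp 2 (x, y)) = WithLp.toLp 2 (x, -y) := rfl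

/-- The operator `((0, P), (Q, 0))` on `E ⊕ E`. -/
def offDiagOp (P Q : E →L[ℂ] E) : Double E →L[ℂ] Double E :=
  (WithLp.prodContinuousLinearEquiv 2 ℂ E E).symm.toContinuousLinearMap ∘L
    ((P ∘L ContinuousLinearMap.snd ℂ E E).prod (Q ∘L ContinuousLinearMap.fst ℂ E E)) ∘L
      (WithLp.prodContinuousLinearEquiv 2 ℂ E E).toContinuousLinearMap

theorem offDiagOp_apply (P Q : E →L[ℂ] E) (x y : E) :
    offDiagOp P Q (WithLp.toLp 2 (x, y)) = WithLp.toLp 2 (P y, Q x) := rfl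

end OffDiag

section ProdDirac

open HilbertTensor

variable {H₁ : Type u} [NormedAddCommGroup H₁] [InnerProductSpace ℂ H₁]
  {H₂ : Type v} [NormedAddCommGroup H₂] [InnerProductSpace ℂ H₂]
  {D₁ : H₁ →ₗ.[ℂ] H₁} {D₂ : H₂ →ₗ.[ℂ] H₂}

theorem coreIncl_tmul {E : Submodule ℂ H₁} {F : Submodule ℂ H₂} (x : E) (y : F) :
    coreIncl E F (x ⊗ₜ y) = tmulL (x : H₁) (y : H₂) := rfl

theorem tensorSum_tmul (c : ℂ) (x : D₁.domain) (y : D₂.domain) :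
    tensorSum D₁ D₂ c (x ⊗ₜ y) = tmulL (D₁ x) (y : H₂) + c • tmulL (x : H₁) (D₂ y) := by
  simp only [tensorSum, LinearMap.comp_apply, LinearMap.add_apply, LinearMap.smul_apply,
    TensorProduct.map_tmul, map_add, map_smul]
  rfl

theorem mem_graph_prodDiracCore {p q : Double (HilbertTensor H₁ H₂)} :
    (p, q) ∈ (prodDiracCore D₁ D₂).graph ↔ ∃ s t : D₁.domain ⊗[ℂ] D₂.domain,
      WithLp.toLp 2 (coreIncl _ _ s, coreIncl _ _ t) = p ∧
      WithLp.toLp 2 (tensorSum D₁ D₂ (-Complex.I) t, tensorSum D₁ D₂ Complex.I s) = q := by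
  rw [prodDiracCore, mem_graph_pmapOfParam]
  exact Prod.exists

/-- Conjugating the coefficient exchanges the matrix entries for `i` and `-i`, which is why the
off-diagonal matrix is symmetric. -/
theorem inner_tensorSum_left (h₁ : D₁.IsFormalAdjoint D₁) (h₂ : D₂.IsFormalAdjoint D₂) (c : ℂ)
    (s t : D₁.domain ⊗[ℂ] D₂.domain) :
    inner ℂ (tensorSum D₁ D₂ c s) (coreIncl _ _ t) =
      inner ℂ (coreIncl _ _ s) (tensorSum D₁ D₂ (starRingEnd ℂ c) t) := by
  induction s using TensorProduct.induction_on with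
  | zero => simp
  | add a b ha hb => simp only [map_add, inner_add_left, ha, hb]
  | tmul a b =>
    induction t using TensorProduct.induction_on with
    | zero => simp
    | add c d hc hd => simp only [map_add, inner_add_right, hc, hd]
    | tmul a' b' =>
      simp only [coreIncl_tmul, tensorSum_tmul, inner_add_left, inner_add_right, inner_smul_left,
        inner_smul_right, inner_tmulL, h₁ a a', h₂ b b']

theorem isFormalAdjoint_prodDiracCore (h₁ : D₁.IsFormalAdjoint D₁) (h₂ : D₂.IsFormalAdjoint D₂) :
    (prodDiracCore D₁ D₂).IsFormalAdjoint (prodDiracCore D₁ D₂) := by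
  intro p q
  obtain ⟨s, t, hp, hp'⟩ := mem_graph_prodDiracCore.mp ((prodDiracCore D₁ D₂).mem_graph p)
  obtain ⟨s', t', hq, hq'⟩ := mem_graph_prodDiracCore.mp ((prodDiracCore D₁ D₂).mem_graph q)
  rw [← hp, ← hp', ← hq, ← hq']
  simp only [WithLp.prod_inner_apply, inner_tensorSum_left h₁ h₂, map_neg, Complex.conj_I, neg_neg]
  exact add_comm _ _

/-- A tensor product of operators with bounded commutators has a bounded commutator with the
exterior product operator. -/
theorem HasBoundedCommutator.prodDirac {X : H₁ →L[ℂ] H₁} {Y : H₂ →L[ℂ] H₂}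
    (hX : HasBoundedCommutator D₁ X) (hY : HasBoundedCommutator D₂ Y)
    (hcl : (prodDiracCore D₁ D₂).IsClosable) :
    HasBoundedCommutator (prodDirac D₁ D₂) (doubleOp (tensorOp X Y)) := by
  obtain ⟨hX, C₁, hC₁⟩ := hX
  obtain ⟨hY, C₂, hC₂⟩ := hY
  refine HasBoundedCommutator.closure hcl (hasBoundedCommutator_iff.mpr ?_)
  -- Both operators preserve their domains, so `X ⊗ Y` preserves the algebraic core.
  let X' : D₁.domain →ₗ[ℂ] D₁.domain := (X.toLinearMap ∘ₗ D₁.domain.subtype).codRestrict _ hX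
  let Y' : D₂.domain →ₗ[ℂ] D₂.domain := (Y.toLinearMap ∘ₗ D₂.domain.subtype).codRestrict _ hY
  have hcore : ∀ t, coreIncl D₁.domain D₂.domain (TensorProduct.map X' Y' t) =
      tensorOp X Y (coreIncl _ _ t) := by
    intro t
    induction t using TensorProduct.induction_on with
    | zero => simp
    | add a b ha hb => simp only [map_add, ha, hb]
    | tmul a b =>
      rw [TensorProduct.map_tmul, coreIncl_tmul, coreIncl_tmul, tensorOp_tmulL]
      rfl
  -- The commutator of `D₁ ⊗ 1 + c (1 ⊗ D₂)` with `X ⊗ Y` is `[D₁, X] ⊗ Y + c X ⊗ [D₂, Y]`.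
  have hsum : ∀ c t, tensorSum D₁ D₂ c (TensorProduct.map X' Y' t) =
      tensorOp X Y (tensorSum D₁ D₂ c t) +
        (tensorOp C₁ Y + c • tensorOp X C₂) (coreIncl _ _ t) := by
    intro c t
    induction t using TensorProduct.induction_on with
    | zero => simp
    | add a b ha hb =>
      simp only [map_add, ha, hb]
      abel
    | tmul a b =>
      have h1 : D₁ (X' a) = X (D₁ a) + C₁ a := by rw [← hC₁ a]; simp [X']; rfl
      have h2 : D₂ (Y' b) = Y (D₂ b) + C₂ b := by rw [← hC₂ b]; simp [Y']; rfl
      rw [TensorProduct.map_tmul, coreIncl_tmul, tensorSum_tmul, tensorSum_tmul, h1, h2]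
      simp only [map_add, map_smul, add_apply, smul_apply, tensorOp_tmulL, smul_add]
      change tmulL _ (Y b) + tmulL _ (Y b) + (c • tmulL (X a) _ + c • tmulL (X a) _) = _
      abel
  refine ⟨offDiagOp (tensorOp C₁ Y + -Complex.I • tensorOp X C₂)
    (tensorOp C₁ Y + Complex.I • tensorOp X C₂), fun p q hpq => ?_⟩
  obtain ⟨s, t, rfl, rfl⟩ := mem_graph_prodDiracCore.mp hpq
  refine mem_graph_prodDiracCore.mpr ⟨TensorProduct.map X' Y' s, TensorProduct.map X' Y' t, ?_, ?_⟩
  · rw [hcore, hcore, doubleOp_apply]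
  · rw [hsum, hsum, doubleOp_apply, offDiagOp_apply]
    rfl

/-- An off-diagonal matrix anticommutes with the grading on the core, and the relation passes to the
closure. -/
theorem stdGrading_mem_graph_prodDirac (hcl : (prodDiracCore D₁ D₂).IsClosable)
    {p q : Double (HilbertTensor H₁ H₂)} (h : (p, q) ∈ (prodDirac D₁ D₂).graph) :
    (stdGrading _ p, -stdGrading _ q) ∈ (prodDirac D₁ D₂).graph := by
  have := hcl.closure_mapsTo (stdGrading _) (-stdGrading _) 0 (fun p q hpq => by
    obtain ⟨s, t, rfl, rfl⟩ := mem_graph_prodDiracCore.mp hpq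
    refine mem_graph_prodDiracCore.mpr ⟨s, -t, ?_, ?_⟩
    · rw [stdGrading_apply, map_neg]
    · rw [map_neg, zero_apply, add_zero, neg_apply, stdGrading_apply, ← WithLp.toLp_neg,
        Prod.neg_mk, neg_neg]) p q h
  rwa [zero_apply, add_zero, neg_apply] at this

end ProdDirac

/-! ### Eigenvectors of the exterior product operator -/

section Eigen

open HilbertTensor

/-- The phase of a complex number, with value `1` at `0`. -/
def phase (z : ℂ) : ℂ := if z = 0 then 1 else z / ‖z‖

theorem norm_mul_phase (z : ℂ) : (‖z‖ : ℂ) * phase z = z := by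
  by_cases h : z = 0
  · simp [h]
  · rw [phase, if_neg h, mul_div_cancel₀]
    simpa using h

/-- Here the value `1` at `0` matters: it keeps the eigenvectors below orthonormal even when `z =
0`. -/
theorem conj_phase_mul_phase (z : ℂ) : starRingEnd ℂ (phase z) * phase z = 1 := by
  by_cases h : z = 0
  · simp [phase, h]
  · have : ‖phase z‖ = 1 := by simp [phase, h]
    rw [Complex.conj_mul', this]
    simp

theorem conj_mul_phase (z : ℂ) : starRingEnd ℂ z * phase z = ‖z‖ := by
  have h := congrArg (starRingEnd ℂ) (norm_mul_phase z)
  rw [map_mul, Complex.conj_ofReal] at h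
  rw [← h, mul_assoc, conj_phase_mul_phase, mul_one]

/-- The sign `±1`. -/
def boolSign (s : Bool) : ℝ := if s then 1 else -1

variable {ι : Type*} {κ : Type*} {H₁ : Type u} [NormedAddCommGroup H₁] [InnerProductSpace ℂ H₁]
  {H₂ : Type v} [NormedAddCommGroup H₂] [InnerProductSpace ℂ H₂]
  (b : HilbertBasis ι ℂ H₁) (c : HilbertBasis κ ℂ H₂) (μ : ι → ℝ) (ν : κ → ℝ)

/-- The complex number `μᵢ + i νⱼ`. -/
def eigenPair (p : ι × κ) : ℂ := μ p.1 + ν p.2 * Complex.I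

/-- Eigenvectors of the exterior product operator. -/
def prodEigenvector (p : (ι × κ) × Bool) : Double (HilbertTensor H₁ H₂) :=
  -- On the two copies of `bᵢ ⊗ cⱼ` the operator is `((0, z̄), (z, 0))` with `z = μᵢ + i νⱼ`. Its
  -- normalised eigenvectors for `±|z|` are `(1, ± z / |z|) / √2`.
  (((√2)⁻¹ : ℝ) : ℂ) • WithLp.toLp 2 (tmulL (b p.1.1) (c p.1.2),
    ((boolSign p.2 : ℂ) * phase (eigenPair μ ν p.1)) • tmulL (b p.1.1) (c p.1.2))

theorem inv_sqrt_two_mul_self : (((√2)⁻¹ : ℝ) : ℂ) * (((√2)⁻¹ : ℝ) : ℂ) = 1 / 2 := by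
  rw [← Complex.ofReal_mul, ← mul_inv, Real.mul_self_sqrt (by norm_num)]
  norm_num

theorem orthonormal_prodEigenvector : Orthonormal ℂ (prodEigenvector b c μ ν) := by
  classical
  rw [orthonormal_iff_ite]
  rintro ⟨⟨i, j⟩, s⟩ ⟨⟨i', j'⟩, s'⟩
  simp only [prodEigenvector, inner_smul_left, inner_smul_right, WithLp.prod_inner_apply,
    inner_tmulL, orthonormal_iff_ite.mp b.orthonormal, orthonormal_iff_ite.mp c.orthonormal,
    Complex.conj_ofReal, map_mul]
  by_cases h : i = i' ∧ j = j'
  · obtain ⟨rfl, rfl⟩ := h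
    have h1 := conj_phase_mul_phase (eigenPair μ ν (i, j))
    have h2 := inv_sqrt_two_mul_self
    -- The vectors for opposite signs are orthogonal because the two components contribute `1` and
    -- `-1`.
    have h3 : ((boolSign s : ℂ) * boolSign s' + 1) * (1 / 2) = if s = s' then 1 else 0 := by
      cases s <;> cases s' <;> norm_num [boolSign]
    simp only [if_true, Prod.mk.injEq, true_and, ← h3, ← h2]
    linear_combination ((((√2)⁻¹ : ℝ) : ℂ) * (((√2)⁻¹ : ℝ) : ℂ)) *
      ((boolSign s : ℂ) * boolSign s') * h1
  · have hne : ¬((((i, j), s) : (ι × κ) × Bool) = ((i', j'), s')) := fun h' =>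
      h (by simp only [Prod.mk.injEq] at h'; exact h'.1)
    rw [if_neg hne]
    rcases not_and_or.mp h with h | h <;> simp [h]

theorem dense_span_range_hilbertBasis {ι : Type*} {E : Type*} [NormedAddCommGroup E]
    [InnerProductSpace ℂ E] (b : HilbertBasis ι ℂ E) :
    Dense (Submodule.span ℂ (Set.range b) : Set E) := by
  rw [Submodule.dense_iff_topologicalClosure_eq_top]
  exact b.dense_span

/-- The sum and the difference of the two eigenvectors over `bᵢ ⊗ cⱼ` are multiples of its first and
second copy, and these copies are total. -/
theorem top_le_span_prodEigenvector :
    ⊤ ≤ (Submodule.span ℂ (Set.range (prodEigenvector b c μ ν))).topologicalClosure := by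
  set P := (Submodule.span ℂ (Set.range (prodEigenvector b c μ ν))).topologicalClosure with hP
  have hcl : IsClosed (P : Set (Double (HilbertTensor H₁ H₂))) := Submodule.isClosed_topologicalClosure _
  have hmem : ∀ p, prodEigenvector b c μ ν p ∈ P := fun p =>
    Submodule.le_topologicalClosure _ (Submodule.subset_span ⟨p, rfl⟩)
  let inl : HilbertTensor H₁ H₂ →L[ℂ] Double (HilbertTensor H₁ H₂) :=
    (WithLp.prodContinuousLinearEquiv 2 ℂ _ _).symm.toContinuousLinearMap ∘L
      ContinuousLinearMap.inl ℂ _ _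
  let inr : HilbertTensor H₁ H₂ →L[ℂ] Double (HilbertTensor H₁ H₂) :=
    (WithLp.prodContinuousLinearEquiv 2 ℂ _ _).symm.toContinuousLinearMap ∘L
      ContinuousLinearMap.inr ℂ _ _
  have h2 := inv_sqrt_two_mul_self
  have hinl : P.comap inl.toLinearMap = ⊤ := by
    refine eq_top_of_tmulL_mem (dense_span_range_hilbertBasis b) (dense_span_range_hilbertBasis c)
      (hcl.preimage inl.continuous) ?_
    rintro _ ⟨i, rfl⟩ _ ⟨j, rfl⟩
    have : inl (tmulL (b i) (c j)) = (((√2)⁻¹ : ℝ) : ℂ) • (prodEigenvector b c μ ν ((i, j), true) +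
        prodEigenvector b c μ ν ((i, j), false)) := by
      simp only [prodEigenvector, boolSign, ← smul_add, smul_smul, h2, ← WithLp.toLp_add,
        ← WithLp.toLp_smul, Prod.mk_add_mk, Prod.smul_mk]
      change WithLp.toLp 2 (tmulL (b i) (c j), (0 : HilbertTensor H₁ H₂)) = _
      congr 2
      · module
      · simp
    change inl (tmulL (b i) (c j)) ∈ P
    rw [this]
    exact P.smul_mem _ (P.add_mem (hmem _) (hmem _))
  have hinr : P.comap inr.toLinearMap = ⊤ := by
    refine eq_top_of_tmulL_mem (dense_span_range_hilbertBasis b) (dense_span_range_hilbertBasis c)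
      (hcl.preimage inr.continuous) ?_
    rintro _ ⟨i, rfl⟩ _ ⟨j, rfl⟩
    have h1 := conj_phase_mul_phase (eigenPair μ ν (i, j))
    have : inr (tmulL (b i) (c j)) = starRingEnd ℂ (phase (eigenPair μ ν (i, j))) •
        (((√2)⁻¹ : ℝ) : ℂ) • (prodEigenvector b c μ ν ((i, j), true) -
        prodEigenvector b c μ ν ((i, j), false)) := by
      simp only [prodEigenvector, boolSign, ← smul_sub, smul_smul, h2, ← WithLp.toLp_sub,
        ← WithLp.toLp_smul, Prod.mk_sub_mk, Prod.smul_mk]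
      change WithLp.toLp 2 ((0 : HilbertTensor H₁ H₂), tmulL (b i) (c j)) = _
      congr 2
      · simp
      · rw [← sub_smul, smul_smul]
        conv_lhs => rw [← one_smul ℂ (tmulL (b i) (c j)), ← h1]
        congr 1
        simp only [if_true, Bool.false_eq_true, if_false]
        push_cast at h2 ⊢
        linear_combination (-2 * starRingEnd ℂ (phase (eigenPair μ ν (i, j))) *
          phase (eigenPair μ ν (i, j))) * h2
    change inr (tmulL (b i) (c j)) ∈ P
    rw [this]
    exact P.smul_mem _ (P.smul_mem _ (P.sub_mem (hmem _) (hmem _)))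
  rintro ⟨x, y⟩ -
  have hx : inl x ∈ P := (hinl ▸ Submodule.mem_top : x ∈ P.comap inl.toLinearMap)
  have hy : inr y ∈ P := (hinr ▸ Submodule.mem_top : y ∈ P.comap inr.toLinearMap)
  have : (WithLp.toLp 2 (x, y) : Double (HilbertTensor H₁ H₂)) = inl x + inr y := by
    change _ = WithLp.toLp 2 (x, (0 : HilbertTensor H₁ H₂)) + WithLp.toLp 2 (0, y)
    rw [← WithLp.toLp_add, Prod.mk_add_mk, add_zero, zero_add]
  rw [this]
  exact P.add_mem hx hy

/-- The Hilbert basis of eigenvectors of the exterior product operator. -/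
def prodEigenbasis : HilbertBasis ((ι × κ) × Bool) ℂ (Double (HilbertTensor H₁ H₂)) :=
  HilbertBasis.mk (orthonormal_prodEigenvector b c μ ν) (top_le_span_prodEigenvector b c μ ν)

/-- The eigenvalues `± |μᵢ + i νⱼ|` of the exterior product operator. -/
def prodEigenvalue (p : (ι × κ) × Bool) : ℝ := boolSign p.2 * ‖eigenPair μ ν p.1‖

/-- The modulus `|μ + i ν|` dominates both `|μ|` and `|ν|`, so a bound on it leaves finitely many
`i` and `j`. -/
theorem finite_prodEigenvalue (hμ : ∀ N : ℝ, {i | |μ i| ≤ N}.Finite)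
    (hν : ∀ N : ℝ, {j | |ν j| ≤ N}.Finite) (N : ℝ) :
    {p | |prodEigenvalue μ ν p| ≤ N}.Finite := by
  refine (((hμ N).prod (hν N)).prod (Set.finite_univ (α := Bool))).subset ?_
  rintro ⟨⟨i, j⟩, s⟩ h
  have h1 : ‖eigenPair μ ν (i, j)‖ ≤ N := by
    have h0 : |boolSign s| = 1 := by cases s <;> simp [boolSign]
    simpa [prodEigenvalue, abs_mul, h0] using h
  refine ⟨⟨?_, ?_⟩, trivial⟩
  · refine le_trans ?_ h1
    simpa [eigenPair] using Complex.abs_re_le_norm (eigenPair μ ν (i, j))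
  · refine le_trans ?_ h1
    simpa [eigenPair] using Complex.abs_im_le_norm (eigenPair μ ν (i, j))

variable {b c μ ν}

/-- The eigenvectors are built from algebraic tensors of domain vectors, so they lie in the core
itself and not just in the domain of its closure. This is the input of `closure_eq_diagOp`. -/
theorem prodEigenvector_mem_graph {D₁ : H₁ →ₗ.[ℂ] H₁} {D₂ : H₂ →ₗ.[ℂ] H₂}
    (hb : ∀ i, (b i, (μ i : ℂ) • b i) ∈ D₁.graph) (hc : ∀ j, (c j, (ν j : ℂ) • c j) ∈ D₂.graph)
    (p : (ι × κ) × Bool) :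
    (prodEigenvector b c μ ν p, (prodEigenvalue μ ν p : ℂ) • prodEigenvector b c μ ν p) ∈
      (prodDiracCore D₁ D₂).graph := by
  obtain ⟨⟨i, j⟩, s⟩ := p
  obtain ⟨x, hx, hx'⟩ := (LinearPMap.mem_graph_iff _).mp (hb i)
  obtain ⟨y, hy, hy'⟩ := (LinearPMap.mem_graph_iff _).mp (hc j)
  simp only at hx hx' hy hy'
  set z := eigenPair μ ν (i, j) with hz
  have hsum : ∀ r : ℂ, tensorSum D₁ D₂ r (x ⊗ₜ y) =
      ((μ i : ℂ) + r * ν j) • tmulL (b i) (c j) := by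
    intro r
    rw [tensorSum_tmul, hx, hy, hx', hy']
    simp only [map_smul, smul_apply, smul_smul, add_smul]
  have hz1 : (μ i : ℂ) + Complex.I * ν j = z := by rw [hz, eigenPair]; ring
  have hz2 : (μ i : ℂ) + -Complex.I * ν j = starRingEnd ℂ z := by
    rw [hz, eigenPair]
    simp only [map_add, map_mul, Complex.conj_ofReal, Complex.conj_I]
    ring
  have hs : (boolSign s : ℂ) * boolSign s = 1 := by cases s <;> simp [boolSign]
  have hmem : (WithLp.toLp 2 (tmulL (b i) (c j), ((boolSign s : ℂ) * phase z) •
      tmulL (b i) (c j)), (prodEigenvalue μ ν ((i, j), s) : ℂ) •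
      WithLp.toLp 2 (tmulL (b i) (c j), ((boolSign s : ℂ) * phase z) • tmulL (b i) (c j))) ∈
      (prodDiracCore D₁ D₂).graph := by
    refine mem_graph_prodDiracCore.mpr ⟨x ⊗ₜ y, ((boolSign s : ℂ) * phase z) • x ⊗ₜ y, ?_, ?_⟩
    · rw [map_smul, coreIncl_tmul, hx, hy]
    · rw [map_smul, hsum, hsum, hz1, hz2, ← WithLp.toLp_smul, Prod.smul_mk, smul_smul, smul_smul,
        prodEigenvalue, ← hz]
      congr 3
      -- The two components of the eigenvalue equation are `z̄ · (± z / |z|) = ±|z|` and `z = ±|z| ·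
      -- (± z / |z|)`.
      · rw [mul_assoc, mul_comm (phase z), conj_mul_phase]
        push_cast
        rfl
      · push_cast
        linear_combination -norm_mul_phase z - (‖z‖ : ℂ) * phase z * hs
  have := (prodDiracCore D₁ D₂).graph.smul_mem (((√2)⁻¹ : ℝ) : ℂ) hmem
  rwa [Prod.smul_mk, smul_comm] at this

/-- The exterior product of symmetric operators with Hilbert bases of eigenvectors is essentially
self-adjoint, and its closure depends only on the eigenvectors and eigenvalues. -/
theorem prodDirac_eq_diagOp {D₁ : H₁ →ₗ.[ℂ] H₁} {D₂ : H₂ →ₗ.[ℂ] H₂}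
    (h₁ : D₁.IsFormalAdjoint D₁) (h₂ : D₂.IsFormalAdjoint D₂)
    (hb : ∀ i, (b i, (μ i : ℂ) • b i) ∈ D₁.graph) (hc : ∀ j, (c j, (ν j : ℂ) • c j) ∈ D₂.graph) :
    (prodDiracCore D₁ D₂).IsClosable ∧
      prodDirac D₁ D₂ = diagOp (prodEigenbasis b c μ ν) (prodEigenvalue μ ν) :=
  closure_eq_diagOp (isFormalAdjoint_prodDiracCore h₁ h₂) fun p => by
    rw [prodEigenbasis, HilbertBasis.coe_mk]
    exact prodEigenvector_mem_graph hb hc p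

end Eigen

/-! ### Eigenvectors of operators with compact resolvent -/

section CompactResolvent

/-- The eigenvalues of a compact operator on an orthonormal family accumulate only at `0`. -/
theorem IsCompactOperator.finite_eigenvalues {ι : Type*} {E : Type*} [NormedAddCommGroup E]
    [InnerProductSpace ℂ E] {K : E →L[ℂ] E} (hK : IsCompactOperator K) {b : ι → E}
    (hb : Orthonormal ℂ b) {μ : ι → ℝ} (h : ∀ i, K (b i) = (μ i : ℂ) • b i) {c : ℝ} (hc : 0 < c) :
    {i | c ≤ |μ i|}.Finite := by
  by_contra hinf
  have e := Set.Infinite.natEmbedding _ hinf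
  obtain ⟨C, hC, hsub⟩ := hK.image_closedBall_subset_compact (f := K.toLinearMap) 1
  have hmem : ∀ n, K (b (e n)) ∈ C := fun n =>
    hsub ⟨b (e n), by simp [hb.1], rfl⟩
  obtain ⟨a, -, φ, hφ, hlim⟩ := hC.tendsto_subseq hmem
  have hcau := hlim.cauchySeq
  rw [Metric.cauchySeq_iff'] at hcau
  obtain ⟨N, hN⟩ := hcau c hc
  have h1 := hN (N + 1) (Nat.le_succ N)
  set i : ι := (e (φ (N + 1))).1 with hi
  set j : ι := (e (φ N)).1 with hj
  have hij : i ≠ j := by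
    intro h
    have := hφ.injective (e.injective (Subtype.ext h))
    omega
  -- By Pythagoras the images of distinct basis vectors stay at distance at least `c`, so no
  -- subsequence of them is Cauchy.
  have h2 : ‖K (b i) - K (b j)‖ ^ 2 = |μ i| ^ 2 + |μ j| ^ 2 := by
    have h0 : inner ℂ (K (b i)) (K (b j)) = 0 := by
      rw [h, h, inner_smul_left, inner_smul_right, hb.2 hij]
      simp
    rw [@norm_sub_sq ℂ, h0, h, h, norm_smul, norm_smul, hb.1, hb.1]
    simp
  rw [dist_eq_norm] at h1
  change ‖K (b i) - K (b j)‖ < c at h1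
  have h3 : c ≤ |μ i| := (e (φ (N + 1))).2
  nlinarith [sq_nonneg (|μ j|), norm_nonneg (K (b i) - K (b j))]

variable {E : Type v} [NormedAddCommGroup E] [InnerProductSpace ℂ E]

/-- The eigenspace of an unbounded operator. -/
def pmapEigenspace (D : E →ₗ.[ℂ] E) (t : ℝ) : Submodule ℂ E :=
  D.graph.comap (LinearMap.prod LinearMap.id ((t : ℂ) • LinearMap.id))

theorem mem_pmapEigenspace {D : E →ₗ.[ℂ] E} {t : ℝ} {x : E} :
    x ∈ pmapEigenspace D t ↔ (x, (t : ℂ) • x) ∈ D.graph := Iff.rfl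

theorem isClosed_pmapEigenspace {D : E →ₗ.[ℂ] E} (hD : D.IsClosed) (t : ℝ) :
    IsClosed (pmapEigenspace D t : Set E) :=
  IsClosed.preimage (f := fun x : E => (x, (t : ℂ) • x)) (by fun_prop) hD

variable {D : E →ₗ.[ℂ] E}

theorem LinearPMap.IsFormalAdjoint.inner_eq {D : E →ₗ.[ℂ] E} (hD : D.IsFormalAdjoint D)
    {x y x' y' : E} (h : (x, y) ∈ D.graph) (h' : (x', y') ∈ D.graph) :
    inner ℂ y x' = inner ℂ x y' := by
  obtain ⟨z, rfl, rfl⟩ := (LinearPMap.mem_graph_iff _).mp h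
  obtain ⟨z', rfl, rfl⟩ := (LinearPMap.mem_graph_iff _).mp h'
  exact hD z z'

theorem orthogonalFamily_pmapEigenspace (hD : D.IsFormalAdjoint D) :
    OrthogonalFamily ℂ (fun t => pmapEigenspace D t) fun t => (pmapEigenspace D t).subtypeₗᵢ := by
  rintro s t hst ⟨x, hx⟩ ⟨y, hy⟩
  have h := hD.inner_eq hx hy
  rw [LinearMap.id_apply, LinearMap.id_apply] at h
  change inner ℂ ((s : ℂ) • x) y = inner ℂ x ((t : ℂ) • y) at h
  rw [inner_smul_left, inner_smul_right, Complex.conj_ofReal, ← sub_eq_zero, ← sub_mul] at h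
  rcases mul_eq_zero.mp h with h | h
  · exact absurd (by exact_mod_cast sub_eq_zero.mp h) hst
  · exact h

variable [CompleteSpace E]

theorem IsSelfAdjoint.isFormalAdjoint (hD : IsSelfAdjoint D) : D.IsFormalAdjoint D := by
  have := LinearPMap.adjoint_isFormalAdjoint hD.dense_domain
  rwa [LinearPMap.isSelfAdjoint_def.mp hD] at this

variable {S : E →L[ℂ] E}

/-- The equation `(1 + D²) S² ξ = ξ` is split into two first-order relations, with `η = D S² ξ`. -/
theorem IsInvSqrtOneAddSq.exists_mem_graph (hS : IsInvSqrtOneAddSq D S) (ξ : E) :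
    ∃ η, (S (S ξ), η) ∈ D.graph ∧ (η, ξ - S (S ξ)) ∈ D.graph := by
  obtain ⟨h₁, h₂, h⟩ := hS.2 ξ
  refine ⟨_, D.mem_graph ⟨_, h₁⟩, ?_⟩
  have := D.mem_graph ⟨_, h₂⟩
  rwa [← eq_sub_iff_add_eq'.mpr h]

/-- The difference `u` of the two sides satisfies `D u = w` and `D w = -u` for some `w`. Symmetry
then gives `‖w‖² = -‖u‖²`, so `u = 0`. -/
theorem IsInvSqrtOneAddSq.apply_eigenvector (hD : D.IsFormalAdjoint D)
    (hS : IsInvSqrtOneAddSq D S) {t : ℝ} {e : E} (he : (e, (t : ℂ) • e) ∈ D.graph) :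
    S (S e) = (((1 + t ^ 2)⁻¹ : ℝ) : ℂ) • e := by
  obtain ⟨η, h1, h2⟩ := hS.exists_mem_graph e
  set r : ℂ := (((1 + t ^ 2)⁻¹ : ℝ) : ℂ) with hr
  have hr' : r * (t * t) = 1 - r := by
    rw [hr]
    norm_cast
    have : 1 + t ^ 2 ≠ 0 := by positivity
    field_simp
    ring
  have he' := D.graph.smul_mem r he
  have he'' := D.graph.smul_mem (r * t) he
  rw [Prod.smul_mk] at he' he''
  have g1 := D.graph.sub_mem h1 he'
  have g2 := D.graph.sub_mem h2 he''
  rw [Prod.mk_sub_mk] at g1 g2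
  have hq : η - r • (t : ℂ) • e = η - (r * t) • e := by rw [smul_smul]
  rw [hq] at g1
  have hd : e - S (S e) - (r * t) • (t : ℂ) • e = -(S (S e) - r • e) := by
    rw [smul_smul, mul_assoc, hr', sub_smul, one_smul]
    abel
  rw [hd] at g2
  have h := hD.inner_eq g1 g2
  rw [inner_neg_right, inner_self_eq_norm_sq_to_K, inner_self_eq_norm_sq_to_K] at h
  have h' : ‖η - (r * t) • e‖ ^ 2 = -‖S (S e) - r • e‖ ^ 2 := by exact_mod_cast h
  have h0 : ‖S (S e) - r • e‖ = 0 := by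
    nlinarith [sq_nonneg ‖η - (r * t) • e‖, sq_nonneg ‖S (S e) - r • e‖]
  exact sub_eq_zero.mp (norm_eq_zero.mp h0)

/-- An eigenvector of `(1 + D²)⁻¹` is a sum of eigenvectors of `D`. -/
theorem IsInvSqrtOneAddSq.eigenvector_mem (hD : D.IsFormalAdjoint D)
    (hS : IsInvSqrtOneAddSq D S) {m : ℂ} {ξ : E} (hξ : S (S ξ) = m • ξ) :
    ξ ∈ ⨆ t, pmapEigenspace D t := by
  by_cases hξ0 : ξ = 0
  · rw [hξ0]; exact Submodule.zero_mem _
  obtain ⟨η, h1, h2⟩ := hS.exists_mem_graph ξ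
  rw [hξ] at h1 h2
  have hm : m ≠ 0 := by
    rintro rfl
    rw [zero_smul] at h1 h2
    have h0 := D.graph_fst_eq_zero_snd h1 rfl
    rw [h0, sub_zero] at h2
    exact hξ0 (D.graph_fst_eq_zero_snd h2 rfl)
  -- This vector is `D ξ`.
  obtain ⟨y, hy⟩ : ∃ y, y = m⁻¹ • η := ⟨_, rfl⟩
  have g1 : (ξ, y) ∈ D.graph := by
    have := D.graph.smul_mem m⁻¹ h1
    rwa [Prod.smul_mk, smul_smul, inv_mul_cancel₀ hm, one_smul, ← hy] at this
  -- Since `D² ξ = (m⁻¹ - 1) ξ`, symmetry gives `(m⁻¹ - 1) ‖ξ‖² = ‖D ξ‖²`, so `s` is the nonnegative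
  -- square root of `m⁻¹ - 1`.
  set s : ℝ := ‖y‖ / ‖ξ‖ with hs
  have hn : ‖ξ‖ ≠ 0 := norm_ne_zero_iff.mpr hξ0
  have g2 : (y, ((s : ℂ) * s) • ξ) ∈ D.graph := by
    have h := D.graph.smul_mem m⁻¹ h2
    have h' : m⁻¹ • (ξ - m • ξ) = (m⁻¹ - 1) • ξ := by
      rw [smul_sub, smul_smul, inv_mul_cancel₀ hm, sub_smul]
    rw [Prod.smul_mk, h', ← hy] at h
    have hin := hD.inner_eq g1 h
    rw [inner_smul_right, inner_self_eq_norm_sq_to_K, inner_self_eq_norm_sq_to_K] at hin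
    have hν : m⁻¹ - 1 = (s : ℂ) * s := by
      have hn' : (‖ξ‖ : ℂ) ≠ 0 := by exact_mod_cast hn
      rw [hs]
      push_cast
      rw [div_mul_div_comm, eq_div_iff (mul_ne_zero hn' hn'), ← pow_two, ← pow_two]
      exact hin.symm
    rwa [hν] at h
  by_cases hs0 : s = 0
  · refine Submodule.mem_iSup_of_mem 0 (mem_pmapEigenspace.mpr ?_)
    have : y = 0 := by
      rw [hs, div_eq_zero_iff, or_iff_left hn] at hs0
      exact norm_eq_zero.mp hs0
    rw [this] at g1
    simpa using g1
  · have hs0' : (s : ℂ) ≠ 0 := by exact_mod_cast hs0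
    -- From `D² ξ = s² ξ`, the vectors `ξ ± s⁻¹ D ξ` satisfy the eigenvalue equation of `D` for
    -- `±s`.
    have hdec : ξ = (2⁻¹ : ℂ) • (ξ + (s : ℂ)⁻¹ • y) + (2⁻¹ : ℂ) • (ξ - (s : ℂ)⁻¹ • y) := by
      module
    have g2' := D.graph.smul_mem (s : ℂ)⁻¹ g2
    rw [Prod.smul_mk, smul_smul, inv_mul_cancel_left₀ hs0'] at g2'
    have k1 := D.graph.add_mem g1 g2'
    have k2 := D.graph.sub_mem g1 g2'
    rw [Prod.mk_add_mk] at k1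
    rw [Prod.mk_sub_mk] at k2
    rw [hdec]
    refine Submodule.add_mem _ (Submodule.smul_mem _ _ ?_) (Submodule.smul_mem _ _ ?_)
    · refine Submodule.mem_iSup_of_mem s (mem_pmapEigenspace.mpr ?_)
      rwa [smul_add, smul_smul, mul_inv_cancel₀ hs0', one_smul, add_comm (_ • ξ)]
    · refine Submodule.mem_iSup_of_mem (-s) (mem_pmapEigenspace.mpr ?_)
      rwa [smul_sub, smul_smul, Complex.ofReal_neg, neg_mul, mul_inv_cancel₀ hs0', neg_smul,
        neg_smul, one_smul, sub_neg_eq_add, neg_add_eq_sub]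

/-- A self-adjoint operator with compact resolvent has a Hilbert basis of eigenvectors, with
eigenvalues tending to infinity. -/
theorem exists_eigenbasis (hD : IsSelfAdjoint D)
    (hS : ∃ S : E →L[ℂ] E, IsInvSqrtOneAddSq D S ∧ IsCompactOperator S) :
    ∃ (ι : Type v) (b : HilbertBasis ι ℂ E) (μ : ι → ℝ), (∀ N : ℝ, {i | |μ i| ≤ N}.Finite) ∧
      ∀ i, (b i, (μ i : ℂ) • b i) ∈ D.graph := by
  obtain ⟨S, hS, hcpt⟩ := hS
  have hsym := hD.isFormalAdjoint
  have hcomp : ∀ t, CompleteSpace (pmapEigenspace D t) := fun t =>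
    (isClosed_pmapEigenspace hD.isClosed t).completeSpace_coe
  choose w β hβ using fun t => exists_hilbertBasis ℂ (pmapEigenspace D t)
  have horth := (orthogonalFamily_pmapEigenspace hsym).orthonormal_sigma_orthonormal
    (fun t => (β t).orthonormal)
  have hN : IsCompactOperator (S * S) := hcpt.comp_clm S
  have hNsym : (S * S : E →L[ℂ] E).IsSymmetric := by
    intro x y
    have := hS.1.isSymmetric
    exact (this (S x) y).trans (this x (S y))
  -- The eigenspaces of the compact symmetric operator `S²` are total by the spectral theorem. Each
  -- is contained in the span of the eigenspaces of `D`, so these are total too.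
  have hbot : (Submodule.span ℂ (Set.range fun a : Σ t, w t =>
      (pmapEigenspace D a.1).subtypeₗᵢ (β a.1 a.2)))ᗮ = ⊥ := by
    rw [eq_bot_iff, ← ContinuousLinearMap.orthogonalComplement_iSup_eigenspaces_eq_bot hN hNsym]
    refine le_trans (b := (⨆ t, pmapEigenspace D t)ᗮ) ?_
      (Submodule.orthogonal_le (iSup_le fun m ξ hξ => ?_))
    rotate_left
    · exact hS.eigenvector_mem hsym (Module.End.mem_eigenspace_iff.mp hξ)
    · intro x hx
      rw [Submodule.mem_orthogonal'] at hx ⊢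
      have hle : ⨆ t, pmapEigenspace D t ≤ LinearMap.ker (innerSL ℂ x).toLinearMap := by
        refine iSup_le fun t => ?_
        have h0 : (innerSL ℂ x) ∘L (pmapEigenspace D t).subtypeL = 0 := by
          refine ContinuousLinearMap.ext_on (dense_span_range_hilbertBasis (β t)) ?_
          rintro _ ⟨a, rfl⟩
          exact hx _ (Submodule.subset_span ⟨⟨t, a⟩, rfl⟩)
        intro y hy
        exact DFunLike.congr_fun h0 ⟨y, hy⟩
      intro u hu
      exact hle hu
  refine ⟨Σ t, w t, HilbertBasis.mkOfOrthogonalEqBot horth hbot, fun a => a.1, ?_, ?_⟩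
  · have hgr : ∀ a : Σ t, w t, (S * S : E →L[ℂ] E) ((pmapEigenspace D a.1).subtypeₗᵢ (β a.1 a.2)) =
        (((1 + a.1 ^ 2)⁻¹ : ℝ) : ℂ) • (pmapEigenspace D a.1).subtypeₗᵢ (β a.1 a.2) := fun a =>
      hS.apply_eigenvector hsym (β a.1 a.2).2
    intro N
    -- Eigenvalues of `D` in `[-N, N]` give eigenvalues of `S²` that are at least `(1 + N²)⁻¹`. The
    -- index type counts them with multiplicity.
    refine (hN.finite_eigenvalues horth hgr (c := (1 + N ^ 2)⁻¹) (by positivity)).subset ?_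
    intro a ha
    have ha' : |a.1| ≤ N := ha
    change _ ≤ |(1 + a.1 ^ 2)⁻¹|
    rw [abs_of_pos (by positivity)]
    gcongr (1 + ?_)⁻¹
    exact sq_le_sq' (abs_le.mp ha').1 (abs_le.mp ha').2
  · intro a
    rw [HilbertBasis.coe_mkOfOrthogonalEqBot]
    exact (β a.1 a.2).2

end CompactResolvent

/-! ### The length operator -/

section L2

variable {G : Type u}

theorem norm_L2δ (x : G) : ‖L2.δ x‖ = 1 := by
  classical
  rw [L2.δ, lp.norm_single (by norm_num), norm_one]

open Classical in
theorem inner_L2δ (x y : G) :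
    inner ℂ (L2.δ x) (L2.δ y) = if x = y then (1 : ℂ) else 0 := by
  rw [L2.δ, L2.δ, lp.inner_single_left, lp.single_apply]
  by_cases h : x = y
  · subst h; simp
  · simp [h]

theorem dense_span_L2δ (G : Type u) :
    Dense (Submodule.span ℂ (Set.range (L2.δ (G := G))) : Set (L2 G)) := by
  classical
  have h := dense_span_range_hilbertBasis
    (HilbertBasis.ofRepr (LinearIsometryEquiv.refl ℂ (L2 G)))
  have h' : ⇑(HilbertBasis.ofRepr (LinearIsometryEquiv.refl ℂ (L2 G))) = L2.δ := by
    funext x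
    rw [← HilbertBasis.repr_symm_single]
    rfl
  rwa [h'] at h

theorem weightedShift_single {ι : Type*} [DecidableEq ι] {E : Type*} [NormedAddCommGroup E]
    [InnerProductSpace ℂ E] (e : ι ≃ ι) (T : ι → E →L[ℂ] E) (C : ℝ) (hC : ∀ i, ‖T i‖ ≤ C) (i : ι)
    (v : E) : weightedShift (E := fun _ : ι => E) e T C hC (lp.single 2 i v) =
      lp.single 2 (e.symm i) (T (e.symm i) v) := by
  ext j
  rw [weightedShift_apply, lp.single_apply, lp.single_apply]
  by_cases h : j = e.symm i
  · subst h; simp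
  · have h' : e j ≠ i := fun h' => h (by rw [← h', Equiv.symm_apply_apply])
    simp [h, h']

theorem leftReg_L2δ [Group G] (g x : G) : leftReg g (L2.δ x) = L2.δ (g * x) := by
  classical
  rw [leftReg, L2.δ, weightedShift_single]
  simp [L2.δ]

end L2

section Fibred

open HilbertTensor

variable {G : Type u} {V : Type v} [NormedAddCommGroup V] [InnerProductSpace ℂ V]

theorem fibreMap_single (m : G → V →ₗ[ℂ] V) (x : G) (v : V) :
    fibreMap m (Finsupp.single x v) = tmulL (L2.δ x) (m x v) := by
  rw [fibreMap, Finsupp.lsum_single]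
  rfl

theorem mem_graph_lengthCore {ℓ : G → V →L[ℂ] V} {x y : HilbertTensor (L2 G) V} :
    (x, y) ∈ (lengthCore ℓ).graph ↔ ∃ f : G →₀ V, fibreMap (fun _ => LinearMap.id) f = x ∧
      fibreMap (fun x => (ℓ x).toLinearMap) f = y :=
  mem_graph_pmapOfParam _ _ _

variable [CompleteSpace V]

theorem isHilbertSum_fibres (G : Type u) (V : Type v) [NormedAddCommGroup V]
    [InnerProductSpace ℂ V] [CompleteSpace V] :
    IsHilbertSum ℂ (fun _ : G => V) fun x => tmulLeft V (L2.δ x) (norm_L2δ x) := by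
  classical
  refine IsHilbertSum.mk ?_ ?_
  · intro x y hxy v w
    change inner ℂ (tmulL (L2.δ x) v) (tmulL (L2.δ y) w) = 0
    rw [inner_tmulL, inner_L2δ, if_neg hxy, zero_mul]
  · refine (eq_top_of_tmulL_mem (dense_span_L2δ G) (dense_span_univ V)
      (Submodule.isClosed_topologicalClosure _) ?_).ge
    rintro _ ⟨x, rfl⟩ v -
    refine Submodule.le_topologicalClosure _ (Submodule.mem_iSup_of_mem x ?_)
    exact ⟨v, rfl⟩

/-- The identification `ℓ²(G) ⊗ V = ℓ²(G, V)`. -/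
def fibreEquiv (G : Type u) (V : Type v) [NormedAddCommGroup V] [InnerProductSpace ℂ V]
    [CompleteSpace V] : HilbertTensor (L2 G) V ≃ₗᵢ[ℂ] lp (fun _ : G => V) 2 :=
  (isHilbertSum_fibres G V).linearIsometryEquiv

open Classical in
theorem fibreEquiv_symm_single (x : G) (v : V) :
    (fibreEquiv G V).symm (lp.single 2 x v) = tmulL (L2.δ x) v :=
  (isHilbertSum_fibres G V).linearIsometryEquiv_symm_apply_single v

open Classical in
theorem fibreEquiv_tmulL (x : G) (v : V) :
    fibreEquiv G V (tmulL (L2.δ x) v) = lp.single 2 x v := by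
  rw [← fibreEquiv_symm_single, LinearIsometryEquiv.apply_symm_apply]

end Fibred

section Length

open HilbertTensor

variable {G : Type u} {V : Type v} [NormedAddCommGroup V] [InnerProductSpace ℂ V]
  [CompleteSpace V] {ℓ : G → V →L[ℂ] V}

theorem isFormalAdjoint_lengthCore (hℓ : ∀ x, IsSelfAdjoint (ℓ x)) :
    (lengthCore ℓ).IsFormalAdjoint (lengthCore ℓ) := by
  classical
  intro p q
  obtain ⟨f, hf, hf'⟩ := mem_graph_lengthCore.mp ((lengthCore ℓ).mem_graph p)
  obtain ⟨g, hg, hg'⟩ := mem_graph_lengthCore.mp ((lengthCore ℓ).mem_graph q)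
  rw [← hf, ← hf', ← hg, ← hg']
  clear hf hf' hg hg'
  induction f using Finsupp.induction_linear with
  | zero => simp
  | add a b ha hb => simp only [map_add, inner_add_left, ha, hb]
  | single x v =>
    induction g using Finsupp.induction_linear with
    | zero => simp
    | add c d hc hd => simp only [map_add, inner_add_right, hc, hd]
    | single y w =>
      simp only [fibreMap_single, inner_tmulL, inner_L2δ, LinearMap.id_apply,
        ContinuousLinearMap.coe_coe]
      by_cases h : x = y
      · subst h
        rw [if_pos rfl, one_mul, one_mul]
        exact (hℓ x).isSymmetric v w
      · simp [h]

/-- The commutator is the shift by `g` weighted with `ℓ(x) - ℓ(g⁻¹ x)`, which translation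
boundedness makes a bounded operator on `ℓ²(G, V)`. -/
theorem hasBoundedCommutator_lengthCore [Group G]
    (hℓ : ∀ y, ∃ C : ℝ, ∀ x, ‖ℓ x - ℓ (y⁻¹ * x)‖ ≤ C) (g : G) :
    HasBoundedCommutator (lengthCore ℓ) (tensorOp (leftReg g) (1 : V →L[ℂ] V)) := by
  classical
  obtain ⟨C, hC⟩ := hℓ g
  rw [hasBoundedCommutator_iff]
  refine ⟨(fibreEquiv G V).symm.toContinuousLinearEquiv.toContinuousLinearMap ∘L
    weightedShift (E := fun _ : G => V) (Equiv.mulLeft g⁻¹) (fun x => ℓ x - ℓ (g⁻¹ * x)) C hC ∘L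
    (fibreEquiv G V).toContinuousLinearEquiv.toContinuousLinearMap, fun x y hxy => ?_⟩
  obtain ⟨f, rfl, rfl⟩ := mem_graph_lengthCore.mp hxy
  refine mem_graph_lengthCore.mpr ⟨Finsupp.lmapDomain V ℂ (g * ·) f, ?_, ?_⟩ <;> clear hxy
  · induction f using Finsupp.induction_linear with
    | zero => simp
    | add a b ha hb => simp only [map_add, ha, hb]
    | single x v =>
      rw [Finsupp.lmapDomain_apply, Finsupp.mapDomain_single, fibreMap_single, fibreMap_single,
        tensorOp_tmulL, leftReg_L2δ]
      rfl
  · induction f using Finsupp.induction_linear with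
    | zero => simp
    | add a b ha hb =>
      simp only [map_add, ha, hb]
      abel
    | single x v =>
      rw [Finsupp.lmapDomain_apply, Finsupp.mapDomain_single, fibreMap_single, fibreMap_single,
        fibreMap_single, tensorOp_tmulL, leftReg_L2δ]
      change _ = _ + (fibreEquiv G V).symm (weightedShift (E := fun _ : G => V) _ _ C hC
        (fibreEquiv G V (tmulL (L2.δ x) v)))
      rw [fibreEquiv_tmulL, weightedShift_single, fibreEquiv_symm_single]
      simp only [Equiv.mulLeft_symm_apply, inv_inv, inv_mul_cancel_left, one_apply_eq_self,
        sub_apply, map_sub, ContinuousLinearMap.coe_coe]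
      abel

variable [FiniteDimensional ℂ V]

/-- The eigenvectors `δₓ ⊗ v` of the length operator. -/
def lengthEigenvector (hℓ : ∀ x, IsSelfAdjoint (ℓ x)) (p : G × Fin (Module.finrank ℂ V)) :
    HilbertTensor (L2 G) V :=
  tmulL (L2.δ p.1) ((hℓ p.1).isSymmetric.eigenvectorBasis rfl p.2)

/-- The eigenvalues of the length operator. -/
def lengthEigenvalue (hℓ : ∀ x, IsSelfAdjoint (ℓ x)) (p : G × Fin (Module.finrank ℂ V)) : ℝ :=
  (hℓ p.1).isSymmetric.eigenvalues rfl p.2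

theorem orthonormal_lengthEigenvector (hℓ : ∀ x, IsSelfAdjoint (ℓ x)) :
    Orthonormal ℂ (lengthEigenvector hℓ) := by
  classical
  rw [orthonormal_iff_ite]
  rintro ⟨x, i⟩ ⟨y, j⟩
  rw [lengthEigenvector, lengthEigenvector, inner_tmulL, inner_L2δ]
  by_cases h : x = y
  · subst h
    simp [orthonormal_iff_ite.mp (OrthonormalBasis.orthonormal _)]
  · simp [h]

theorem top_le_span_lengthEigenvector (hℓ : ∀ x, IsSelfAdjoint (ℓ x)) :
    ⊤ ≤ (Submodule.span ℂ (Set.range (lengthEigenvector hℓ))).topologicalClosure := by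
  refine (eq_top_of_tmulL_mem (dense_span_L2δ G) (dense_span_univ V)
    (Submodule.isClosed_topologicalClosure _) ?_).ge
  rintro _ ⟨x, rfl⟩ v -
  refine Submodule.le_topologicalClosure _ ?_
  rw [← ((hℓ x).isSymmetric.eigenvectorBasis rfl).sum_repr v, map_sum]
  refine Submodule.sum_mem _ fun i _ => ?_
  rw [map_smul]
  exact Submodule.smul_mem _ _ (Submodule.subset_span ⟨(x, i), rfl⟩)

/-- The Hilbert basis of eigenvectors of the length operator. -/
def lengthEigenbasis (hℓ : ∀ x, IsSelfAdjoint (ℓ x)) :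
    HilbertBasis (G × Fin (Module.finrank ℂ V)) ℂ (HilbertTensor (L2 G) V) :=
  HilbertBasis.mk (orthonormal_lengthEigenvector hℓ) (top_le_span_lengthEigenvector hℓ)

theorem lengthEigenbasis_mem_graph (hℓ : ∀ x, IsSelfAdjoint (ℓ x))
    (p : G × Fin (Module.finrank ℂ V)) :
    (lengthEigenbasis hℓ p, (lengthEigenvalue hℓ p : ℂ) • lengthEigenbasis hℓ p) ∈
      (lengthCore ℓ).graph := by
  rw [lengthEigenbasis, HilbertBasis.coe_mk]
  refine mem_graph_lengthCore.mpr
    ⟨Finsupp.single p.1 ((hℓ p.1).isSymmetric.eigenvectorBasis rfl p.2), ?_, ?_⟩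
  · rw [fibreMap_single]
    rfl
  · rw [fibreMap_single, (hℓ p.1).isSymmetric.apply_eigenvectorBasis, map_smul]
    rfl

/-- A closed discrete set meets `[-N, N]` in finitely many points. Each belongs to the spectrum of
finitely many `ℓ(x)`, and each `ℓ(x)` has finitely many eigenvalues as `V` is finite-dimensional. -/
theorem IsProperLength.finite_lengthEigenvalue [Group G] (hℓ : IsProperLength ℓ) (N : ℝ) :
    {p | |lengthEigenvalue hℓ.selfAdjoint p| ≤ N}.Finite := by
  have hfin : (lengthSpectrum ℓ ∩ Set.Icc (-N) N).Finite :=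
    (isCompact_Icc.inter_left hℓ.closed).finite (hℓ.discrete.mono Set.inter_subset_left)
  have hG : (⋃ t ∈ lengthSpectrum ℓ ∩ Set.Icc (-N) N, {x | (t : ℂ) ∈ spectrum ℂ (ℓ x)}).Finite :=
    hfin.biUnion fun t ht => hℓ.finite t ht.1
  refine (hG.prod (Set.finite_univ (α := Fin (Module.finrank ℂ V)))).subset ?_
  rintro ⟨x, i⟩ h
  have hspec : ((lengthEigenvalue hℓ.selfAdjoint (x, i) : ℝ) : ℂ) ∈ spectrum ℂ (ℓ x) := by
    rw [ContinuousLinearMap.spectrum_eq]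
    exact ((hℓ.selfAdjoint x).isSymmetric.hasEigenvalue_eigenvalues rfl i).mem_spectrum
  refine ⟨Set.mem_biUnion ⟨⟨x, hspec⟩, abs_le.mp h⟩ hspec, trivial⟩

/-- The length operator is essentially self-adjoint. -/
theorem lengthDirac_eq_diagOp (hℓ : ∀ x, IsSelfAdjoint (ℓ x)) :
    (lengthCore ℓ).IsClosable ∧
      lengthDirac ℓ = diagOp (lengthEigenbasis hℓ) (lengthEigenvalue hℓ) :=
  closure_eq_diagOp (isFormalAdjoint_lengthCore hℓ) (lengthEigenbasis_mem_graph hℓ)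

end Length

/-! ### Homomorphisms of concrete C*-algebras -/

section Generating

variable {C : Type*} [CStarAlgebra C] {C' : Type*} [CStarAlgebra C']

theorem StarAlgHom.continuous_of_cstar (φ : C →⋆ₐ[ℂ] C') : Continuous φ :=
  AddMonoidHomClass.continuous_of_bound φ 1 fun x => by
    rw [one_mul]
    exact NonUnitalStarAlgHom.norm_apply_le φ x

/-- The set `g` generates the C*-algebra `C`. -/
def IsGenerating (g : Set C) : Prop :=
  ∀ B : StarSubalgebra ℂ C, IsClosed (B : Set C) → g ⊆ B → B = ⊤

variable {g : Set C}

/-- A `*`-subalgebra whose closure contains a generating set is dense. -/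
theorem IsGenerating.dense (hg : IsGenerating g) (W : Submodule ℂ C) (h1 : (1 : C) ∈ W)
    (hmul : ∀ a ∈ W, ∀ b ∈ W, a * b ∈ W) (hstar : ∀ a ∈ W, star a ∈ W)
    (h : g ⊆ closure (W : Set C)) : Dense (W : Set C) := by
  let B : StarSubalgebra ℂ C :=
    { W with
      mul_mem' := fun {a b} ha hb => hmul a ha b hb
      one_mem' := h1
      algebraMap_mem' := fun c => by
        rw [Algebra.algebraMap_eq_smul_one]
        exact W.smul_mem c h1
      star_mem' := fun {a} ha => hstar a ha }
  have hB := hg B.topologicalClosure B.isClosed_topologicalClosure h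
  intro x
  exact (hB ▸ StarSubalgebra.mem_top : x ∈ B.topologicalClosure)

theorem IsGenerating.hom_ext (hg : IsGenerating g) {φ φ' : C →⋆ₐ[ℂ] C'}
    (h : ∀ x ∈ g, φ x = φ' x) : φ = φ' := by
  have := hg (StarAlgHom.equalizer φ φ') (isClosed_eq φ.continuous_of_cstar φ'.continuous_of_cstar) h
  ext x
  exact (this ▸ StarSubalgebra.mem_top : x ∈ StarAlgHom.equalizer φ φ')

theorem IsGenerating.hom_mem (hg : IsGenerating g) (φ : C →⋆ₐ[ℂ] C') {B : StarSubalgebra ℂ C'}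
    (hB : IsClosed (B : Set C')) (h : ∀ x ∈ g, φ x ∈ B) (x : C) : φ x ∈ B := by
  have := hg (B.comap φ) (hB.preimage φ.continuous_of_cstar) h
  exact (this ▸ StarSubalgebra.mem_top : x ∈ B.comap φ)

end Generating

section OpAlgHom

variable {K : Type*} [NormedAddCommGroup K] [InnerProductSpace ℂ K] [CompleteSpace K]
  {L : Type*} [NormedAddCommGroup L] [InnerProductSpace ℂ L] [CompleteSpace L]
  {s : Set (K →L[ℂ] K)} {t : Set (L →L[ℂ] L)}

theorem OpAlg.val_injective (s : Set (K →L[ℂ] K)) : Function.Injective (OpAlg.val s) :=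
  Subtype.val_injective

theorem OpAlg.isometry_val (s : Set (K →L[ℂ] K)) : Isometry (OpAlg.val s) := isometry_subtype_coe

theorem OpAlg.val_mem (x : OpAlg s) : OpAlg.val s x ∈ cstarGen s := x.2

theorem MinTensor.val_tmul (b : OpAlg s) (c : OpAlg t) :
    OpAlg.val _ (MinTensor.tmul b c) = tensorOp (OpAlg.val s b) (OpAlg.val t c) := rfl

/-- A closed `*`-subalgebra that contains the generators is everything. -/
theorem OpAlg.eq_top_of_gen_mem (B : StarSubalgebra ℂ (OpAlg s))
    (hB : IsClosed (B : Set (OpAlg s))) (h : ∀ T (hT : T ∈ s), OpAlg.gen T hT ∈ B) : B = ⊤ := by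
  have hcl : IsClosed ((B.map (OpAlg.val s) : StarSubalgebra ℂ (K →L[ℂ] K)) : Set (K →L[ℂ] K)) :=
    (OpAlg.isometry_val s).isClosedEmbedding.isClosedMap _ hB
  have hle : cstarGen s ≤ B.map (OpAlg.val s) := by
    refine StarSubalgebra.topologicalClosure_minimal ?_ hcl
    refine StarAlgebra.adjoin_le fun T hT => ?_
    exact ⟨OpAlg.gen T hT, h T hT, rfl⟩
  rw [eq_top_iff]
  rintro x -
  obtain ⟨y, hy, hyx⟩ := hle (OpAlg.val_mem x)
  rwa [← OpAlg.val_injective s hyx]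

theorem OpAlg.isGenerating (s : Set (K →L[ℂ] K)) :
    IsGenerating {x : OpAlg s | ∃ T, ∃ hT : T ∈ s, x = OpAlg.gen T hT} := fun B hB h =>
  OpAlg.eq_top_of_gen_mem B hB fun T hT => h ⟨T, hT, rfl⟩

theorem OpAlg.hom_ext {C : Type*} [CStarAlgebra C] {f g : OpAlg s →⋆ₐ[ℂ] C}
    (h : ∀ T (hT : T ∈ s), f (OpAlg.gen T hT) = g (OpAlg.gen T hT)) : f = g :=
  (OpAlg.isGenerating s).hom_ext (by rintro _ ⟨T, hT, rfl⟩; exact h T hT)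

theorem OpAlg.hom_mem_cstarGen (f : OpAlg s →⋆ₐ[ℂ] (L →L[ℂ] L))
    (h : ∀ T (hT : T ∈ s), f (OpAlg.gen T hT) ∈ cstarGen t) (x : OpAlg s) : f x ∈ cstarGen t :=
  (OpAlg.isGenerating s).hom_mem f (isClosed_cstarGen t)
    (by rintro _ ⟨T, hT, rfl⟩; exact h T hT) x

/-- A `*`-homomorphism to operators that maps the generators into a C*-algebra of operators. -/
def OpAlg.codRestrict (f : OpAlg s →⋆ₐ[ℂ] (L →L[ℂ] L))
    (h : ∀ T (hT : T ∈ s), f (OpAlg.gen T hT) ∈ cstarGen t) : OpAlg s →⋆ₐ[ℂ] OpAlg t :=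
  StarAlgHom.codRestrict f (cstarGen t) (OpAlg.hom_mem_cstarGen f h)

open ContinuousLinearMap in
theorem adjoint_isometry_apply (J : L →ₗᵢ[ℂ] K) (ξ : L) :
    adjoint J.toContinuousLinearMap (J ξ) = ξ := by
  refine ext_inner_left ℂ fun η => ?_
  rw [adjoint_inner_right]
  exact J.inner_map_map η ξ

/-- The operators which leave the range of the isometry `J` and its complement invariant. -/
def reducingAlg (J : L →ₗᵢ[ℂ] K) : StarSubalgebra ℂ (K →L[ℂ] K) where
  carrier := {T | (∀ ξ, T (J ξ) ∈ LinearMap.range J.toLinearMap) ∧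
    ∀ ξ, star T (J ξ) ∈ LinearMap.range J.toLinearMap}
  mul_mem' := by
    rintro S T ⟨hS, hS'⟩ ⟨hT, hT'⟩
    refine ⟨fun ξ => ?_, fun ξ => ?_⟩
    · obtain ⟨η, hη⟩ := hT ξ
      rw [mul_apply_eq_comp, ← hη]
      exact hS η
    · obtain ⟨η, hη⟩ := hS' ξ
      rw [star_mul, mul_apply_eq_comp, ← hη]
      exact hT' η
  add_mem' := by
    rintro S T ⟨hS, hS'⟩ ⟨hT, hT'⟩
    refine ⟨fun ξ => Submodule.add_mem _ (hS ξ) (hT ξ), fun ξ => ?_⟩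
    rw [star_add]
    exact Submodule.add_mem _ (hS' ξ) (hT' ξ)
  algebraMap_mem' c := by
    rw [Set.mem_ofPred_eq, Algebra.algebraMap_eq_smul_one, star_smul, star_one]
    exact ⟨fun ξ => Submodule.smul_mem _ _ ⟨ξ, rfl⟩, fun ξ => Submodule.smul_mem _ _ ⟨ξ, rfl⟩⟩
  star_mem' := by
    rintro T ⟨hT, hT'⟩
    refine ⟨hT', ?_⟩
    rwa [star_star]

theorem isClosed_reducingAlg (J : L →ₗᵢ[ℂ] K) :
    IsClosed (reducingAlg J : Set (K →L[ℂ] K)) := by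
  have hr : IsClosed (LinearMap.range J.toLinearMap : Set K) := by
    have := J.isometry.isClosedEmbedding.isClosed_range
    exact this
  have h : (reducingAlg J : Set (K →L[ℂ] K)) =
      (⋂ ξ, {T : K →L[ℂ] K | T (J ξ) ∈ LinearMap.range J.toLinearMap}) ∩
      ⋂ ξ, {T : K →L[ℂ] K | star T (J ξ) ∈ LinearMap.range J.toLinearMap} := by
    ext T
    simp only [Set.mem_inter_iff, Set.mem_iInter]
    rfl
  rw [h]
  refine (isClosed_iInter fun ξ => hr.preimage (by fun_prop)).inter
    (isClosed_iInter fun ξ => hr.preimage ?_)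
  exact (ContinuousLinearMap.apply ℂ K (J ξ)).continuous.comp continuous_star

open ContinuousLinearMap in
/-- Compression to the range of an isometry `J` which reduces the generators. -/
def compression (J : L →ₗᵢ[ℂ] K) (hs : s ⊆ reducingAlg J) : OpAlg s →⋆ₐ[ℂ] (L →L[ℂ] L) :=
  have hle : cstarGen s ≤ reducingAlg J :=
    StarSubalgebra.topologicalClosure_minimal (StarAlgebra.adjoin_le hs) (isClosed_reducingAlg J)
  -- The projection `J J*` fixes the range of `J`, which `x` leaves invariant. This makes the
  -- compression multiplicative.
  have key : ∀ (x : OpAlg s) ξ, J (adjoint J.toContinuousLinearMap (OpAlg.val s x (J ξ))) =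
      OpAlg.val s x (J ξ) := fun x ξ => by
    obtain ⟨η, hη⟩ := (hle (OpAlg.val_mem x)).1 ξ
    rw [← hη]
    exact congrArg J (adjoint_isometry_apply J η)
  { toFun := fun x => adjoint J.toContinuousLinearMap ∘L OpAlg.val s x ∘L J.toContinuousLinearMap
    map_one' := by
      ext ξ
      simp only [map_one]
      exact adjoint_isometry_apply J ξ
    map_mul' := fun x y => by
      ext ξ
      simp only [map_mul]
      change adjoint J.toContinuousLinearMap (OpAlg.val s x (OpAlg.val s y (J ξ))) =
        adjoint J.toContinuousLinearMap (OpAlg.val s x (J (adjoint J.toContinuousLinearMap _)))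
      rw [← key y]
      rfl
    map_zero' := by
      simp only [map_zero]
      ext ξ
      simp
    map_add' := fun x y => by
      simp only [map_add]
      ext ξ
      simp
    commutes' := fun c => by
      ext ξ
      rw [AlgHomClass.commutes, Algebra.algebraMap_eq_smul_one, Algebra.algebraMap_eq_smul_one]
      change adjoint J.toContinuousLinearMap (c • J ξ) = c • ξ
      rw [map_smul, adjoint_isometry_apply]
    map_star' := fun x => by
      rw [map_star, star_eq_adjoint, star_eq_adjoint, adjoint_comp, adjoint_comp, adjoint_adjoint,
        ContinuousLinearMap.comp_assoc] }

theorem compression_gen (J : L →ₗᵢ[ℂ] K) (hs : s ⊆ reducingAlg J) (x : OpAlg s) {Y : L →L[ℂ] L}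
    (h : ∀ ξ, OpAlg.val s x (J ξ) = J (Y ξ)) : compression J hs x = Y := by
  ext ξ
  change ContinuousLinearMap.adjoint J.toContinuousLinearMap (OpAlg.val s x (J ξ)) = _
  rw [h, adjoint_isometry_apply]

theorem compression_apply (J : L →ₗᵢ[ℂ] K) (hs : s ⊆ reducingAlg J) (x : OpAlg s) (ξ : L) :
    J (compression J hs x ξ) = OpAlg.val s x (J ξ) := by
  have hle : cstarGen s ≤ reducingAlg J :=
    StarSubalgebra.topologicalClosure_minimal (StarAlgebra.adjoin_le hs) (isClosed_reducingAlg J)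
  obtain ⟨η, hη⟩ := (hle (OpAlg.val_mem x)).1 ξ
  change J (ContinuousLinearMap.adjoint J.toContinuousLinearMap (OpAlg.val s x (J ξ))) = _
  rw [← hη]
  exact congrArg J (adjoint_isometry_apply J η)

end OpAlgHom

/-! ### Spans closed under products and adjoints -/

section SpanClosed

variable {C : Type*} [CStarAlgebra C] {g : Set C}

theorem mul_mem_span_of_mul_mem (h : ∀ a ∈ g, ∀ b ∈ g, a * b ∈ Submodule.span ℂ g) {a b : C}
    (ha : a ∈ Submodule.span ℂ g) (hb : b ∈ Submodule.span ℂ g) : a * b ∈ Submodule.span ℂ g := by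
  have hle : Submodule.span ℂ g * Submodule.span ℂ g ≤ Submodule.span ℂ g := by
    rw [Submodule.span_mul_span, Submodule.span_le]
    rintro _ ⟨a, ha, b, hb, rfl⟩
    exact h a ha b hb
  exact hle (Submodule.mul_mem_mul ha hb)

theorem star_mem_span_of_star_mem (h : ∀ a ∈ g, star a ∈ Submodule.span ℂ g) {a : C}
    (ha : a ∈ Submodule.span ℂ g) : star a ∈ Submodule.span ℂ g := by
  induction ha using Submodule.span_induction with
  | mem a ha => exact h a ha
  | zero => simp
  | add a b _ _ ha hb =>
    rw [star_add]
    exact Submodule.add_mem _ ha hb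
  | smul c a _ ha =>
    rw [star_smul]
    exact Submodule.smul_mem _ _ ha

end SpanClosed

/-! ### Families of elements `a δₓ` in a C*-algebra -/

section Family

variable {A : Type*} [CStarAlgebra A] {G : Type*} [Group G] {S : TwistedSystem A G}
  {C : Type*} [CStarAlgebra C] {C' : Type*} [CStarAlgebra C']

/-- The elements `d a x` of a C*-algebra satisfy the relations of the elements `a δₓ` of a crossed
product. -/
structure IsCrossedFamily (S : TwistedSystem A G) (d : A → G → C) : Prop where
  add : ∀ a b x, d (a + b) x = d a x + d b x
  smul : ∀ (c : ℂ) a x, d (c • a) x = c • d a x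
  one : d 1 1 = 1
  mul : ∀ a x b y, d a x * d b y = d (a * S.ρ x b * S.σ x y) (x * y)
  star : ∀ a x, star (d a x) = d (star (S.σ x⁻¹ x : A) * S.ρ x⁻¹ (star a)) x⁻¹
  -- The bound makes `a ↦ d a x` continuous, which is needed to pass from a dense subspace `𝒜` to
  -- `A`.
  norm_le : ∀ a x, ‖d a x‖ ≤ ‖a‖

namespace IsCrossedFamily

variable {d : A → G → C} {d' : A → G → C'}

theorem map (h : IsCrossedFamily S d) (φ : C →⋆ₐ[ℂ] C') :
    IsCrossedFamily S fun a x => φ (d a x) where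
  add a b x := by rw [h.add, map_add]
  smul c a x := by rw [h.smul, map_smul]
  one := by rw [h.one, map_one]
  mul a x b y := by rw [← map_mul, h.mul]
  star a x := by rw [← map_star, h.star]
  norm_le a x := (NonUnitalStarAlgHom.norm_apply_le φ _).trans (h.norm_le a x)

/-- Injective `*`-homomorphisms are isometric, so the relations, including the norm bound, can be
checked on concrete operators. -/
theorem of_map {φ : C →⋆ₐ[ℂ] C'} (hφ : Function.Injective φ)
    (h : IsCrossedFamily S fun a x => φ (d a x)) : IsCrossedFamily S d where
  add a b x := hφ (by rw [h.add, map_add])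
  smul c a x := hφ (by rw [h.smul, map_smul])
  one := hφ (by rw [h.one, map_one])
  mul a x b y := hφ (by rw [map_mul, h.mul])
  star a x := hφ (by rw [map_star, h.star])
  norm_le a x := by
    rw [← NonUnitalStarAlgHom.norm_map φ hφ]
    exact h.norm_le a x

/-- `a ↦ d a x` as a linear map. -/
def linearMap (h : IsCrossedFamily S d) (x : G) : A →ₗ[ℂ] C where
  toFun a := d a x
  map_add' a b := h.add a b x
  map_smul' c a := h.smul c a x

/-- Finite sums of the elements `d a x`. -/
def sum (h : IsCrossedFamily S d) : (G →₀ A) →ₗ[ℂ] C := Finsupp.lsum ℂ h.linearMap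

theorem sum_single (h : IsCrossedFamily S d) (x : G) (a : A) :
    h.sum (Finsupp.single x a) = d a x := by
  rw [sum, Finsupp.lsum_single]
  rfl

/-- The span of the elements `d a x`, for `a` in the subspace `𝒜`. -/
def span (d : A → G → C) (𝒜 : Submodule ℂ A) : Submodule ℂ C :=
  Submodule.span ℂ {t | ∃ a ∈ 𝒜, ∃ g, t = d a g}

variable {𝒜 : Submodule ℂ A}

theorem one_mem_span (h : IsCrossedFamily S d) (h1 : (1 : A) ∈ 𝒜) : 1 ∈ span d 𝒜 :=
  Submodule.subset_span ⟨1, h1, 1, h.one.symm⟩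

theorem mul_mem_span (h : IsCrossedFamily S d) (hmul : ∀ a ∈ 𝒜, ∀ b ∈ 𝒜, a * b ∈ 𝒜)
    (hS : S.IsSmooth 𝒜) {s t : C} (hs : s ∈ span d 𝒜) (ht : t ∈ span d 𝒜) :
    s * t ∈ span d 𝒜 := by
  refine mul_mem_span_of_mul_mem ?_ hs ht
  rintro _ ⟨a, ha, x, rfl⟩ _ ⟨b, hb, y, rfl⟩
  rw [h.mul]
  exact Submodule.subset_span
    ⟨_, hmul _ (hmul _ ha _ (hS.1 x b hb)) _ (hS.2 x y), _, rfl⟩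

theorem star_mem_span (h : IsCrossedFamily S d) (hmul : ∀ a ∈ 𝒜, ∀ b ∈ 𝒜, a * b ∈ 𝒜)
    (hstar : ∀ a ∈ 𝒜, Star.star a ∈ 𝒜) (hS : S.IsSmooth 𝒜) {s : C} (hs : s ∈ span d 𝒜) :
    Star.star s ∈ span d 𝒜 := by
  refine star_mem_span_of_star_mem ?_ hs
  rintro _ ⟨a, ha, x, rfl⟩
  rw [h.star]
  exact Submodule.subset_span
    ⟨_, hmul _ (hstar _ (hS.2 _ _)) _ (hS.1 _ _ (hstar a ha)), _, rfl⟩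

theorem continuous (h : IsCrossedFamily S d) (x : G) : Continuous fun a => d a x :=
  ((h.linearMap x).mkContinuous 1 fun a => by rw [one_mul]; exact h.norm_le a x).continuous

theorem dense_span (h : IsCrossedFamily S d) (h1 : (1 : A) ∈ 𝒜)
    (hmul : ∀ a ∈ 𝒜, ∀ b ∈ 𝒜, a * b ∈ 𝒜) (hstar : ∀ a ∈ 𝒜, Star.star a ∈ 𝒜)
    (hd : Dense (𝒜 : Set A)) (hS : S.IsSmooth 𝒜)
    (hgen : IsGenerating {t | ∃ a x, t = d a x}) : Dense (span d 𝒜 : Set C) := by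
  refine hgen.dense _ (h.one_mem_span h1) (fun a ha b hb => h.mul_mem_span hmul hS ha hb)
    (fun a ha => h.star_mem_span hmul hstar hS ha) ?_
  rintro _ ⟨a, x, rfl⟩
  exact map_mem_closure (f := fun a => d a x) (h.continuous x) (hd a) fun b hb =>
    Submodule.subset_span ⟨b, hb, x, rfl⟩

theorem denseRange_sum (h : IsCrossedFamily S d) (hgen : IsGenerating {t | ∃ a x, t = d a x}) :
    DenseRange h.sum := by
  have hd : Dense (span d (⊤ : Submodule ℂ A) : Set C) :=
    h.dense_span Submodule.mem_top (fun _ _ _ _ => Submodule.mem_top)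
      (fun _ _ => Submodule.mem_top) (by simp)
      ⟨fun _ _ _ => Submodule.mem_top, fun _ _ => Submodule.mem_top⟩ hgen
  have hle : span d ⊤ ≤ LinearMap.range h.sum := by
    refine Submodule.span_le.mpr ?_
    rintro _ ⟨a, -, x, rfl⟩
    exact ⟨Finsupp.single x a, h.sum_single x a⟩
  exact hd.mono hle

/-- A crossed family whose finite sums are dominated in norm by those of a generating one is the
image of the latter under a `*`-homomorphism. -/
theorem exists_hom (h : IsCrossedFamily S d) (h' : IsCrossedFamily S d')
    (hgen : IsGenerating {t | ∃ a x, t = d a x}) (hle : ∀ f, ‖h'.sum f‖ ≤ ‖h.sum f‖) :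
    ∃ φ : C →⋆ₐ[ℂ] C', ∀ a x, φ (d a x) = d' a x := by
  have hd := h.denseRange_sum hgen
  -- The norm inequality makes `h.sum f ↦ h'.sum f` well defined and contractive on a dense
  -- subspace; `h.sum` need not be injective.
  set E : C →L[ℂ] C' := h'.sum.extendOfNorm h.sum with hE
  have hEs : ∀ f, E (h.sum f) = h'.sum f := fun f =>
    LinearMap.extendOfNorm_eq hd ⟨1, fun f => by rw [one_mul]; exact hle f⟩ f
  have hEd : ∀ a x, E (d a x) = d' a x := fun a x => by
    rw [← h.sum_single, hEs, h'.sum_single]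
  have hE1 : E 1 = 1 := by rw [← h.one, hEd, h'.one]
  have hmul : ∀ s t, E (s * t) = E s * E t := by
    intro s t
    refine hd.induction_on₂ (isClosed_eq (by fun_prop) (by fun_prop)) (fun f g => ?_) s t
    induction f using Finsupp.induction_linear with
    | zero => simp
    | add a b ha hb => simp only [map_add, add_mul, ha, hb]
    | single x a =>
      induction g using Finsupp.induction_linear with
      | zero => simp
      | add a b ha hb => simp only [map_add, mul_add, ha, hb]
      | single y b => rw [h.sum_single, h.sum_single, h.mul, hEd, hEd, hEd, h'.mul]
  have hst : ∀ s, E (Star.star s) = Star.star (E s) := by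
    intro s
    refine hd.induction_on s (isClosed_eq (by fun_prop) (by fun_prop)) (fun f => ?_)
    induction f using Finsupp.induction_linear with
    | zero => simp
    | add a b ha hb => simp only [map_add, star_add, ha, hb]
    | single x a => rw [h.sum_single, h.star, hEd, hEd, h'.star]
  exact ⟨{ toFun := E
           map_one' := hE1
           map_mul' := hmul
           map_zero' := map_zero E
           map_add' := map_add E
           commutes' := fun c => by
             rw [Algebra.algebraMap_eq_smul_one, Algebra.algebraMap_eq_smul_one, map_smul, hE1]
           map_star' := hst }, hEd⟩

end IsCrossedFamily

end Family

section Covariant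

variable {A : Type*} [CStarAlgebra A] {G : Type*} [Group G] {S : TwistedSystem A G}
  {K : Type*} [NormedAddCommGroup K] [InnerProductSpace ℂ K] [CompleteSpace K]

namespace CovariantRep

variable (R : CovariantRep S K)

/-- The normalisation of `σ` gives `U₁ U₁ = U₁`, and an idempotent unitary is `1`. -/
theorem U_one : (R.U 1 : K →L[ℂ] K) = 1 := by
  have h := R.mul 1 1
  rw [S.σ_one_left, OneMemClass.coe_one, map_one, one_mul, mul_one] at h
  have h' := congrArg (star (R.U 1 : K →L[ℂ] K) * ·) h
  simpa [← mul_assoc] using h'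

theorem U_mul_π (x : G) (a : A) :
    (R.U x : K →L[ℂ] K) * R.π a = R.π (S.ρ x a) * (R.U x : K →L[ℂ] K) := by
  rw [R.cov, mul_assoc, Unitary.coe_star_mul_self, mul_one]

/-- This is the relation `U_{x⁻¹} Uₓ = π(σ_{x⁻¹,x})` solved for `Uₓ*`. -/
theorem star_U (x : G) :
    star (R.U x : K →L[ℂ] K) = R.π (star (S.σ x⁻¹ x : A)) * (R.U x⁻¹ : K →L[ℂ] K) := by
  have h := R.mul x⁻¹ x
  rw [inv_mul_cancel, R.U_one, mul_one] at h
  have h1 : R.π (star (S.σ x⁻¹ x : A)) * R.π (S.σ x⁻¹ x : A) = 1 := by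
    rw [← map_mul, Unitary.coe_star_mul_self, map_one]
  calc star (R.U x : K →L[ℂ] K)
      = R.π (star (S.σ x⁻¹ x : A)) * R.π (S.σ x⁻¹ x : A) * star (R.U x : K →L[ℂ] K) := by
        rw [h1, one_mul]
    _ = R.π (star (S.σ x⁻¹ x : A)) * (R.U x⁻¹ : K →L[ℂ] K) *
          ((R.U x : K →L[ℂ] K) * star (R.U x : K →L[ℂ] K)) := by
        rw [← h, mul_assoc, mul_assoc, mul_assoc]
    _ = _ := by rw [Unitary.mul_star_self_of_mem (R.U x).2, mul_one]

/-- The operators `π(a) Uₓ` of a covariant representation satisfy the crossed product relations. -/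
theorem isCrossedFamily : IsCrossedFamily S R.op where
  add a b x := by rw [op, op, op, map_add, add_mul]
  smul c a x := by rw [op, op, map_smul, smul_mul_assoc]
  one := by rw [op, map_one, one_mul, R.U_one]
  mul a x b y := by
    rw [op, op, op, mul_assoc, ← mul_assoc (R.U x : K →L[ℂ] K), U_mul_π, mul_assoc, R.mul, map_mul,
      map_mul]
    simp only [mul_assoc]
  star a x := by
    rw [op, op, star_mul, ← map_star, star_U, map_mul, mul_assoc, mul_assoc, U_mul_π]
  norm_le a x := R.norm_op_le a x

end CovariantRep

end Covariant

/-! ### Fell absorption -/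

theorem IsCrossedFamily.sum_map {A : Type*} [CStarAlgebra A] {G : Type*} [Group G]
    {S : TwistedSystem A G} {C : Type*} [CStarAlgebra C] {C' : Type*} [CStarAlgebra C']
    {d : A → G → C} {d' : A → G → C'} (h : IsCrossedFamily S d) (h' : IsCrossedFamily S d')
    (φ : C →⋆ₐ[ℂ] C') (hφ : ∀ a x, φ (d a x) = d' a x) (f : G →₀ A) :
    φ (h.sum f) = h'.sum f := by
  induction f using Finsupp.induction_linear with
  | zero => simp
  | add a b ha hb => simp only [map_add, ha, hb]
  | single x a => rw [h.sum_single, h'.sum_single, hφ]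

/-! ### The left regular representation -/

section LeftReg

theorem L2_clm_ext {G : Type u} {E : Type*} [NormedAddCommGroup E] [NormedSpace ℂ E] {X Y : L2 G →L[ℂ] E}
    (h : ∀ x, X (L2.δ x) = Y (L2.δ x)) : X = Y :=
  ContinuousLinearMap.ext_on (dense_span_L2δ G) (by rintro _ ⟨x, rfl⟩; exact h x)

variable {G : Type u} [Group G]

theorem leftReg_mul (x y : G) : leftReg x * leftReg y = leftReg (x * y) :=
  L2_clm_ext fun z => by
    rw [mul_apply_eq_comp, leftReg_L2δ, leftReg_L2δ, leftReg_L2δ, mul_assoc]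

theorem leftReg_one : leftReg (1 : G) = 1 :=
  L2_clm_ext fun z => by
    rw [leftReg_L2δ, one_mul]
    rfl

theorem star_leftReg (x : G) : star (leftReg x) = leftReg x⁻¹ := by
  refine Eq.symm ((ContinuousLinearMap.eq_adjoint_iff _ _).mpr fun f g => ?_)
  rw [lp.inner_eq_tsum, lp.inner_eq_tsum, ← (Equiv.mulLeft x⁻¹).tsum_eq]
  refine tsum_congr fun z => ?_
  change inner ℂ (f (x⁻¹⁻¹ * (x⁻¹ * z))) (g (x⁻¹ * z)) = inner ℂ (f z) (g (x⁻¹ * z))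
  rw [inv_mul_cancel_left]

theorem norm_leftReg_le (x : G) : ‖leftReg x‖ ≤ 1 := by
  refine ContinuousLinearMap.opNorm_le_bound _ zero_le_one fun f => ?_
  have := norm_weightedShiftₗ_le (E := fun _ : G => ℂ) (Equiv.mulLeft x⁻¹)
    (fun _ => ContinuousLinearMap.id ℂ ℂ) 1 (fun _ => ContinuousLinearMap.norm_id_le) f
  rwa [abs_one] at this

end LeftReg

/-! ### The Fell unitary -/

section Fell

open HilbertTensor

variable {A : Type*} [CStarAlgebra A] {G : Type*} [Group G] {S : TwistedSystem A G}
  {K : Type*} [NormedAddCommGroup K] [InnerProductSpace ℂ K] [CompleteSpace K]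

/-- The operators `a δₓ` of the regular representation on `ℓ²(G, K)` induced by a representation
`π` on `K`. -/
def inducedOp (S : TwistedSystem A G) (π : A →⋆ₐ[ℂ] (K →L[ℂ] K)) (a : A) (x : G) :
    lp (fun _ : G => K) 2 →L[ℂ] lp (fun _ : G => K) 2 :=
  weightedShift (E := fun _ : G => K) (Equiv.mulLeft x⁻¹)
    (fun z => π (S.ρ z⁻¹ a * S.σ z⁻¹ x)) ‖a‖ (fun z => by
      refine (NonUnitalStarAlgHom.norm_apply_le π _).trans ?_
      rw [CStarRing.norm_mul_coe_unitary]
      exact NonUnitalStarAlgHom.norm_apply_le (S.ρ z⁻¹).toStarAlgHom a)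

theorem inducedOp_single [DecidableEq G] (π : A →⋆ₐ[ℂ] (K →L[ℂ] K)) (a : A) (x y : G) (k : K) :
    inducedOp S π a x (lp.single 2 y k) =
      lp.single 2 (x * y) (π (S.ρ (x * y)⁻¹ a * S.σ (x * y)⁻¹ x) k) := by
  rw [inducedOp, weightedShift_single]
  simp only [Equiv.mulLeft_symm_apply, inv_inv]

namespace CovariantRep

variable (R : CovariantRep S K)

theorem norm_star_U_apply (x : G) (k : K) : ‖star (R.U x : K →L[ℂ] K) k‖ = ‖k‖ :=
  ContinuousLinearMap.norm_map_of_mem_unitary (Unitary.star_mem (R.U x).2) k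

/-- The isometries `k ↦ U_{z⁻¹}* k ⊗ δ_z`. -/
def fellIncl (z : G) : K →ₗᵢ[ℂ] HilbertTensor K (L2 G) where
  toLinearMap := (tmulL.flip (L2.δ z) ∘L star (R.U z⁻¹ : K →L[ℂ] K)).toLinearMap
  norm_map' k := by
    change ‖tmulL (star (R.U z⁻¹ : K →L[ℂ] K) k) (L2.δ z)‖ = ‖k‖
    rw [norm_tmulL, norm_L2δ, mul_one, norm_star_U_apply]

theorem U_star_U_apply (x : G) (k : K) :
    (star (R.U x : K →L[ℂ] K)) ((R.U x : K →L[ℂ] K) k) = k :=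
  DFunLike.congr_fun (Unitary.star_mul_self_of_mem (R.U x).2) k

theorem isHilbertSum_fellIncl : IsHilbertSum ℂ (fun _ : G => K) R.fellIncl := by
  classical
  refine IsHilbertSum.mk ?_ ?_
  · intro x y hxy v w
    change inner ℂ (tmulL _ (L2.δ x)) (tmulL _ (L2.δ y)) = 0
    rw [inner_tmulL, inner_L2δ, if_neg hxy, mul_zero]
  · refine (eq_top_of_tmulL_mem (dense_span_univ K) (dense_span_L2δ G)
      (Submodule.isClosed_topologicalClosure _) ?_).ge
    rintro k - _ ⟨x, rfl⟩
    refine Submodule.le_topologicalClosure _ (Submodule.mem_iSup_of_mem x ?_)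
    refine ⟨(R.U x⁻¹ : K →L[ℂ] K) k, ?_⟩
    change tmulL (star (R.U x⁻¹ : K →L[ℂ] K) _) (L2.δ x) = _
    rw [U_star_U_apply]

/-- The unitary `k ⊗ δ_z ↦ U_{z⁻¹} k ⊗ δ_z` from `K ⊗ ℓ²(G)` to `ℓ²(G, K)`. -/
def fellEquiv : HilbertTensor K (L2 G) ≃ₗᵢ[ℂ] lp (fun _ : G => K) 2 :=
  R.isHilbertSum_fellIncl.linearIsometryEquiv

open Classical in
theorem fellEquiv_tmulL (k : K) (z : G) :
    R.fellEquiv (tmulL k (L2.δ z)) = lp.single 2 z ((R.U z⁻¹ : K →L[ℂ] K) k) := by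
  have h := R.isHilbertSum_fellIncl.linearIsometryEquiv_symm_apply_single
    (i := z) ((R.U z⁻¹ : K →L[ℂ] K) k)
  rw [fellEquiv, ← LinearIsometryEquiv.eq_symm_apply, h]
  change _ = tmulL (star (R.U z⁻¹ : K →L[ℂ] K) _) (L2.δ z)
  rw [U_star_U_apply]

/-- Fell absorption: `a δₓ ↦ π(a) Uₓ ⊗ λₓ` is unitarily equivalent to the induced regular
representation. -/
theorem fellEquiv_conj (a : A) (x : G) :
    R.fellEquiv.conjStarAlgEquiv (tensorOp (R.op a x) (leftReg x)) = inducedOp S R.π a x := by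
  classical
  have h : R.fellEquiv.toContinuousLinearEquiv.toContinuousLinearMap ∘L
      tensorOp (R.op a x) (leftReg x) =
      inducedOp S R.π a x ∘L R.fellEquiv.toContinuousLinearEquiv.toContinuousLinearMap := by
    refine clm_ext (dense_span_univ K) (dense_span_L2δ G) ?_
    rintro k - _ ⟨y, rfl⟩
    change R.fellEquiv (tensorOp _ _ _) = inducedOp S R.π a x (R.fellEquiv _)
    rw [tensorOp_tmulL, leftReg_L2δ, fellEquiv_tmulL, fellEquiv_tmulL, inducedOp_single]
    congr 1
    -- The relation `U_w π(a) Uₓ = π(ρ_w(a) σ_{w,x}) U_{wx}` with `w = (xy)⁻¹` and `wx = y⁻¹`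
    -- produces exactly the coefficient of the induced representation.
    have := R.isCrossedFamily.mul 1 (x * y)⁻¹ a x
    have hxy : (x * y)⁻¹ * x = y⁻¹ := by group
    rw [op, map_one, one_mul, one_mul, hxy] at this
    exact DFunLike.congr_fun this k
  ext1 f
  rw [LinearIsometryEquiv.conjStarAlgEquiv_apply_apply]
  refine (DFunLike.congr_fun h (R.fellEquiv.symm f)).trans ?_
  change inducedOp S R.π a x (R.fellEquiv (R.fellEquiv.symm f)) = _
  rw [LinearIsometryEquiv.apply_symm_apply]

/-- Since `λ` is an untwisted representation, the cocycle stays in the first tensor factor. -/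
theorem isCrossedFamily_absorbed :
    IsCrossedFamily S fun a x => tensorOp (R.op a x) (leftReg x : L2 G →L[ℂ] L2 G) where
  add a b x := by rw [R.isCrossedFamily.add, tensorOp_add_left]
  smul c a x := by rw [R.isCrossedFamily.smul, tensorOp_smul_left]
  one := by rw [R.isCrossedFamily.one, leftReg_one, tensorOp_one]
  mul a x b y := by rw [← tensorOp_mul, R.isCrossedFamily.mul, leftReg_mul]
  star a x := by rw [← tensorOp_star, R.isCrossedFamily.star, star_leftReg]
  norm_le a x := by
    refine (norm_tensorOp_le _ _).trans ?_
    refine (mul_le_mul (R.norm_op_le a x) (norm_leftReg_le x) (norm_nonneg _)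
      (norm_nonneg _)).trans ?_
    rw [mul_one]

/-- The relations are transported through the Fell unitary, which avoids a direct computation with
the cocycle identity. -/
theorem isCrossedFamily_induced : IsCrossedFamily S (inducedOp S R.π) := by
  have := R.isCrossedFamily_absorbed.map R.fellEquiv.conjStarAlgEquiv.toStarAlgHom
  convert this using 3 with a x
  exact (R.fellEquiv_conj a x).symm

end CovariantRep

end Fell

/-! ### Comparison of regular representations -/

section MatrixRep

variable {A : Type*} [CStarAlgebra A] {n : Type*} [Fintype n]
  {K : Type*} [NormedAddCommGroup K] [InnerProductSpace ℂ K] [CompleteSpace K]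

/-- The operator on `Kⁿ` with the matrix `π(Mᵢⱼ)`. -/
def matrixOp (π : A →⋆ₐ[ℂ] (K →L[ℂ] K)) (M : CStarMatrix n n A) :
    PiLp 2 (fun _ : n => K) →L[ℂ] PiLp 2 (fun _ : n => K) :=
  (PiLp.continuousLinearEquiv 2 ℂ fun _ : n => K).symm.toContinuousLinearMap ∘L
    ContinuousLinearMap.pi fun i => ∑ j, π (M i j) ∘L PiLp.proj 2 (fun _ : n => K) j

theorem matrixOp_apply (π : A →⋆ₐ[ℂ] (K →L[ℂ] K)) (M : CStarMatrix n n A)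
    (ξ : PiLp 2 fun _ : n => K) (i : n) : matrixOp π M ξ i = ∑ j, π (M i j) (ξ j) := by
  change (∑ j, π (M i j) ∘L PiLp.proj 2 (fun _ : n => K) j) ξ = _
  rw [_root_.sum_apply]
  rfl

theorem matrixOp_star (π : A →⋆ₐ[ℂ] (K →L[ℂ] K)) (M : CStarMatrix n n A) :
    matrixOp π (star M) = star (matrixOp π M) := by
  refine (ContinuousLinearMap.eq_adjoint_iff _ _).mpr fun ξ η => ?_
  simp only [PiLp.inner_apply, matrixOp_apply, sum_inner, inner_sum, CStarMatrix.star_apply,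
    map_star, ContinuousLinearMap.star_eq_adjoint, ContinuousLinearMap.adjoint_inner_left]
  exact Finset.sum_comm

theorem matrixOp_mul (π : A →⋆ₐ[ℂ] (K →L[ℂ] K)) (M N : CStarMatrix n n A) :
    matrixOp π (M * N) = matrixOp π M * matrixOp π N := by
  ext ξ i
  rw [mul_apply_eq_comp]
  simp only [matrixOp_apply, CStarMatrix.mul_apply, map_sum, map_mul, _root_.sum_apply,
    mul_apply_eq_comp]
  exact Finset.sum_comm

/-- The representation of matrices over `A` on `Kⁿ` given by a representation of `A` on `K`. -/
def matrixRep (π : A →⋆ₐ[ℂ] (K →L[ℂ] K)) :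
    CStarMatrix n n A →⋆ₙₐ[ℂ] (PiLp 2 (fun _ : n => K) →L[ℂ] PiLp 2 (fun _ : n => K)) where
  toFun := matrixOp π
  map_smul' c M := by
    ext ξ i
    simp [matrixOp_apply, Finset.smul_sum]
  map_zero' := by
    ext ξ i
    simp [matrixOp_apply]
  map_add' M N := by
    ext ξ i
    simp [matrixOp_apply, Finset.sum_add_distrib]
  map_mul' := matrixOp_mul π
  map_star' := matrixOp_star π

theorem matrixRep_injective {π : A →⋆ₐ[ℂ] (K →L[ℂ] K)} (hπ : Function.Injective π) :
    Function.Injective (matrixRep (n := n) π) := by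
  classical
  intro M N h
  ext i j
  refine hπ ?_
  ext k
  have h' := congrArg (fun ξ : PiLp 2 (fun _ : n => K) => ξ i)
    (DFunLike.congr_fun h (WithLp.toLp 2 (Pi.single j k)))
  have key : ∀ M : CStarMatrix n n A,
      matrixOp π M (WithLp.toLp 2 (Pi.single j k)) i = π (M i j) k := fun M => by
    rw [matrixOp_apply, Finset.sum_eq_single j]
    · simp
    · intro l _ hl
      simp [Pi.single_eq_of_ne hl]
    · simp
  rw [← key M, ← key N]
  exact h'

/-- Matrices over `A` form a C*-algebra, on which a faithful representation is isometric and any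
representation is contractive. -/
theorem norm_matrixOp_le {K' : Type*} [NormedAddCommGroup K'] [InnerProductSpace ℂ K']
    [CompleteSpace K'] {π : A →⋆ₐ[ℂ] (K →L[ℂ] K)} (hπ : Function.Injective π)
    (π' : A →⋆ₐ[ℂ] (K' →L[ℂ] K')) (M : CStarMatrix n n A) : ‖matrixOp π' M‖ ≤ ‖matrixOp π M‖ := by
  let := CStarAlgebra.spectralOrder A
  let := CStarAlgebra.spectralOrderedRing A
  calc ‖matrixRep π' M‖ ≤ ‖M‖ := NonUnitalStarAlgHom.norm_apply_le (matrixRep π') M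
    _ = ‖matrixRep π M‖ := (NonUnitalStarAlgHom.norm_map (matrixRep π) (matrixRep_injective hπ) M).symm

end MatrixRep

/-! ### Norms of operators on `ℓ²(G, K)` from their finite corners -/

section Corner

variable {G : Type*} {K : Type*} [NormedAddCommGroup K]

open Classical in
/-- The inclusion of the finitely supported functions with support in `F` in `ℓ²(G, K)`. -/
def corner (F : Finset G) (ξ : PiLp 2 fun _ : F => K) : lp (fun _ : G => K) 2 :=
  ∑ i : F, lp.single 2 (i : G) (ξ i)

theorem corner_apply (F : Finset G) (ξ : PiLp 2 fun _ : F => K) (i : F) :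
    corner F ξ i = ξ i := by
  classical
  rw [corner, lp.coeFn_sum, Finset.sum_apply, Finset.sum_eq_single i]
  · simp
  · intro j _ hj
    rw [lp.single_apply, Pi.single_eq_of_ne]
    exact fun h => hj (Subtype.ext h).symm
  · simp

theorem tendsto_corner (f : lp (fun _ : G => K) 2) :
    Filter.Tendsto (fun F : Finset G => corner F (WithLp.toLp 2 fun i : F => f i)) Filter.atTop
      (nhds f) := by
  classical
  have h := lp.hasSum_single (p := 2) (by simp) f
  refine h.congr fun F => ?_
  rw [corner, ← Finset.sum_coe_sort F]

variable [InnerProductSpace ℂ K]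

theorem inner_corner_right (F : Finset G) (f : lp (fun _ : G => K) 2) (ξ : PiLp 2 fun _ : F => K) :
    inner ℂ f (corner F ξ) = ∑ i : F, inner ℂ (f i) (ξ i) := by
  simp only [corner, inner_sum, lp.inner_single_right]

theorem norm_corner (F : Finset G) (ξ : PiLp 2 fun _ : F => K) : ‖corner F ξ‖ = ‖ξ‖ := by
  have h : inner ℂ (corner F ξ) (corner F ξ) = inner ℂ ξ ξ := by
    rw [inner_corner_right, PiLp.inner_apply]
    simp only [corner_apply]
  rw [inner_self_eq_norm_sq_to_K, inner_self_eq_norm_sq_to_K] at h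
  have h' : ‖corner F ξ‖ ^ 2 = ‖ξ‖ ^ 2 := by exact_mod_cast h
  exact (sq_eq_sq₀ (norm_nonneg _) (norm_nonneg _)).mp h'

variable {A : Type*} [CStarAlgebra A] [CompleteSpace K]

open Classical in
/-- The operator `X` on `ℓ²(G, K)` has the matrix `π(m z y)`. -/
def HasMatrix (π : A →⋆ₐ[ℂ] (K →L[ℂ] K)) (X : lp (fun _ : G => K) 2 →L[ℂ] lp (fun _ : G => K) 2)
    (m : G → G → A) : Prop :=
  ∀ y k z, X (lp.single 2 y k) z = π (m z y) k

/-- The finite corner of an infinite matrix. -/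
def cornerMatrix (m : G → G → A) (F : Finset G) : CStarMatrix F F A :=
  CStarMatrix.ofMatrix fun i j => m i j

theorem HasMatrix.inner_corner {π : A →⋆ₐ[ℂ] (K →L[ℂ] K)}
    {X : lp (fun _ : G => K) 2 →L[ℂ] lp (fun _ : G => K) 2} {m : G → G → A}
    (h : HasMatrix π X m) (F : Finset G) (ξ η : PiLp 2 fun _ : F => K) :
    inner ℂ (X (corner F ξ)) (corner F η) = inner ℂ (matrixOp π (cornerMatrix m F) ξ) η := by
  classical
  rw [inner_corner_right, PiLp.inner_apply]
  refine Finset.sum_congr rfl fun i _ => ?_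
  congr 1
  rw [matrixOp_apply, corner, map_sum, lp.coeFn_sum, Finset.sum_apply]
  refine Finset.sum_congr rfl fun j _ => ?_
  exact h j (ξ j) i

/-- A finite corner is the compression of `X` along the isometry `corner F`. -/
theorem HasMatrix.norm_matrixOp_le {π : A →⋆ₐ[ℂ] (K →L[ℂ] K)}
    {X : lp (fun _ : G => K) 2 →L[ℂ] lp (fun _ : G => K) 2} {m : G → G → A}
    (h : HasMatrix π X m) (F : Finset G) : ‖matrixOp π (cornerMatrix m F)‖ ≤ ‖X‖ := by
  refine ContinuousLinearMap.opNorm_le_of_re_inner_le (𝕜 := ℂ) (norm_nonneg _) fun ξ η hξ hη => ?_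
  rw [← h.inner_corner]
  refine (RCLike.re_le_norm _).trans ((norm_inner_le_norm _ _).trans ?_)
  rw [norm_corner, hη, mul_one]
  refine (X.le_opNorm _).trans ?_
  rw [norm_corner, hξ, mul_one]

/-- Finitely supported vectors are dense, so `X'` is controlled by its finite corners. These are
matrices over `A`, where the faithful `π` dominates `π'`. -/
theorem HasMatrix.norm_le {K' : Type*} [NormedAddCommGroup K'] [InnerProductSpace ℂ K']
    [CompleteSpace K'] {π : A →⋆ₐ[ℂ] (K →L[ℂ] K)} (hπ : Function.Injective π)
    {π' : A →⋆ₐ[ℂ] (K' →L[ℂ] K')}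
    {X : lp (fun _ : G => K) 2 →L[ℂ] lp (fun _ : G => K) 2}
    {X' : lp (fun _ : G => K') 2 →L[ℂ] lp (fun _ : G => K') 2} {m : G → G → A}
    (h : HasMatrix π X m) (h' : HasMatrix π' X' m) : ‖X'‖ ≤ ‖X‖ := by
  refine ContinuousLinearMap.opNorm_le_of_re_inner_le (𝕜 := ℂ) (norm_nonneg _) fun f g hf hg => ?_
  refine (RCLike.re_le_norm _).trans ?_
  have h1 := tendsto_corner f
  have h2 := tendsto_corner g
  have hl := (((X'.continuous.tendsto f).comp h1).inner (𝕜 := ℂ) h2).norm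
  have hr := (h1.norm.const_mul ‖X‖).mul h2.norm
  rw [hf, hg, mul_one, mul_one] at hr
  refine le_of_tendsto_of_tendsto' hl hr fun F => ?_
  simp only [Function.comp_apply]
  rw [h'.inner_corner, norm_corner, norm_corner]
  refine (norm_inner_le_norm _ _).trans ?_
  gcongr
  refine ((matrixOp π' (cornerMatrix m F)).le_opNorm _).trans ?_
  gcongr
  exact (_root_.norm_matrixOp_le hπ π' _).trans (h.norm_matrixOp_le F)

end Corner

/-! ### Domination by the regular representation of a faithful one -/

section Comparison

variable {A : Type*} [CStarAlgebra A] {G : Type*} [Group G] {S : TwistedSystem A G}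
  {K : Type*} [NormedAddCommGroup K] [InnerProductSpace ℂ K] [CompleteSpace K]
  {K' : Type*} [NormedAddCommGroup K'] [InnerProductSpace ℂ K'] [CompleteSpace K']

/-- Only the term at `x = z y⁻¹` reaches `z` from `y`. The resulting matrix over `A` does not depend
on `π`, as the comparison requires. -/
theorem hasMatrix_inducedOp_sum {π : A →⋆ₐ[ℂ] (K →L[ℂ] K)}
    (h : IsCrossedFamily S (inducedOp S π)) (f : G →₀ A) :
    HasMatrix π (h.sum f) fun z y => S.ρ z⁻¹ (f (z * y⁻¹)) * S.σ z⁻¹ (z * y⁻¹) := by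
  classical
  intro y k z
  induction f using Finsupp.induction_linear with
  | zero => simp
  | add a b ha hb =>
    simp only [map_add, Finsupp.add_apply, add_mul, add_apply, lp.coeFn_add, Pi.add_apply] at ha hb ⊢
    rw [ha, hb]
  | single x a =>
    rw [h.sum_single, inducedOp_single, lp.single_apply]
    by_cases hz : z = x * y
    · subst hz
      simp
    · have hx : z * y⁻¹ ≠ x := by
        rintro rfl
        exact hz (by group)
      simp [Pi.single_eq_of_ne hz, Finsupp.single_eq_of_ne hx]

/-- The regular representation induced by a faithful representation dominates all
representations `a δₓ ↦ π(a) Uₓ ⊗ λₓ`. -/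
theorem CovariantRep.norm_absorbed_sum_le (R : CovariantRep S K) (hR : Function.Injective R.π)
    (R' : CovariantRep S K') (f : G →₀ A) :
    ‖R'.isCrossedFamily_absorbed.sum f‖ ≤ ‖R.isCrossedFamily_induced.sum f‖ := by
  -- Fell absorption for `R'` turns the left side into the norm in the regular representation
  -- induced by `R'.π`, which need not be faithful.
  have h := R'.isCrossedFamily_absorbed.sum_map R'.isCrossedFamily_induced
    R'.fellEquiv.conjStarAlgEquiv.toStarAlgHom R'.fellEquiv_conj f
  rw [← NonUnitalStarAlgHom.norm_map R'.fellEquiv.conjStarAlgEquiv.toStarAlgHom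
    R'.fellEquiv.conjStarAlgEquiv.injective, h]
  exact (hasMatrix_inducedOp_sum R.isCrossedFamily_induced f).norm_le hR
    (hasMatrix_inducedOp_sum R'.isCrossedFamily_induced f)

end Comparison

/-! ### Surjectivity of `*`-homomorphisms -/

section ClosedRange

variable {C : Type*} [CStarAlgebra C] {C' : Type*} [CStarAlgebra C']

theorem StarAlgHom.map_real_smul_of_cstar (φ : C →⋆ₐ[ℂ] C') (r : ℝ) (a : C) :
    φ (r • a) = r • φ a :=
  φ.toAlgHom.toLinearMap.map_smul_of_tower r a

/-- The real part of `a` is also a lift. Truncating it to `[-M, M]` with `M = ‖φ a‖` by functional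
calculus bounds its norm and does not change its image, whose spectrum lies in that interval. -/
theorem StarAlgHom.exists_norm_le_of_isSelfAdjoint (φ : C →⋆ₐ[ℂ] C') (a : C)
    (h : IsSelfAdjoint (φ a)) : ∃ b, φ b = φ a ∧ ‖b‖ ≤ ‖φ a‖ := by
  have hr : φ (realPart a : C) = φ a := by
    rw [realPart_apply_coe, φ.map_real_smul_of_cstar, map_add, map_star, h.star_eq, ← two_smul ℝ (φ a),
      smul_smul]
    norm_num
  set M := ‖φ a‖ with hM
  let f : ℝ → ℝ := fun t => max (-M) (min t M)
  have hf : Continuous f := by fun_prop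
  have hM0 : 0 ≤ M := norm_nonneg _
  refine ⟨cfc f (realPart a : C), ?_, norm_cfc_le hM0 fun t _ => ?_⟩
  · have hra : IsSelfAdjoint (realPart a : C) := (realPart a).2
    rw [StarAlgHom.map_cfc φ f (realPart a : C) hf.continuousOn φ.continuous_of_cstar hra
      (hr ▸ h), hr]
    conv_rhs => rw [← cfc_id' ℝ (φ a)]
    refine cfc_congr fun t ht => ?_
    rcases subsingleton_or_nontrivial C' with hs | hn
    · rw [spectrum.of_subsingleton] at ht
      exact ht.elim
    · have h1 : |t| ≤ M := spectrum.norm_le_norm_of_mem ht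
      rw [abs_le] at h1
      change max (-M) (min t M) = t
      rw [min_eq_left h1.2, max_eq_right h1.1]
  · rw [Real.norm_eq_abs, abs_le]
    exact ⟨le_max_left _ _, max_le (by linarith) (min_le_right _ _)⟩

theorem StarAlgHom.exists_norm_le (φ : C →⋆ₐ[ℂ] C') (a : C) :
    ∃ b, φ b = φ a ∧ ‖b‖ ≤ 2 * ‖φ a‖ := by
  have hre : ∀ a : C, φ (realPart a : C) = (realPart (φ a) : C') := fun a => by
    rw [realPart_apply_coe, realPart_apply_coe, φ.map_real_smul_of_cstar, map_add, map_star]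
  have him : ∀ a : C, φ (imaginaryPart a : C) = (imaginaryPart (φ a) : C') := fun a => by
    rw [imaginaryPart_apply_coe, imaginaryPart_apply_coe, map_smul, φ.map_real_smul_of_cstar, map_sub,
      map_star]
  obtain ⟨b, hb, hbn⟩ := φ.exists_norm_le_of_isSelfAdjoint (realPart a : C)
    (hre a ▸ (realPart (φ a)).2)
  obtain ⟨c, hc, hcn⟩ := φ.exists_norm_le_of_isSelfAdjoint (imaginaryPart a : C)
    (him a ▸ (imaginaryPart (φ a)).2)
  refine ⟨b + Complex.I • c, ?_, ?_⟩
  · rw [map_add, map_smul, hb, hc, hre, him, realPart_add_I_smul_imaginaryPart]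
  · refine (norm_add_le _ _).trans ?_
    rw [norm_smul, Complex.norm_I, one_mul, two_mul]
    refine add_le_add (hbn.trans ?_) (hcn.trans ?_)
    · rw [hre]
      exact realPart.norm_le (φ a)
    · rw [him]
      exact imaginaryPart.norm_le (φ a)

/-- Elements of the range have lifts of norm at most twice their own, so successive approximation
reaches the whole closure of the range. -/
theorem StarAlgHom.surjective_of_denseRange (φ : C →⋆ₐ[ℂ] C') (h : DenseRange φ) :
    Function.Surjective φ := by
  let f : NormedAddGroupHom C C' := (φ : C →+ C').mkNormedAddGroupHom 1 fun a => by
    rw [one_mul]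
    exact NonUnitalStarAlgHom.norm_apply_le φ a
  have hf : f.SurjectiveOnWith f.range 2 := by
    rintro _ ⟨a, rfl⟩
    exact φ.exists_norm_le a
  intro c
  obtain ⟨a, ha, -⟩ := controlled_closure_of_complete two_pos one_pos hf c (h c)
  exact ⟨a, ha⟩

end ClosedRange

/-! ### The universal covariant representation -/

section Block

variable {ι : Type*} {E : ι → Type*} [∀ i, NormedAddCommGroup (E i)]
  [∀ i, InnerProductSpace ℂ (E i)]

/-- The direct sum of a bounded family of operators. -/
def blockOp (T : ∀ i, E i →L[ℂ] E i) (C : ℝ) (hC : ∀ i, ‖T i‖ ≤ C) : lp E 2 →L[ℂ] lp E 2 :=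
  weightedShift (Equiv.refl ι) T C hC

theorem blockOp_apply (T : ∀ i, E i →L[ℂ] E i) (C : ℝ) (hC : ∀ i, ‖T i‖ ≤ C) (f : lp E 2) (i : ι) :
    blockOp T C hC f i = T i (f i) := rfl

theorem blockOp_single [DecidableEq ι] (T : ∀ i, E i →L[ℂ] E i) (C : ℝ) (hC : ∀ i, ‖T i‖ ≤ C)
    (i : ι) (v : E i) : blockOp T C hC (lp.single 2 i v) = lp.single 2 i (T i v) := by
  ext j
  rw [blockOp_apply]
  by_cases h : j = i
  · subst h
    rw [lp.single_apply_self, lp.single_apply_self]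
  · rw [lp.single_apply_ne _ _ _ h, lp.single_apply_ne _ _ _ h, map_zero]

variable [∀ i, CompleteSpace (E i)]

theorem star_blockOp (T T' : ∀ i, E i →L[ℂ] E i) (C C' : ℝ) (hC : ∀ i, ‖T i‖ ≤ C)
    (hC' : ∀ i, ‖T' i‖ ≤ C') (h : ∀ i, star (T i) = T' i) :
    star (blockOp T C hC) = blockOp T' C' hC' := by
  refine Eq.symm ((ContinuousLinearMap.eq_adjoint_iff _ _).mpr fun f g => ?_)
  rw [lp.inner_eq_tsum, lp.inner_eq_tsum]
  refine tsum_congr fun i => ?_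
  rw [blockOp_apply, blockOp_apply, ← h, ContinuousLinearMap.star_eq_adjoint,
    ContinuousLinearMap.adjoint_inner_left]

/-- The direct sum of a family of representations. -/
def blockRep {A : Type*} [CStarAlgebra A] (π : ∀ i, A →⋆ₐ[ℂ] (E i →L[ℂ] E i)) :
    A →⋆ₐ[ℂ] (lp E 2 →L[ℂ] lp E 2) where
  toFun a := blockOp (fun i => π i a) ‖a‖ fun i => NonUnitalStarAlgHom.norm_apply_le (π i) a
  map_one' := by
    ext f i
    rw [blockOp_apply, map_one]
    rfl
  map_mul' a b := by
    ext f i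
    rw [blockOp_apply, map_mul]
    rfl
  map_zero' := by
    ext f i
    rw [blockOp_apply, map_zero]
    rfl
  map_add' a b := by
    ext f i
    rw [blockOp_apply, map_add]
    rfl
  commutes' c := by
    ext f i
    rw [blockOp_apply, AlgHomClass.commutes]
    rfl
  map_star' a := (star_blockOp _ _ _ _ _ _ fun i => (map_star (π i) a).symm).symm

theorem norm_coe_unitary_clm_le {K : Type*} [NormedAddCommGroup K] [InnerProductSpace ℂ K]
    [CompleteSpace K] (U : unitary (K →L[ℂ] K)) : ‖(U : K →L[ℂ] K)‖ ≤ 1 :=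
  ContinuousLinearMap.opNorm_le_bound _ zero_le_one fun k => by
    rw [ContinuousLinearMap.norm_map_of_mem_unitary U.2, one_mul]

theorem star_blockOp_unitary_apply (U : ∀ i, unitary (E i →L[ℂ] E i)) (f : lp E 2) (i : ι) :
    star (blockOp (fun i => (U i : E i →L[ℂ] E i)) 1 fun i => norm_coe_unitary_clm_le (U i)) f i =
      star (U i : E i →L[ℂ] E i) (f i) := by
  rw [star_blockOp _ (fun i => star (U i : E i →L[ℂ] E i)) _ 1 _
    (fun i => norm_coe_unitary_clm_le (star (U i))) fun i => rfl]
  rfl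

/-- The direct sum of a family of unitaries. -/
def blockUnitary (U : ∀ i, unitary (E i →L[ℂ] E i)) : unitary (lp E 2 →L[ℂ] lp E 2) :=
  ⟨blockOp (fun i => (U i : E i →L[ℂ] E i)) 1 fun i => norm_coe_unitary_clm_le (U i), by
    rw [Unitary.mem_iff]
    constructor
    · ext f i
      rw [mul_apply_eq_comp, star_blockOp_unitary_apply]
      exact DFunLike.congr_fun (Unitary.star_mul_self_of_mem (U i).2) (f i)
    · ext f i
      rw [mul_apply_eq_comp, blockOp_apply, star_blockOp_unitary_apply]
      exact DFunLike.congr_fun (Unitary.mul_star_self_of_mem (U i).2) (f i)⟩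

open Classical in
/-- The inclusion of a summand in a Hilbert space direct sum. -/
def blockIncl (E : ι → Type*) [∀ i, NormedAddCommGroup (E i)] [∀ i, InnerProductSpace ℂ (E i)]
    (i : ι) : E i →ₗᵢ[ℂ] lp E 2 where
  toLinearMap := lp.lsingle 2 i
  norm_map' v := lp.norm_single (by simp) i v

end Block

section Universal

variable {A G : Type u} [CStarAlgebra A] [Group G] (S : TwistedSystem A G)

/-- The direct sum of all covariant representations. -/
def univRep : CovariantRep S (UnivSpace S) where
  π := blockRep fun R : SomeCovariantRep S => R.rep.π
  U x := blockUnitary fun R : SomeCovariantRep S => R.rep.U x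
  mul x y := by
    ext f R
    exact DFunLike.congr_fun (R.rep.mul x y) (f R)
  cov x a := by
    ext f R
    refine (DFunLike.congr_fun (R.rep.cov x a) (f R)).trans ?_
    exact congrArg (fun k => (R.rep.U x : R.K →L[ℂ] R.K) (R.rep.π a k))
      (star_blockOp_unitary_apply (fun R : SomeCovariantRep S => R.rep.U x) f R).symm

theorem univRep_op (a : A) (x : G) : (univRep S).op a x = univOp S a x := by
  ext f R
  rfl

end Universal

/-! ### The integrated form and the coaction -/

theorem IsGenerating.mono {C : Type*} [CStarAlgebra C] {g g' : Set C} (hg : IsGenerating g)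
    (h : g ⊆ g') : IsGenerating g' := fun B hB hB' => hg B hB (h.trans hB')

theorem OpAlg.norm_val {K : Type*} [NormedAddCommGroup K] [InnerProductSpace ℂ K] [CompleteSpace K]
    {s : Set (K →L[ℂ] K)} (x : OpAlg s) : ‖OpAlg.val s x‖ = ‖x‖ := rfl

/-! ### Compressions of tensor products -/

section Reducing

open HilbertTensor

variable {K : Type*} [NormedAddCommGroup K] [InnerProductSpace ℂ K]
  {L : Type*} [NormedAddCommGroup L] [InnerProductSpace ℂ L]
  {F : Type*} [NormedAddCommGroup F] [InnerProductSpace ℂ F]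

theorem tensorOp_mapIsometry_id {J : L →ₗᵢ[ℂ] K} {T : K →L[ℂ] K} {Y : L →L[ℂ] L}
    (h : ∀ ξ, T (J ξ) = J (Y ξ)) (Z : F →L[ℂ] F) (ζ : HilbertTensor L F) :
    tensorOp T Z (mapIsometry J LinearIsometry.id ζ) =
      mapIsometry J LinearIsometry.id (tensorOp Y Z ζ) := by
  have : tensorOp T Z ∘L (mapIsometry J LinearIsometry.id).toContinuousLinearMap =
      (mapIsometry J LinearIsometry.id).toContinuousLinearMap ∘L tensorOp Y Z := by
    refine clm_ext' fun x y => ?_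
    change tensorOp T Z (mapIsometry J LinearIsometry.id (tmulL x y)) =
      mapIsometry J LinearIsometry.id (tensorOp Y Z (tmulL x y))
    rw [mapIsometry_tmulL, tensorOp_tmulL, tensorOp_tmulL, mapIsometry_tmulL, h]
    rfl
  exact DFunLike.congr_fun this ζ

variable [CompleteSpace K]

theorem mem_reducingAlg_of_intertwines {J : L →ₗᵢ[ℂ] K} {T : K →L[ℂ] K} {Y Y' : L →L[ℂ] L}
    (h : ∀ ξ, T (J ξ) = J (Y ξ)) (h' : ∀ ξ, star T (J ξ) = J (Y' ξ)) : T ∈ reducingAlg J :=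
  ⟨fun ξ => ⟨Y ξ, (h ξ).symm⟩, fun ξ => ⟨Y' ξ, (h' ξ).symm⟩⟩

variable [CompleteSpace L] [CompleteSpace F]

variable {s : Set (K →L[ℂ] K)} {t : Set (F →L[ℂ] F)}

theorem tensorGen_subset_reducingAlg {J : L →ₗᵢ[ℂ] K} (hs : s ⊆ reducingAlg J) :
    tensorGen s t ⊆ reducingAlg (mapIsometry J (LinearIsometry.id : F →ₗᵢ[ℂ] F)) := by
  rintro _ ⟨b, c, rfl⟩
  refine mem_reducingAlg_of_intertwines
    (tensorOp_mapIsometry_id (fun ξ => (compression_apply J hs b ξ).symm) _) ?_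
    (Y' := tensorOp (compression J hs (star b)) (star (OpAlg.val t c)))
  intro ζ
  rw [← tensorOp_star, ← map_star]
  exact tensorOp_mapIsometry_id (fun ξ => (compression_apply J hs (star b) ξ).symm) _ ζ

/-- Compressing along `J ⊗ 1` realises the tensor product of a compression with the identity. This
is how the integrated form extends to the minimal tensor products. -/
theorem compression_tmul {J : L →ₗᵢ[ℂ] K} (hs : s ⊆ reducingAlg J) (b : OpAlg s) (c : OpAlg t) :
    compression (mapIsometry J LinearIsometry.id) (tensorGen_subset_reducingAlg (t := t) hs)
      (MinTensor.tmul b c) = tensorOp (compression J hs b) (OpAlg.val t c) :=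
  compression_gen _ _ _ fun ζ =>
    tensorOp_mapIsometry_id (fun ξ => (compression_apply J hs b ξ).symm) _ ζ

end Reducing

/-! ### Full, reduced and represented crossed products -/

section Crossed

variable {A G : Type u} [CStarAlgebra A] [Group G] {S : TwistedSystem A G}
  {H : Type u} [NormedAddCommGroup H] [InnerProductSpace ℂ H] [CompleteSpace H]

theorem isCrossedFamily_univOp (S : TwistedSystem A G) : IsCrossedFamily S (univOp S) := by
  have h := (univRep S).isCrossedFamily
  rwa [show (univRep S).op = univOp S from funext₂ (univRep_op S)] at h

theorem isCrossedFamily_fullδ (S : TwistedSystem A G) : IsCrossedFamily S (fullδ S) :=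
  IsCrossedFamily.of_map (OpAlg.val_injective (univGen S)) (isCrossedFamily_univOp S)

theorem isCrossedFamily_tmul_fullδ (S : TwistedSystem A G) :
    IsCrossedFamily S fun a x => MinTensor.tmul (fullδ S a x) (grpδ x) := by
  refine IsCrossedFamily.of_map (OpAlg.val_injective (tensorGen (univGen S) (grpGen G))) ?_
  have h := (univRep S).isCrossedFamily_absorbed
  simp only [univRep_op] at h
  exact h

namespace CovariantRep

variable (R : CovariantRep S H)

theorem isCrossedFamily_repδ : IsCrossedFamily S (repδ R) :=
  IsCrossedFamily.of_map (OpAlg.val_injective (repGen R)) R.isCrossedFamily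

theorem isGenerating_repδ : IsGenerating {t | ∃ a x, t = repδ R a x} :=
  (OpAlg.isGenerating (repGen R)).mono (by rintro _ ⟨_, ⟨a, x, rfl⟩, rfl⟩; exact ⟨a, x, rfl⟩)

theorem isCrossedFamily_redδ : IsCrossedFamily S (redδ S R.π) :=
  IsCrossedFamily.of_map (OpAlg.val_injective (regGen S R.π)) R.isCrossedFamily_induced

theorem isGenerating_redδ : IsGenerating {t | ∃ a x, t = redδ S R.π a x} :=
  (OpAlg.isGenerating (regGen S R.π)).mono
    (by rintro _ ⟨_, ⟨a, x, rfl⟩, rfl⟩; exact ⟨a, x, rfl⟩)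

/-- The inclusion of the Hilbert space of a covariant representation in that of the universal
one. -/
def univIncl : H →ₗᵢ[ℂ] UnivSpace S :=
  blockIncl (fun R : SomeCovariantRep S => R.K) (SomeCovariantRep.mk H R)

/-- The representation `R` is itself one of the summands, because `H` lives in the universe over
which the direct sum is taken. -/
theorem univOp_univIncl (a : A) (x : G) (ξ : H) :
    univOp S a x (R.univIncl ξ) = R.univIncl (R.op a x ξ) := by
  classical
  exact blockOp_single (E := fun R : SomeCovariantRep S => R.K) _ _
    (fun R => R.rep.norm_op_le a x) (SomeCovariantRep.mk H R) ξ

theorem univGen_subset_reducingAlg : univGen S ⊆ reducingAlg R.univIncl := by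
  rintro _ ⟨a, x, rfl⟩
  refine mem_reducingAlg_of_intertwines (R.univOp_univIncl a x)
    (Y' := R.op (star (S.σ x⁻¹ x : A) * S.ρ x⁻¹ (star a)) x⁻¹) fun ξ => ?_
  rw [(isCrossedFamily_univOp S).star]
  exact R.univOp_univIncl _ _ ξ

theorem compression_fullδ (a : A) (x : G) :
    compression R.univIncl R.univGen_subset_reducingAlg (fullδ S a x) = R.op a x :=
  compression_gen _ _ _ (R.univOp_univIncl a x)

/-- The integrated form of a covariant representation. -/
def integratedForm : FullCrossed S →⋆ₐ[ℂ] RepAlg R :=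
  OpAlg.codRestrict (compression R.univIncl R.univGen_subset_reducingAlg) (by
    rintro _ ⟨a, x, rfl⟩
    exact (R.compression_fullδ a x).symm ▸ mem_cstarGen ⟨a, x, rfl⟩)

theorem integratedForm_fullδ (a : A) (x : G) : R.integratedForm (fullδ S a x) = repδ R a x :=
  OpAlg.val_injective _ (R.compression_fullδ a x)

/-- The range contains all finite sums of the generators `π(a) Uₓ`, which are dense in `B`. -/
theorem integratedForm_surjective : Function.Surjective R.integratedForm := by
  refine R.integratedForm.surjective_of_denseRange
    ((R.isCrossedFamily_repδ.denseRange_sum R.isGenerating_repδ).mono ?_)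
  rintro _ ⟨f, rfl⟩
  exact ⟨_, (isCrossedFamily_fullδ S).sum_map R.isCrossedFamily_repδ R.integratedForm
    R.integratedForm_fullδ f⟩

/-- The tensor product of the integrated form with the identity. -/
def integratedFormTensor :
    MinTensor (univGen S) (grpGen G) →⋆ₐ[ℂ] MinTensor (repGen R) (grpGen G) :=
  OpAlg.codRestrict (compression (HilbertTensor.mapIsometry R.univIncl LinearIsometry.id)
    (tensorGen_subset_reducingAlg R.univGen_subset_reducingAlg)) (by
      rintro _ ⟨b, c, rfl⟩
      exact (compression_tmul R.univGen_subset_reducingAlg b c).symm ▸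
        mem_cstarGen ⟨R.integratedForm b, c, rfl⟩)

theorem integratedFormTensor_tmul (b : FullCrossed S) (c : ReducedGroupAlg G) :
    R.integratedFormTensor (MinTensor.tmul b c) = MinTensor.tmul (R.integratedForm b) c :=
  OpAlg.val_injective _ (compression_tmul R.univGen_subset_reducingAlg b c)

/-- On finite sums the norm of the target is that of the universal representation tensored with `λ`,
which the regular representation of the faithful `R.π` dominates. -/
theorem exists_coaction (hR : Function.Injective R.π) :
    ∃ φ : ReducedCrossed S R.π →⋆ₐ[ℂ] MinTensor (univGen S) (grpGen G),
      ∀ a x, φ (redδ S R.π a x) = MinTensor.tmul (fullδ S a x) (grpδ x) := by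
  refine R.isCrossedFamily_redδ.exists_hom (isCrossedFamily_tmul_fullδ S) R.isGenerating_redδ
    fun f => ?_
  have h1 := (isCrossedFamily_tmul_fullδ S).sum_map (univRep S).isCrossedFamily_absorbed
    (OpAlg.val (tensorGen (univGen S) (grpGen G))) (fun a x => by rw [univRep_op]; rfl) f
  have h2 := R.isCrossedFamily_redδ.sum_map R.isCrossedFamily_induced
    (OpAlg.val (regGen S R.π)) (fun a x => rfl) f
  rw [← OpAlg.norm_val, h1, ← OpAlg.norm_val, h2]
  exact R.norm_absorbed_sum_le hR (univRep S) f

/-- Conjugation by the Fell unitary of `R` turns `ψ` into the inclusion of the reduced crossed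
product in the operators on `ℓ²(G, H)`. -/
theorem injective_of_redδ (ψ : ReducedCrossed S R.π →⋆ₐ[ℂ] MinTensor (repGen R) (grpGen G))
    (h : ∀ a x, ψ (redδ S R.π a x) = MinTensor.tmul (repδ R a x) (grpδ x)) :
    Function.Injective ψ := by
  have key : (R.fellEquiv.conjStarAlgEquiv.toStarAlgHom.comp (OpAlg.val _)).comp ψ =
      OpAlg.val (regGen S R.π) := by
    refine OpAlg.hom_ext ?_
    rintro _ ⟨a, x, rfl⟩
    change R.fellEquiv.conjStarAlgEquiv (OpAlg.val _ (ψ (redδ S R.π a x))) = regOp S R.π a x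
    rw [h]
    exact R.fellEquiv_conj a x
  refine Function.Injective.of_comp (f := R.fellEquiv.conjStarAlgEquiv.toStarAlgHom.comp
    (OpAlg.val (tensorGen (repGen R) (grpGen G)))) ?_
  rw [← StarAlgHom.coe_comp, key]
  exact OpAlg.val_injective _

end CovariantRep

end Crossed

/-! ### The representation of the exterior product -/

section DoubleHom

variable {E : Type*} [NormedAddCommGroup E] [InnerProductSpace ℂ E]

theorem stdGrading_mul_self : stdGrading E * stdGrading E = 1 := by
  ext p
  refine WithLp.ofLp_injective 2 (Prod.ext rfl ?_)
  exact neg_neg _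

theorem doubleOp_mul_stdGrading (T : E →L[ℂ] E) :
    doubleOp T * stdGrading E = stdGrading E * doubleOp T := by
  ext p
  refine WithLp.ofLp_injective 2 (Prod.ext rfl ?_)
  exact map_neg T _

variable [CompleteSpace E]

theorem star_doubleOp (T : E →L[ℂ] E) : star (doubleOp T) = doubleOp (star T) := by
  refine Eq.symm ((ContinuousLinearMap.eq_adjoint_iff _ _).mpr fun p q => ?_)
  rw [WithLp.prod_inner_apply, WithLp.prod_inner_apply]
  change inner ℂ (star T p.fst) q.fst + inner ℂ (star T p.snd) q.snd =
    inner ℂ p.fst (T q.fst) + inner ℂ p.snd (T q.snd)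
  rw [ContinuousLinearMap.star_eq_adjoint, ContinuousLinearMap.adjoint_inner_left,
    ContinuousLinearMap.adjoint_inner_left]

/-- `T ↦ T ⊕ T` as a unital `*`-homomorphism. -/
def doubleHom (E : Type*) [NormedAddCommGroup E] [InnerProductSpace ℂ E] [CompleteSpace E] :
    (E →L[ℂ] E) →⋆ₐ[ℂ] (Double E →L[ℂ] Double E) where
  toFun := doubleOp
  map_one' := rfl
  map_mul' _ _ := rfl
  map_zero' := rfl
  map_add' _ _ := rfl
  commutes' _ := rfl
  map_star' T := (star_doubleOp T).symm

theorem isSelfAdjoint_stdGrading : IsSelfAdjoint (stdGrading E) := by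
  refine Eq.symm ((ContinuousLinearMap.eq_adjoint_iff _ _).mpr fun p q => ?_)
  rw [WithLp.prod_inner_apply, WithLp.prod_inner_apply]
  change inner ℂ p.fst q.fst + inner ℂ (-p.snd) q.snd =
    inner ℂ p.fst q.fst + inner ℂ p.snd (-q.snd)
  rw [inner_neg_left, inner_neg_right]

end DoubleHom

/-! ### Amplification by `V` -/

section AssocHom

open HilbertTensor ContinuousLinearMap

variable {E : Type*} [NormedAddCommGroup E] [InnerProductSpace ℂ E]
  {F : Type*} [NormedAddCommGroup F] [InnerProductSpace ℂ F]
  {V : Type*} [NormedAddCommGroup V] [InnerProductSpace ℂ V]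

/-- The isometry `x ⊗ y ↦ x ⊗ (y ⊗ v)` for a unit vector `v`. -/
def assocIncl (E F : Type*) [NormedAddCommGroup E] [InnerProductSpace ℂ E]
    [NormedAddCommGroup F] [InnerProductSpace ℂ F] (v : V) (hv : ‖v‖ = 1) :
    HilbertTensor E F →L[ℂ] HilbertTensor E (HilbertTensor F V) :=
  (mapIsometry LinearIsometry.id (tmulRight F v hv)).toContinuousLinearMap

theorem assocIncl_tmulL (v : V) (hv : ‖v‖ = 1) (x : E) (y : F) :
    assocIncl E F v hv (tmulL x y) = tmulL x (tmulL y v) :=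
  mapIsometry_tmulL _ _ x y

theorem adjoint_assocIncl_tmulL (v : V) (hv : ‖v‖ = 1) (x : E) (y : F) (w : V) :
    adjoint (assocIncl E F v hv) (tmulL x (tmulL y w)) = inner ℂ v w • tmulL x y := by
  refine ext_inner_right ℂ fun ζ => ?_
  rw [adjoint_inner_left]
  have h : innerSL ℂ (tmulL x (tmulL y w)) ∘L assocIncl E F v hv =
      innerSL ℂ (inner ℂ v w • tmulL x y) := by
    refine clm_ext' fun x' y' => ?_
    rw [ContinuousLinearMap.comp_apply, assocIncl_tmulL, innerSL_apply_apply, innerSL_apply_apply,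
      inner_tmulL, inner_tmulL, inner_smul_left, inner_tmulL, inner_conj_symm]
    ring
  exact DFunLike.congr_fun h ζ

theorem clm_ext_assoc {K : Type*} [NormedAddCommGroup K] [NormedSpace ℂ K]
    {X Y : HilbertTensor E (HilbertTensor F V) →L[ℂ] K}
    (h : ∀ x y v, X (tmulL x (tmulL y v)) = Y (tmulL x (tmulL y v))) : X = Y := by
  refine clm_ext (dense_span_univ E) (dense_span_tmulL (dense_span_univ F) (dense_span_univ V)) ?_
  rintro x - _ ⟨y, -, v, -, rfl⟩
  exact h x y v

variable [FiniteDimensional ℂ V]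

/-- The `*`-homomorphism with `X ⊗ Y ↦ X ⊗ (Y ⊗ 1)`. -/
def assocHom (E F V : Type*) [NormedAddCommGroup E] [InnerProductSpace ℂ E]
    [NormedAddCommGroup F] [InnerProductSpace ℂ F] [NormedAddCommGroup V] [InnerProductSpace ℂ V]
    [FiniteDimensional ℂ V] :
    (HilbertTensor E F →L[ℂ] HilbertTensor E F) →⋆ₐ[ℂ]
      (HilbertTensor E (HilbertTensor F V) →L[ℂ] HilbertTensor E (HilbertTensor F V)) :=
  -- An orthonormal basis of `V` splits `E ⊗ (F ⊗ V)` into finitely many copies of `E ⊗ F`.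
  copiesHom (fun i => assocIncl E F (stdOrthonormalBasis ℂ V i) (OrthonormalBasis.norm_eq_one _ i))
    (fun i j => by
      refine clm_ext' fun x y => ?_
      rw [ContinuousLinearMap.comp_apply, assocIncl_tmulL, adjoint_assocIncl_tmulL,
        OrthonormalBasis.inner_eq_ite]
      split_ifs <;> simp)
    (by
      refine clm_ext_assoc fun x y v => ?_
      rw [_root_.sum_apply]
      simp only [ContinuousLinearMap.comp_apply, adjoint_assocIncl_tmulL, map_smul,
        assocIncl_tmulL]
      conv_rhs => rw [← (stdOrthonormalBasis ℂ V).sum_repr' v]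
      simp only [map_sum, map_smul]
      rfl)

theorem assocHom_tensorOp (X : E →L[ℂ] E) (Y : F →L[ℂ] F) :
    assocHom E F V (tensorOp X Y) = tensorOp X (tensorOp Y 1) := by
  refine copiesHom_apply_eq _ _ _ fun i => clm_ext' fun x y => ?_
  rw [ContinuousLinearMap.comp_apply, ContinuousLinearMap.comp_apply, tensorOp_tmulL,
    assocIncl_tmulL, assocIncl_tmulL, tensorOp_tmulL, tensorOp_tmulL]
  rfl

end AssocHom

/-! ### Algebraic tensor products inside the minimal one -/

section ElementaryTensors

variable {K : Type*} [NormedAddCommGroup K] [InnerProductSpace ℂ K] [CompleteSpace K]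
  {L : Type*} [NormedAddCommGroup L] [InnerProductSpace ℂ L] [CompleteSpace L]
  {s : Set (K →L[ℂ] K)} {t : Set (L →L[ℂ] L)}

namespace MinTensor

theorem tmul_one_one : tmul (1 : OpAlg s) (1 : OpAlg t) = 1 :=
  OpAlg.val_injective _ (by rw [val_tmul, map_one, map_one, map_one, tensorOp_one])

theorem tmul_mul_tmul (b b' : OpAlg s) (c c' : OpAlg t) :
    tmul b c * tmul b' c' = tmul (b * b') (c * c') :=
  OpAlg.val_injective _ (by
    rw [map_mul, val_tmul, val_tmul, val_tmul, map_mul, map_mul, tensorOp_mul])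

theorem star_tmul (b : OpAlg s) (c : OpAlg t) : star (tmul b c) = tmul (star b) (star c) :=
  OpAlg.val_injective _ (by rw [map_star, val_tmul, val_tmul, map_star, map_star, tensorOp_star])

theorem continuous_tmul : Continuous fun p : OpAlg s × OpAlg t => tmul p.1 p.2 := by
  refine (OpAlg.isometry_val (tensorGen s t)).isUniformInducing.isInducing.continuous_iff.mpr ?_
  have h1 := (OpAlg.isometry_val s).continuous
  have h2 := (OpAlg.isometry_val t).continuous
  exact ((tensorOpL K L).continuous.comp (h1.comp continuous_fst)).clm_apply
    (h2.comp continuous_snd)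

/-- The algebraic tensor product of two subspaces. -/
def algTensor (𝒞 : Submodule ℂ (OpAlg s)) (𝒟 : Submodule ℂ (OpAlg t)) :
    Submodule ℂ (MinTensor s t) :=
  Submodule.span ℂ {x | ∃ b ∈ 𝒞, ∃ c ∈ 𝒟, x = tmul b c}

variable {𝒞 : Submodule ℂ (OpAlg s)} {𝒟 : Submodule ℂ (OpAlg t)}

theorem one_mem_algTensor (h : 1 ∈ 𝒞) (h' : 1 ∈ 𝒟) : 1 ∈ algTensor 𝒞 𝒟 :=
  Submodule.subset_span ⟨1, h, 1, h', tmul_one_one.symm⟩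

theorem mul_mem_algTensor (h : ∀ a ∈ 𝒞, ∀ b ∈ 𝒞, a * b ∈ 𝒞) (h' : ∀ a ∈ 𝒟, ∀ b ∈ 𝒟, a * b ∈ 𝒟)
    {x y : MinTensor s t} (hx : x ∈ algTensor 𝒞 𝒟) (hy : y ∈ algTensor 𝒞 𝒟) :
    x * y ∈ algTensor 𝒞 𝒟 := by
  refine mul_mem_span_of_mul_mem ?_ hx hy
  rintro _ ⟨b, hb, c, hc, rfl⟩ _ ⟨b', hb', c', hc', rfl⟩
  rw [tmul_mul_tmul]
  exact Submodule.subset_span ⟨_, h b hb b' hb', _, h' c hc c' hc', rfl⟩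

theorem star_mem_algTensor (h : ∀ a ∈ 𝒞, star a ∈ 𝒞) (h' : ∀ a ∈ 𝒟, star a ∈ 𝒟)
    {x : MinTensor s t} (hx : x ∈ algTensor 𝒞 𝒟) : star x ∈ algTensor 𝒞 𝒟 := by
  refine star_mem_span_of_star_mem ?_ hx
  rintro _ ⟨b, hb, c, hc, rfl⟩
  rw [star_tmul]
  exact Submodule.subset_span ⟨_, h b hb, _, h' c hc, rfl⟩

theorem dense_algTensor (h1 : 1 ∈ 𝒞) (h1' : 1 ∈ 𝒟) (hm : ∀ a ∈ 𝒞, ∀ b ∈ 𝒞, a * b ∈ 𝒞)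
    (hm' : ∀ a ∈ 𝒟, ∀ b ∈ 𝒟, a * b ∈ 𝒟) (hs : ∀ a ∈ 𝒞, star a ∈ 𝒞) (hs' : ∀ a ∈ 𝒟, star a ∈ 𝒟)
    (hd : Dense (𝒞 : Set (OpAlg s))) (hd' : Dense (𝒟 : Set (OpAlg t))) :
    Dense (algTensor 𝒞 𝒟 : Set (MinTensor s t)) := by
  refine (OpAlg.isGenerating (tensorGen s t)).dense _ (one_mem_algTensor h1 h1')
    (fun a ha b hb => mul_mem_algTensor hm hm' ha hb) (fun a ha => star_mem_algTensor hs hs' ha) ?_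
  rintro _ ⟨_, ⟨b, c, rfl⟩, rfl⟩
  exact map_mem_closure₂ (f := tmul) continuous_tmul (hd b) (hd' c) fun b' hb' c' hc' =>
    Submodule.subset_span ⟨b', hb', c', hc', rfl⟩

end MinTensor

end ElementaryTensors

/-! ### Spectral triples -/

section Triples

theorem hasBoundedCommutator_of_mem_span {C : Type*} [CStarAlgebra C] {E : Type*}
    [NormedAddCommGroup E] [InnerProductSpace ℂ E] [CompleteSpace E] {D : E →ₗ.[ℂ] E}
    (π : C →⋆ₐ[ℂ] (E →L[ℂ] E)) {g : Set C} (h : ∀ a ∈ g, HasBoundedCommutator D (π a)) {a : C}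
    (ha : a ∈ Submodule.span ℂ g) : HasBoundedCommutator D (π a) := by
  have hle : Submodule.span ℂ g ≤ (boundedCommutators D).comap π.toAlgHom.toLinearMap :=
    Submodule.span_le.mpr h
  exact hle ha

variable {A : Type u} [CStarAlgebra A] {H : Type v} [NormedAddCommGroup H]
    [InnerProductSpace ℂ H] [CompleteSpace H]

/-- The analytic conditions involve only the Dirac operator, the grading and operators `P.rep (ψ
a)`, so they are inherited. The conditions on the smooth subalgebra are not. -/
theorem IsEvenSpectralTriple.pullback {A' : Type w} [CStarAlgebra A'] {ψ : A' →⋆ₐ[ℂ] A}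
    {P : EvenTripleData A H} {Q : EvenTripleData A' H} (hP : IsEvenSpectralTriple P)
    (h : IsPullback ψ P Q) (one_mem : (1 : A') ∈ Q.alg)
    (mul_mem : ∀ a ∈ Q.alg, ∀ b ∈ Q.alg, a * b ∈ Q.alg)
    (star_mem : ∀ a ∈ Q.alg, star a ∈ Q.alg) (dense : Dense (Q.alg : Set A')) :
    IsEvenSpectralTriple Q := by
  obtain ⟨⟨alg, rep, dirac⟩, grading⟩ := Q
  obtain ⟨hs, hr, hd, hg⟩ := h
  dsimp only at hs hr hd hg one_mem mul_mem star_mem dense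
  subst hr hd hg
  exact
    { one_mem, mul_mem, star_mem, dense
      selfAdjoint := hP.selfAdjoint
      compact := hP.compact
      commutator := fun a ha => hP.commutator (ψ a) (hs a ha)
      grading_selfAdjoint := hP.grading_selfAdjoint
      grading_sq := hP.grading_sq
      grading_comm := fun a => hP.grading_comm (ψ a)
      grading_dirac := hP.grading_dirac }

end Triples

/-! ### The triple on the reduced group C*-algebra -/

section Group

variable {G : Type u} [Group G]

theorem grpδ_one : grpδ (1 : G) = 1 :=
  OpAlg.val_injective (grpGen G) leftReg_one

theorem grpδ_mul (x y : G) : grpδ x * grpδ y = grpδ (x * y) :=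
  OpAlg.val_injective (grpGen G) (leftReg_mul x y)

theorem star_grpδ (x : G) : star (grpδ x) = grpδ x⁻¹ :=
  OpAlg.val_injective (grpGen G) (star_leftReg x)

variable {V : Type v} [NormedAddCommGroup V] [InnerProductSpace ℂ V] [FiniteDimensional ℂ V]
  [CompleteSpace V] {ℓ : G → V →L[ℂ] V}

theorem isSpectralTriple_groupTriple (hℓ : IsProperLength ℓ) :
    IsSpectralTriple (groupTriple (V := V) ℓ) := by
  have h1 : (1 : ReducedGroupAlg G) ∈ Submodule.span ℂ (Set.range grpδ) :=
    Submodule.subset_span ⟨1, grpδ_one⟩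
  have hm : ∀ a ∈ Submodule.span ℂ (Set.range (grpδ (G := G))),
      ∀ b ∈ Submodule.span ℂ (Set.range grpδ), a * b ∈ Submodule.span ℂ (Set.range grpδ) := by
    refine fun a ha b hb => mul_mem_span_of_mul_mem ?_ ha hb
    rintro _ ⟨x, rfl⟩ _ ⟨y, rfl⟩
    rw [grpδ_mul]
    exact Submodule.subset_span ⟨_, rfl⟩
  have hs : ∀ a ∈ Submodule.span ℂ (Set.range (grpδ (G := G))),
      star a ∈ Submodule.span ℂ (Set.range grpδ) := by
    refine fun a ha => star_mem_span_of_star_mem ?_ ha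
    rintro _ ⟨x, rfl⟩
    rw [star_grpδ]
    exact Submodule.subset_span ⟨_, rfl⟩
  obtain ⟨hcl, hD⟩ := lengthDirac_eq_diagOp hℓ.selfAdjoint
  exact
    { one_mem := h1
      mul_mem := hm
      star_mem := hs
      dense := by
        refine (OpAlg.isGenerating (grpGen G)).dense _ h1 hm hs ?_
        rintro _ ⟨_, ⟨x, rfl⟩, rfl⟩
        exact subset_closure (Submodule.subset_span ⟨x, rfl⟩)
      selfAdjoint := by
        change IsSelfAdjoint (lengthDirac ℓ)
        rw [hD]
        exact isSelfAdjoint_diagOp _ _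
      compact := by
        change ∃ S, IsInvSqrtOneAddSq (lengthDirac ℓ) S ∧ _
        rw [hD]
        exact exists_isInvSqrtOneAddSq_diagOp _ _ hℓ.finite_lengthEigenvalue
      commutator := by
        refine fun a ha => hasBoundedCommutator_of_mem_span _ ?_ ha
        rintro _ ⟨x, rfl⟩
        exact (hasBoundedCommutator_lengthCore hℓ.translation x).closure hcl }

end Group

/-! ### The triple on `B` -/

section Rep

variable {A G H : Type u} [CStarAlgebra A] [Group G] [NormedAddCommGroup H]
  [InnerProductSpace ℂ H] [CompleteSpace H] {S : TwistedSystem A G}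

/-- The space and the operator are those of `T`. Smoothness of the action makes `ℬ` a `*`-algebra,
and the Leibniz rule bounds the commutators with `π(a) U_g`. -/
theorem isSpectralTriple_repTriple {T : TripleData A H} (hT : IsSpectralTriple T)
    (R : CovariantRep S H) (hπ : T.rep = R.π) (hsmooth : S.IsSmooth T.alg)
    (hequiv : ∀ g, HasBoundedCommutator T.dirac (R.U g : H →L[ℂ] H)) :
    IsSpectralTriple (repTriple R T.alg T.dirac) where
  one_mem := R.isCrossedFamily_repδ.one_mem_span hT.one_mem
  mul_mem _ ha _ hb := R.isCrossedFamily_repδ.mul_mem_span hT.mul_mem hsmooth ha hb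
  star_mem _ ha := R.isCrossedFamily_repδ.star_mem_span hT.mul_mem hT.star_mem hsmooth ha
  dense := R.isCrossedFamily_repδ.dense_span hT.one_mem hT.mul_mem hT.star_mem hT.dense hsmooth
    R.isGenerating_repδ
  selfAdjoint := hT.selfAdjoint
  compact := hT.compact
  commutator _ hb := by
    refine hasBoundedCommutator_of_mem_span _ ?_ hb
    rintro _ ⟨a, ha, g, rfl⟩
    exact (hπ ▸ hT.commutator a ha : HasBoundedCommutator T.dirac (R.π a)).mul (hequiv g)

end Rep

/-! ### The exterior product triple -/

section Exterior

variable {H₁ : Type u} [NormedAddCommGroup H₁] [InnerProductSpace ℂ H₁] [CompleteSpace H₁]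
  {H₂ : Type v} [NormedAddCommGroup H₂] [InnerProductSpace ℂ H₂] [CompleteSpace H₂]
  {K₁ : Type w} [NormedAddCommGroup K₁] [InnerProductSpace ℂ K₁] [CompleteSpace K₁]
  {K₂ : Type w'} [NormedAddCommGroup K₂] [InnerProductSpace ℂ K₂] [CompleteSpace K₂]
  {s₁ : Set (K₁ →L[ℂ] K₁)} {s₂ : Set (K₂ →L[ℂ] K₂)}

/-- The exterior product of two odd spectral triples is an even spectral triple, once the tensor
product of the representations exists. -/
theorem IsExteriorProduct.isEvenSpectralTriple {T₁ : TripleData (OpAlg s₁) H₁}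
    {T₂ : TripleData (OpAlg s₂) H₂}
    {P : EvenTripleData (MinTensor s₁ s₂) (Double (HilbertTensor H₁ H₂))}
    (hP : IsExteriorProduct T₁ T₂ P) (h₁ : IsSpectralTriple T₁) (h₂ : IsSpectralTriple T₂) :
    IsEvenSpectralTriple P := by
  obtain ⟨⟨alg, rep, dirac⟩, grading⟩ := P
  obtain ⟨ha, hr, hd, hg⟩ := hP
  dsimp only at ha hr hd hg
  subst ha hd hg
  obtain ⟨ι, b, μ, hμ, hb⟩ := exists_eigenbasis h₁.selfAdjoint h₁.compact
  obtain ⟨κ, c, ν, hν, hc⟩ := exists_eigenbasis h₂.selfAdjoint h₂.compact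
  obtain ⟨hcl, hD⟩ := prodDirac_eq_diagOp h₁.selfAdjoint.isFormalAdjoint
    h₂.selfAdjoint.isFormalAdjoint hb hc
  exact
    { one_mem := MinTensor.one_mem_algTensor h₁.one_mem h₂.one_mem
      mul_mem := fun x hx y hy => MinTensor.mul_mem_algTensor h₁.mul_mem h₂.mul_mem hx hy
      star_mem := fun x hx => MinTensor.star_mem_algTensor h₁.star_mem h₂.star_mem hx
      dense := MinTensor.dense_algTensor h₁.one_mem h₂.one_mem h₁.mul_mem h₂.mul_mem h₁.star_mem
        h₂.star_mem h₁.dense h₂.dense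
      selfAdjoint := by
        dsimp only
        rw [hD]
        exact isSelfAdjoint_diagOp _ _
      compact := by
        dsimp only
        rw [hD]
        exact exists_isInvSqrtOneAddSq_diagOp _ _ (finite_prodEigenvalue μ ν hμ hν)
      commutator := by
        refine fun x hx => hasBoundedCommutator_of_mem_span _ ?_ hx
        rintro _ ⟨b, hb, c, hc, rfl⟩
        dsimp only
        rw [hr]
        exact (h₁.commutator b hb).prodDirac (h₂.commutator c hc) hcl
      grading_selfAdjoint := isSelfAdjoint_stdGrading
      grading_sq := stdGrading_mul_self
      grading_comm := fun x => by
        have hcl' : IsClosed (StarSubalgebra.centralizer ℂ {stdGrading (HilbertTensor H₁ H₂)} :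
            Set (Double (HilbertTensor H₁ H₂) →L[ℂ] Double (HilbertTensor H₁ H₂))) := by
          rw [StarSubalgebra.coe_centralizer]
          exact Set.isClosed_centralizer _
        -- The representation is only known on elementary tensors. These generate, and the commutant
        -- of the grading is closed.
        have hx : rep x ∈ StarSubalgebra.centralizer ℂ {stdGrading (HilbertTensor H₁ H₂)} := by
          refine (OpAlg.isGenerating (tensorGen s₁ s₂)).hom_mem rep hcl' ?_ x
          rintro _ ⟨_, ⟨b, c, rfl⟩, rfl⟩
          have hbc : rep (MinTensor.tmul b c) * stdGrading (HilbertTensor H₁ H₂) =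
              stdGrading (HilbertTensor H₁ H₂) * rep (MinTensor.tmul b c) := by
            rw [hr, doubleOp_mul_stdGrading]
          rw [StarSubalgebra.mem_centralizer_iff]
          rintro _ rfl
          rw [isSelfAdjoint_stdGrading.star_eq]
          exact ⟨hbc.symm, hbc.symm⟩
        exact (((StarSubalgebra.mem_centralizer_iff ℂ).mp hx) _ rfl).1.symm
      grading_dirac := by
        have key : ∀ ξ : (prodDirac T₁.dirac T₂.dirac).domain,
            (stdGrading _ (ξ : Double (HilbertTensor H₁ H₂)),
              -stdGrading _ (prodDirac T₁.dirac T₂.dirac ξ)) ∈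
              (prodDirac T₁.dirac T₂.dirac).graph := fun ξ =>
          stdGrading_mem_graph_prodDirac hcl ((prodDirac T₁.dirac T₂.dirac).mem_graph ξ)
        refine ⟨fun ξ => LinearPMap.mem_domain_of_mem_graph (key ξ), fun ξ => ?_⟩
        exact ((LinearPMap.image_iff _).mpr (key ξ)).symm }

end Exterior

/-! ### Comparison of the two Dirac operators -/

section Main

variable {A G H : Type u} [CStarAlgebra A] [Group G] [NormedAddCommGroup H]
  [InnerProductSpace ℂ H] [CompleteSpace H] {S : TwistedSystem A G}
  {V : Type v} [NormedAddCommGroup V] [InnerProductSpace ℂ V] [FiniteDimensional ℂ V]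
  [CompleteSpace V]

/-- The exterior product of the triple on `B` with the length triple. -/
def exteriorTriple (R : CovariantRep S H) (𝒜 : Submodule ℂ A) (D : H →ₗ.[ℂ] H)
    (ℓ : G → V →L[ℂ] V) : EvenTripleData (MinTensor (repGen R) (grpGen G))
      (Double (HilbertTensor H (HilbertTensor (L2 G) V))) where
  alg := MinTensor.algTensor (repTriple R 𝒜 D).alg (groupTriple ℓ).alg
  rep := (doubleHom _).comp ((assocHom H (L2 G) V).comp (OpAlg.val _))
  dirac := prodDirac D (lengthDirac ℓ)
  grading := stdGrading _

theorem isExteriorProduct_exteriorTriple (R : CovariantRep S H) (𝒜 : Submodule ℂ A)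
    (D : H →ₗ.[ℂ] H) (ℓ : G → V →L[ℂ] V) :
    IsExteriorProduct (repTriple R 𝒜 D) (groupTriple ℓ) (exteriorTriple R 𝒜 D ℓ) where
  alg := rfl
  rep _ _ := congrArg doubleOp (assocHom_tensorOp _ _)
  dirac := rfl
  grading := rfl

/-- The operator of the exterior product does not change if the length operator is replaced by its
core. -/
theorem prodDirac_lengthCore {D : H →ₗ.[ℂ] H} (hD : IsSelfAdjoint D)
    (hS : ∃ S : H →L[ℂ] H, IsInvSqrtOneAddSq D S ∧ IsCompactOperator S) {ℓ : G → V →L[ℂ] V}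
    (hℓ : IsProperLength ℓ) : prodDirac D (lengthCore ℓ) = prodDirac D (lengthDirac ℓ) := by
  obtain ⟨ι, b, μ, -, hb⟩ := exists_eigenbasis hD hS
  have hsa : IsSelfAdjoint (lengthDirac ℓ) := (isSpectralTriple_groupTriple hℓ).selfAdjoint
  -- The same eigenvectors `δₓ ⊗ v` serve for the core and for its closure, so both exterior
  -- products are the same diagonal operator.
  rw [(prodDirac_eq_diagOp hD.isFormalAdjoint (isFormalAdjoint_lengthCore hℓ.selfAdjoint) hb
      (lengthEigenbasis_mem_graph hℓ.selfAdjoint)).2,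
    (prodDirac_eq_diagOp hD.isFormalAdjoint hsa.isFormalAdjoint hb fun p =>
      LinearPMap.le_graph_of_le (LinearPMap.le_closure _)
        (lengthEigenbasis_mem_graph hℓ.selfAdjoint p)).2]

end Main

end

theorem proposition3p8 {A G H : Type u} [CStarAlgebra A] [Group G]
    [NormedAddCommGroup H] [InnerProductSpace ℂ H] [CompleteSpace H]
    {V : Type v} [NormedAddCommGroup V] [InnerProductSpace ℂ V] [FiniteDimensional ℂ V]
    [CompleteSpace V]
    (S : TwistedSystem A G)
    -- an odd twisted equivariant spectral triple `(𝒜, H, D, π)` on `A`, with `π = R.π` faithful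
    (T : TripleData A H) (hT : IsSpectralTriple T)
    (R : CovariantRep S H) (hπ : T.rep = R.π) (hfaithful : Function.Injective R.π)
    (hsmooth : S.IsSmooth T.alg)
    (hequiv : ∀ g, HasBoundedCommutator T.dirac (R.U g : H →L[ℂ] H))
    (ℓ : G → V →L[ℂ] V) (hℓ : IsProperLength ℓ) :
    -- `Φ = π × U` is the integrated form, with image `B`; `Θ = Φ ⊗ id`; `Q` is the equivariant triple;
    -- `P` is the exterior product
    ∃ (Φ : FullCrossed S →⋆ₐ[ℂ] RepAlg R)
      (φ : ReducedCrossed S R.π →⋆ₐ[ℂ] MinTensor (univGen S) (grpGen G))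
      (Θ : MinTensor (univGen S) (grpGen G) →⋆ₐ[ℂ]
        MinTensor (repGen R) (grpGen G))
      (ψ : ReducedCrossed S R.π →⋆ₐ[ℂ] MinTensor (repGen R) (grpGen G))
      (Q : EvenTripleData (ReducedCrossed S R.π)
        (Double (HilbertTensor H (HilbertTensor (L2 G) V))))
      (P : EvenTripleData (MinTensor (repGen R) (grpGen G))
        (Double (HilbertTensor H (HilbertTensor (L2 G) V)))),
      (∀ a g, Φ (fullδ S a g) = repδ R a g) ∧ Function.Surjective Φ ∧
      Function.Injective φ ∧
      (∀ a g, φ (redδ S R.π a g) = MinTensor.tmul (fullδ S a g) (grpδ g)) ∧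
      -- `ψ = (Φ ⊗ id) ∘ φ`
      (∀ f c, Θ (MinTensor.tmul f c) = MinTensor.tmul (Φ f) c) ∧ ψ = Θ.comp φ ∧
      IsEquivariantTriple R T.alg T.dirac ℓ Q ∧ IsEvenSpectralTriple Q ∧
      IsSpectralTriple (repTriple R T.alg T.dirac) ∧ IsSpectralTriple (groupTriple (V := V) ℓ) ∧
      IsExteriorProduct (repTriple R T.alg T.dirac) (groupTriple ℓ) P ∧ IsEvenSpectralTriple P ∧
      IsRestriction ψ P Q := by
  obtain ⟨φ, hφ⟩ := R.exists_coaction hfaithful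
  set ψ := R.integratedFormTensor.comp φ with hψ
  have hψδ : ∀ a x, ψ (redδ S R.π a x) = MinTensor.tmul (repδ R a x) (grpδ x) := fun a x => by
    rw [hψ, StarAlgHom.comp_apply, hφ, R.integratedFormTensor_tmul, R.integratedForm_fullδ]
  have hinj : Function.Injective ψ := R.injective_of_redδ ψ hψδ
  have hrep := isSpectralTriple_repTriple hT R hπ hsmooth hequiv
  have hgrp := isSpectralTriple_groupTriple hℓ
  set P := exteriorTriple R T.alg T.dirac ℓ with hP
  have hext := isExteriorProduct_exteriorTriple R T.alg T.dirac ℓ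
  have hPtriple : IsEvenSpectralTriple P := hext.isEvenSpectralTriple hrep hgrp
  let Q : EvenTripleData (ReducedCrossed S R.π)
      (Double (HilbertTensor H (HilbertTensor (L2 G) V))) :=
    { alg := IsCrossedFamily.span (redδ S R.π) T.alg
      rep := P.rep.comp ψ
      dirac := prodDirac T.dirac (lengthCore ℓ)
      grading := stdGrading _ }
  have hpull : IsPullback ψ P Q :=
    { smooth := fun t ht => by
        have hle : IsCrossedFamily.span (redδ S R.π) T.alg ≤
            P.alg.comap ψ.toAlgHom.toLinearMap := by
          refine Submodule.span_le.mpr ?_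
          rintro _ ⟨a, ha, g, rfl⟩
          change ψ (redδ S R.π a g) ∈ P.alg
          rw [hψδ]
          exact Submodule.subset_span ⟨_, Submodule.subset_span ⟨a, ha, g, rfl⟩, _,
            Submodule.subset_span ⟨g, rfl⟩, rfl⟩
        exact hle ht
      rep := rfl
      -- The two Dirac operators are closures from different cores, so their equality is not
      -- definitional.
      dirac := prodDirac_lengthCore hT.selfAdjoint hT.compact hℓ
      grading := rfl }
  refine ⟨R.integratedForm, φ, R.integratedFormTensor, ψ, Q, P, R.integratedForm_fullδ,
    R.integratedForm_surjective, ?_, hφ, R.integratedFormTensor_tmul, rfl, ?_, ?_, hrep, hgrp, hext,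
    hPtriple, hinj, hpull⟩
  -- The coaction is the first factor of the injective map `ψ`.
  · exact Function.Injective.of_comp (f := R.integratedFormTensor) hinj
  · refine ⟨rfl, fun a h => ?_, rfl, rfl⟩
    change P.rep (ψ (redδ S R.π a h)) = _
    rw [hψδ]
    exact hext.rep _ _
  · have hfam := R.isCrossedFamily_redδ
    exact hPtriple.pullback hpull (hfam.one_mem_span hT.one_mem)
      (fun a ha b hb => hfam.mul_mem_span hT.mul_mem hsmooth ha hb)
      (fun a ha => hfam.star_mem_span hT.mul_mem hT.star_mem hsmooth ha)
      (hfam.dense_span hT.one_mem hT.mul_mem hT.star_mem hT.dense hsmooth R.isGenerating_redδ)
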